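/- Let $(M,g,J)$ be a Hermitian manifold, i.e. a complex manifold of dimension $n$ with a smooth $J$-invariant Riemannian metric $g$ on its real tangent bundle. In local holomorphic coordinates $(z^i)$ write $h_{i\bar j}=g(\partial_{z^i},\partial_{\bar z^j})$ ($g$ extended $\mathbb C$-bilinearly), $h^{i\bar j}$ for the inverse, $h^{i\bar j}h_{k\bar j}=\delta^i_k$, and $\omega=\sqrt{-1}\,h_{i\bar j}dz^i\wedge d\bar z^j$. Let $\nabla^{\mathrm{Ch},\mathbb R}$ be the real Chern connection (preserving $g$ and $J$, with the $(0,1)$-part of its restriction to $T^{1,0}M$ equal to $\bar\partial$), $\nabla^{\mathrm{SB},\mathbb R}$ the real Strominger–Bismut connection (preserving $g$ and $J$, with totally skew-symmetric torsion), and for $t\in\mathbb R$ let $\nabla^t=(1-t)\nabla^{\mathrm{Ch},\mathbb R}+t\nabla^{\mathrm{SB},\mathbb R}$ be the Gauduchon connection. For a connection $\nabla$ preserving $g$ and $J$ let $\rho(\nabla)$ be the restriction of its complexification to $T^{1,0}M$, with curvature components $R_{i\bar jk\bar\ell}=h\big(R(\partial_{z^i},\partial_{\bar z^j})\partial_{z^k},\partial_{\bar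 z^\ell}\big)$, where $R(X,Y)=\nabla_X\nabla_Y-\nabla_Y\nabla_X-\nabla_{[X,Y]}$. Denote the curvature of $\rho(\nabla^t)$ by $\mathfrak R(\omega,t)$ and that of the Chern connection by $\Theta$; let $\Gamma_{ij}^k$ be the coefficients of the Chern connection, $T_{ij}^k=\Gamma_{ij}^k-\Gamma_{ji}^k$. Then $$\mathfrak R_{i\bar jk\bar\ell}(\omega,t)=\Theta_{i\bar jk\bar\ell}+t(\Theta_{i\bar\ell k\bar j}+\Theta_{k\bar ji\bar\ell}-2\Theta_{i\bar jk\bar\ell})+t^2\big(T_{ik}^p\overline{T_{j\ell}^q}h_{p\bar q}-h^{p\bar q}h_{m\bar\ell}h_{k\bar r}T_{ip}^m\overline{T_{jq}^r}\big).$$ Let $\mathfrak{Ric}^{(a)}(\omega,t)=\sqrt{-1}\,\mathfrak{Ric}^{(a)}_{i\bar j}dz^i\wedge d\bar z^j$ with $\mathfrak{Ric}^{(1)}_{i\bar j}=h^{k\bar\ell}\mathfrak R_{i\bar jk\bar\ell}$, $\mathfrak{Ric}^{(2)}_{i\bar j}=h^{k\bar\ell}\mathfrak R_{k\bar\ell i\bar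 j}$, $\mathfrak{Ric}^{(3)}_{i\bar j}=h^{k\bar\ell}\mathfrak R_{i\bar\ell k\bar j}$, $\mathfrak{Ric}^{(4)}_{i\bar j}=h^{k\bar\ell}\mathfrak R_{k\bar ji\bar\ell}$, and $\Theta^{(1)}=\mathfrak{Ric}^{(1)}(\omega,0)$. Let $\partial^*,\bar\partial^*$ be the formal adjoints of $\partial,\bar\partial$ for the $L^2$ product $\int\langle\cdot,\cdot\rangle\,\omega^n/n!$ (where $\langle dz^i,dz^j\rangle=h^{i\bar j}$, and products of distinct members of a unitary coframe of $dz$'s and $d\bar z$'s are orthonormal), let $\Lambda$ be the contraction with $\omega$ (the pointwise adjoint of $\omega\wedge\cdot$, so that $\Lambda\omega=n$), and put $$T\boxdot T=h^{p\bar q}h_{k\bar\ell}T_{ip}^k\overline{T_{jq}^\ell}\,dz^i\wedge d\bar z^j,\qquad T\circ T=h^{p\bar q}h^{s\bar r}h_{k\bar j}h_{i\bar\ell}T_{sp}^k\overline{T_{rq}^\ell}\,dz^i\wedge d\bar z^j,$$ $$T((\partial^*\omega)^\#)=v^pT_{pi}^mh_{m\bar j}\,dz^i\wedge d\bar z^j,\qquad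 v^p=h^{p\bar q}(\partial^*\omega)_{\bar q}.$$ Then $\mathfrak{Ric}^{(1)}(\omega,t)=\Theta^{(1)}-t(\partial\partial^*\omega+\bar\partial\bar\partial^*\omega)$ and $$\begin{aligned} \mathfrak{Ric}^{(2)}(\omega,t)={}&\Theta^{(1)}-(1-2t)\sqrt{-1}\Lambda\partial\bar\partial\omega-(1-t)(\partial\partial^*\omega+\bar\partial\bar\partial^*\omega)+(1-t)^2\sqrt{-1}\,T\boxdot T-t^2\sqrt{-1}\,T\circ T,\\ \mathfrak{Ric}^{(3)}(\omega,t)={}&\Theta^{(1)}-t\sqrt{-1}\Lambda\partial\bar\partial\omega-(1-t)\partial\partial^*\omega-t\,\bar\partial\bar\partial^*\omega+(t-t^2)\sqrt{-1}\,T\boxdot T+t^2\,T((\partial^*\omega)^\#),\\ \mathfrak{Ric}^{(4)}(\omega,t)={}&\Theta^{(1)}-t\sqrt{-1}\Lambda\partial\bar\partial\omega-(1-t)\bar\partial\bar\partial^*\omega-t\,\partial\partial^*\omega+(t-t^2)\sqrt{-1}\,T\boxdot T+t^2\,\overline{T((\partial^*\omega)^\#)}. \end{aligned}$$ With $s^{(1)}(\omega,t)=h^{i\bar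 j}h^{k\bar\ell}\mathfrak R_{i\bar jk\bar\ell}(\omega,t)$, $s^{(2)}(\omega,t)=h^{i\bar\ell}h^{k\bar j}\mathfrak R_{i\bar jk\bar\ell}(\omega,t)$ and $s_{\mathrm C}=h^{i\bar j}h^{k\bar\ell}\Theta_{i\bar jk\bar\ell}$, $$s^{(1)}(\omega,t)=s_{\mathrm C}-2t\langle\partial\partial^*\omega,\omega\rangle,\qquad s^{(2)}(\omega,t)=s_{\mathrm C}-(1-2t)\langle\partial\partial^*\omega,\omega\rangle-t^2\big(2|\partial\omega|^2+|\partial^*\omega|^2\big).$$ The real Chern and Strominger–Bismut connections and the smooth forms $\partial^*\omega$, $\bar\partial^*\omega$ with these properties exist. -/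

import Mathlib

open scoped Manifold ContDiff BigOperators
open Complex

/-- A complex manifold (with holomorphic charts in `ℂⁿ`) is in particular a smooth real manifold. -/
instance isManifold_real_of_complex {n : ℕ} {M : Type*} [TopologicalSpace M]
    [ChartedSpace (Fin n → ℂ) M] [IsManifold 𝓘(ℂ, Fin n → ℂ) ω M] :
    IsManifold 𝓘(ℝ, Fin n → ℂ) ∞ M := by
  refine isManifold_of_contDiffOn _ _ _ fun e e' he he' => ?_
  have h := HasGroupoid.compatible (G := contDiffGroupoid ω 𝓘(ℂ, Fin n → ℂ)) he he'
  rw [contDiffGroupoid, mem_groupoid_of_pregroupoid] at h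
  have h1 : ContDiffOn ℂ ω _ _ := h.1
  exact (h1.restrict_scalars ℝ).of_le le_top

namespace HermitianGeometry

noncomputable section

/-! ### Complexified tangent vectors on (an open subset of) `ℂⁿ`

The real tangent space at a point of `ℂⁿ` is `ℂⁿ` with `J` = multiplication by `i`.  Its
complexification is `T^{1,0} ⊕ T^{0,1}`; the pair `(a, b)` stands for `∑ aⁱ ∂/∂zⁱ + ∑ bⁱ ∂/∂z̄ⁱ`.
The real vector `v` is `∑ vⁱ ∂/∂zⁱ + ∑ v̄ⁱ ∂/∂z̄ⁱ`. -/

/-- Complexified tangent vectors, in the frame `∂/∂zⁱ`, `∂/∂z̄ⁱ`. -/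
abbrev CTan (n : ℕ) : Type := (Fin n → ℂ) × (Fin n → ℂ)

variable {n : ℕ}

/-- The inclusion of real tangent vectors into complexified ones. -/
def toC (v : Fin n → ℂ) : CTan n := (v, star v)

/-- `Z = reC Z + √-1 · imC Z` with `reC Z`, `imC Z` real tangent vectors. -/
def reC (Z : CTan n) : Fin n → ℂ := (1 / 2 : ℂ) • (Z.1 + star Z.2)

/-- The imaginary part of a complexified tangent vector. -/
def imC (Z : CTan n) : Fin n → ℂ := (-I / 2) • (Z.1 - star Z.2)

theorem toC_reC_add_toC_imC (Z : CTan n) : toC (reC Z) + I • toC (imC Z) = Z := by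
  have hI : star I = -I := conj_I
  ext i
  · simp only [toC, reC, imC, Prod.fst_add, Prod.smul_fst, Pi.add_apply, Pi.smul_apply,
      Pi.sub_apply, Pi.star_apply, smul_eq_mul]
    linear_combination (-(1 / 2 : ℂ)) * (Z.1 i - star (Z.2 i)) * I_mul_I
  · simp only [toC, reC, imC, Prod.snd_add, Prod.smul_snd, Pi.add_apply, Pi.smul_apply,
      Pi.sub_apply, Pi.star_apply, smul_eq_mul, star_mul', star_add, star_sub, star_star,
      star_div₀, star_neg, star_one, star_ofNat, hI]
    linear_combination ((1 / 2 : ℂ)) * (star (Z.1 i) - (Z.2 i)) * I_mul_I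

/-- `∂/∂zⁱ`. -/
def dZ (i : Fin n) : CTan n := (Pi.single i 1, 0)

/-- `∂/∂z̄ⁱ`. -/
def dZbar (i : Fin n) : CTan n := (0, Pi.single i 1)

/-- The frame `∂/∂zⁱ`, `∂/∂z̄ⁱ` of the complexified tangent bundle. -/
def frame : Fin n ⊕ Fin n → CTan n := Sum.elim dZ dZbar

/-- The derivative of a complex (vector) valued function along a complexified tangent vector. -/
def cderiv {F : Type*} [NormedAddCommGroup F] [NormedSpace ℂ F]
    (Z : CTan n) (f : (Fin n → ℂ) → F) (x : Fin n → ℂ) : F :=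
  fderiv ℝ f x (reC Z) + I • fderiv ℝ f x (imC Z)

/-- The Lie bracket of complexified vector fields. -/
def bracketC (X Y : (Fin n → ℂ) → CTan n) (x : Fin n → ℂ) : CTan n :=
  (cderiv (X x) (fun y => (Y y).1) x - cderiv (Y x) (fun y => (X y).1) x,
   cderiv (X x) (fun y => (Y y).2) x - cderiv (Y x) (fun y => (X y).2) x)

/-! ### Metric tensors in a holomorphic chart -/

/-- A field of real bilinear forms on `ℂⁿ`. -/
abbrev MetricField (n : ℕ) : Type :=
  (Fin n → ℂ) → (Fin n → ℂ) →L[ℝ] (Fin n → ℂ) →L[ℝ] ℝ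

/-- The complex bilinear extension `h` of the metric `g` to complexified tangent vectors. -/
def hC (g : MetricField n) (x : Fin n → ℂ) (Z W : CTan n) : ℂ :=
  ((g x (reC Z) (reC W) - g x (imC Z) (imC W) : ℝ) : ℂ)
    + I * ((g x (reC Z) (imC W) + g x (imC Z) (reC W) : ℝ) : ℂ)

/-- The matrix `h_{i j̄} = h(∂/∂zⁱ, ∂/∂z̄ʲ)`. -/
def hMat (g : MetricField n) (x : Fin n → ℂ) : Matrix (Fin n) (Fin n) ℂ :=
  Matrix.of fun i j => hC g x (dZ i) (dZbar j)

/-- The inverse `h^{i j̄}`, normalised by `∑ⱼ h^{i j̄} h_{k j̄} = δ_{ik}`. -/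
def hUp (g : MetricField n) (x : Fin n → ℂ) (i j : Fin n) : ℂ := (hMat g x)⁻¹ j i

/-- The Riemannian volume density `ωⁿ / n! = 2ⁿ det(h_{i j̄})` with respect to Lebesgue measure. -/
def volDensity (g : MetricField n) (x : Fin n → ℂ) : ℝ := 2 ^ n * (hMat g x).det.re

/-! ### Connections -/

/-- A connection on the real tangent bundle: `cov Y x v` is `(∇_v Y)(x)`. -/
abbrev Conn (n : ℕ) : Type :=
  ((Fin n → ℂ) → (Fin n → ℂ)) → (Fin n → ℂ) → (Fin n → ℂ) →L[ℝ] (Fin n → ℂ)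

/-- `cov` is an affine connection on the real tangent bundle of `U` preserving `g` and `J`. -/
structure IsHermitianConn (g : MetricField n) (U : Set (Fin n → ℂ)) (cov : Conn n) : Prop where
  isCov : IsCovariantDerivativeOn (I := 𝓘(ℝ, Fin n → ℂ)) (M := Fin n → ℂ) (Fin n → ℂ)
    (V := fun x : Fin n → ℂ => TangentSpace 𝓘(ℝ, Fin n → ℂ) x) cov U
  metric : ∀ x ∈ U, ∀ Y Z : (Fin n → ℂ) → (Fin n → ℂ),
    DifferentiableAt ℝ Y x → DifferentiableAt ℝ Z x → ∀ v : Fin n → ℂ,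
      fderiv ℝ (fun y => g y (Y y) (Z y)) x v = g x (cov Y x v) (Z x) + g x (Y x) (cov Z x v)
  complex : ∀ x ∈ U, ∀ Y : (Fin n → ℂ) → (Fin n → ℂ), DifferentiableAt ℝ Y x →
    ∀ v : Fin n → ℂ, cov (fun y => I • Y y) x v = I • cov Y x v

/-- The complex linear extension of a connection to complexified vectors and vector fields. -/
def covC (cov : Conn n) (Z : CTan n) (W : (Fin n → ℂ) → CTan n) (x : Fin n → ℂ) : CTan n :=
  toC (cov (fun y => reC (W y)) x (reC Z) - cov (fun y => imC (W y)) x (imC Z))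
    + I • toC (cov (fun y => imC (W y)) x (reC Z) + cov (fun y => reC (W y)) x (imC Z))

/-- The connection `ρ(∇)` on `T^{1,0}` obtained by complexifying and restricting.  A section of
`T^{1,0}` is given by its coefficients `s` in the frame `∂/∂zⁱ`. -/
def rho (cov : Conn n) (Z : CTan n) (s : (Fin n → ℂ) → (Fin n → ℂ)) (x : Fin n → ℂ) :
    Fin n → ℂ :=
  (covC cov Z (fun y => (s y, 0)) x).1

/-- The torsion `∇_X Y - ∇_Y X - [X, Y]`. -/
def torsion (cov : Conn n) (X Y : (Fin n → ℂ) → (Fin n → ℂ)) (x : Fin n → ℂ) : Fin n → ℂ :=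
  cov Y x (X x) - cov X x (Y x) - VectorField.lieBracket ℝ X Y x

/-- `cov` is the real Chern connection: it preserves `g` and `J`, and the `(0,1)`-part of
the connection `ρ(cov)` on `T^{1,0}` is the holomorphic structure `∂̄`. -/
structure IsRealChern (g : MetricField n) (U : Set (Fin n → ℂ)) (cov : Conn n) : Prop where
  hermitian : IsHermitianConn g U cov
  holomorphic : ∀ x ∈ U, ∀ s : (Fin n → ℂ) → (Fin n → ℂ), DifferentiableAt ℝ s x →
    ∀ b : Fin n → ℂ, rho cov (0, b) s x = cderiv (0, b) s x

/-- `cov` is the real Strominger–Bismut connection: it preserves `g` and `J`, and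
`(X, Y, Z) ↦ g(T(X, Y), Z)` is totally skew-symmetric, `T` being its torsion. -/
structure IsRealStromingerBismut (g : MetricField n) (U : Set (Fin n → ℂ)) (cov : Conn n) :
    Prop where
  hermitian : IsHermitianConn g U cov
  skew : ∀ x ∈ U, ∀ X Y Z : (Fin n → ℂ) → (Fin n → ℂ),
    DifferentiableAt ℝ X x → DifferentiableAt ℝ Y x → DifferentiableAt ℝ Z x →
      g x (torsion cov X Y x) (Z x) = -g x (torsion cov X Z x) (Y x)

/-- The Gauduchon connection `∇ᵗ = (1 - t) ∇^{Ch} + t ∇^{SB}`. -/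
def gauduchon (ch sb : Conn n) (t : ℝ) : Conn n :=
  fun Y x => (1 - t) • ch Y x + t • sb Y x

/-- The curvature `∇_X ∇_Y s - ∇_Y ∇_X s - ∇_{[X,Y]} s` of the connection `ρ(cov)`. -/
def curvature (cov : Conn n) (X Y : (Fin n → ℂ) → CTan n) (s : (Fin n → ℂ) → (Fin n → ℂ))
    (x : Fin n → ℂ) : Fin n → ℂ :=
  rho cov (X x) (fun y => rho cov (Y y) s y) x - rho cov (Y x) (fun y => rho cov (X y) s y) x
    - rho cov (bracketC X Y x) s x

/-- The components `R_{i j̄ k l̄} = h(R(∂/∂zⁱ, ∂/∂z̄ʲ) ∂/∂zᵏ, ∂/∂z̄ˡ)` of the curvature of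
`ρ(cov)`. -/
def curv (g : MetricField n) (cov : Conn n) (x : Fin n → ℂ) (i j k l : Fin n) : ℂ :=
  hC g x (curvature cov (fun _ => dZ i) (fun _ => dZbar j) (fun _ => Pi.single k 1) x, 0) (dZbar l)

/-- The coefficients `Γ_{ij}^k` of `ρ(cov)`: `∇_{∂/∂zⁱ} ∂/∂zʲ = ∑ Γ_{ij}^k ∂/∂zᵏ`. -/
def christoffel (cov : Conn n) (x : Fin n → ℂ) (i j k : Fin n) : ℂ :=
  rho cov (dZ i) (fun _ => Pi.single j 1) x k

/-- The torsion components `T_{ij}^k = Γ_{ij}^k - Γ_{ji}^k`. -/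
def torsionC (cov : Conn n) (x : Fin n → ℂ) (i j k : Fin n) : ℂ :=
  christoffel cov x i j k - christoffel cov x j i k

/-! ### Complex valued differential forms -/

/-- Complex valued differential forms of degree `k`. -/
abbrev DForm (n k : ℕ) : Type := (Fin n → ℂ) → (Fin n → ℂ) [⋀^Fin k]→L[ℝ] ℂ

/-- Multiplication by `i` on real tangent vectors, i.e. the complex structure `J`. -/
def mulI : (Fin n → ℂ) →L[ℝ] (Fin n → ℂ) :=
  (I • ContinuousLinearMap.id ℂ (Fin n → ℂ)).restrictScalars ℝ

/-- `∂`: the exterior derivative `d` with the derivative of the coefficients of the form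
replaced by its complex linear part, so that `∂(f dz^I ∧ dz̄^J) = ∑ ∂f/∂zⁱ dzⁱ ∧ dz^I ∧ dz̄^J`. -/
def del {k : ℕ} (α : DForm n k) : DForm n (k + 1) := fun x =>
  ContinuousAlternatingMap.alternatizeUncurryFin
    ((1 / 2 : ℂ) • (fderiv ℝ α x - I • (fderiv ℝ α x).comp mulI))

/-- `∂̄`: the same with the complex antilinear part of the derivative of the coefficients. -/
def delbar {k : ℕ} (α : DForm n k) : DForm n (k + 1) := fun x =>
  ContinuousAlternatingMap.alternatizeUncurryFin
    ((1 / 2 : ℂ) • (fderiv ℝ α x + I • (fderiv ℝ α x).comp mulI))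

theorem del_add_delbar {k : ℕ} (α : DForm n k) (x : Fin n → ℂ) :
    del α x + delbar α x = extDeriv α x := by
  simp only [del, delbar, extDeriv, ← ContinuousAlternatingMap.alternatizeUncurryFin_add]
  congr 1
  module

/-- The complex conjugate of a form. -/
def conjForm {k : ℕ} (α : (Fin n → ℂ) [⋀^Fin k]→L[ℝ] ℂ) : (Fin n → ℂ) [⋀^Fin k]→L[ℝ] ℂ :=
  (conjCLE : ℂ →L[ℝ] ℂ).compContinuousAlternatingMap α

/-- The contraction of a form with a complexified tangent vector, put in the first slot. -/
def contract {k : ℕ} (Z : CTan n) (α : (Fin n → ℂ) [⋀^Fin (k + 1)]→L[ℝ] ℂ) :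
    (Fin n → ℂ) [⋀^Fin k]→L[ℝ] ℂ :=
  α.curryLeft (reC Z) + I • α.curryLeft (imC Z)

/-- The value `α(Z₁, …, Z_k)` of the complex multilinear extension of a form on complexified
tangent vectors. -/
def evalC : {k : ℕ} → ((Fin n → ℂ) [⋀^Fin k]→L[ℝ] ℂ) → (Fin k → CTan n) → ℂ
  | 0, α, _ => α ![]
  | _ + 1, α, Z => evalC (contract (Z 0) α) (Fin.tail Z)

/-- The 1-form `dzⁱ`. -/
def dz (i : Fin n) : (Fin n → ℂ) →L[ℝ] ℂ :=
  (ContinuousLinearMap.proj (R := ℂ) (φ := fun _ : Fin n => ℂ) i).restrictScalars ℝ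

/-- The 1-form `dz̄ⁱ`. -/
def dzbar (i : Fin n) : (Fin n → ℂ) →L[ℝ] ℂ := (conjCLE : ℂ →L[ℝ] ℂ).comp (dz i)

/-- The wedge product of two 1-forms: `(a ∧ b)(v, w) = a(v) b(w) - a(w) b(v)`. -/
def wedge (a b : (Fin n → ℂ) →L[ℝ] ℂ) : (Fin n → ℂ) [⋀^Fin 2]→L[ℝ] ℂ :=
  ContinuousAlternatingMap.alternatizeUncurryFin
    (a.smulRight (ContinuousAlternatingMap.ofSubsingleton ℝ (Fin n → ℂ) ℂ (0 : Fin 1) b))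

theorem wedge_apply (a b : (Fin n → ℂ) →L[ℝ] ℂ) (v w : Fin n → ℂ) :
    wedge a b ![v, w] = a v * b w - a w * b v := by
  simp [wedge, ContinuousAlternatingMap.alternatizeUncurryFin_apply, Fin.sum_univ_two,
    Fin.removeNth]
  ring

/-- The `(1,1)`-form `∑ a_{ij} dzⁱ ∧ dz̄ʲ`. -/
def form11 (a : Fin n → Fin n → ℂ) : (Fin n → ℂ) [⋀^Fin 2]→L[ℝ] ℂ :=
  ∑ i, ∑ j, a i j • wedge (dz i) (dzbar j)

/-- The fundamental form `ω = √-1 ∑ h_{i j̄} dzⁱ ∧ dz̄ʲ`. -/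
def fundForm (g : MetricField n) : DForm n 2 := fun x => form11 fun i j => I * hMat g x i j

/-- The Hermitian metric on complexified covectors in the dual frame: `⟨dzⁱ, dzʲ⟩ = h^{i j̄}`,
`⟨dz̄ⁱ, dz̄ʲ⟩ = h^{j ī}`, `⟨dzⁱ, dz̄ʲ⟩ = 0`. -/
def dualMetric (g : MetricField n) (x : Fin n → ℂ) : Fin n ⊕ Fin n → Fin n ⊕ Fin n → ℂ
  | Sum.inl i, Sum.inl j => hUp g x i j
  | Sum.inr i, Sum.inr j => hUp g x j i
  | Sum.inl _, Sum.inr _ => 0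
  | Sum.inr _, Sum.inl _ => 0

/-- The pointwise Hermitian inner product of complex `k`-forms, linear in the first argument, for
which the products `eᴬ¹ ∧ … ∧ eᴬᵏ`, `A₁ < … < A_k`, are orthonormal if the coframe `(eᴬ)` is. -/
def formInner (g : MetricField n) (x : Fin n → ℂ) {k : ℕ}
    (α β : (Fin n → ℂ) [⋀^Fin k]→L[ℝ] ℂ) : ℂ :=
  (1 / (k.factorial : ℂ)) * ∑ A : Fin k → Fin n ⊕ Fin n, ∑ B : Fin k → Fin n ⊕ Fin n,
    (∏ m, dualMetric g x (A m) (B m)) *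
      (evalC α (fun m => frame (A m)) * star (evalC β (fun m => frame (B m))))

/-- `α` is `D* η` on `U`, where `D*` is the formal adjoint of the operator `D` with respect
to the inner product `∫ ⟨·, ·⟩ ωⁿ / n!`: `α` is smooth and `(D β, η) = (β, α)` for all test
forms `β`. -/
def IsFormalAdjoint (g : MetricField n) (U : Set (Fin n → ℂ)) {k : ℕ}
    (D : DForm n k → DForm n (k + 1)) (η : DForm n (k + 1)) (α : DForm n k) : Prop :=
  ContDiffOn ℝ ∞ α U ∧
    ∀ β : DForm n k, ContDiff ℝ ∞ β → HasCompactSupport β → tsupport β ⊆ U →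
      ∫ x in U, formInner g x (D β x) (η x) * (volDensity g x : ℂ)
        = ∫ x in U, formInner g x (β x) (α x) * (volDensity g x : ℂ)

/-- The operator `Λ`, contraction with `ω`: on `(1,1)`-forms
`Λ(√-1 a_{i j̄} dzⁱ ∧ dz̄ʲ) = h^{i j̄} a_{i j̄}`. -/
def Lam (g : MetricField n) (x : Fin n → ℂ) {k : ℕ} (α : (Fin n → ℂ) [⋀^Fin (k + 2)]→L[ℝ] ℂ) :
    (Fin n → ℂ) [⋀^Fin k]→L[ℝ] ℂ :=
  ∑ i, ∑ j, (-I * hUp g x i j) • contract (dZbar j) (contract (dZ i) α)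

/-! ### Torsion terms -/

/-- `T ⊡ T̄ = h^{p q̄} h_{k l̄} T_{ip}^k conj(T_{jq}^l) dzⁱ ∧ dz̄ʲ`. -/
def torsionBox (g : MetricField n) (T : Fin n → Fin n → Fin n → ℂ) (x : Fin n → ℂ) :
    (Fin n → ℂ) [⋀^Fin 2]→L[ℝ] ℂ :=
  form11 fun i j => ∑ p, ∑ q, ∑ k, ∑ l,
    hUp g x p q * hMat g x k l * T i p k * star (T j q l)

/-- `T ∘ T̄ = h^{p q̄} h^{s r̄} h_{k j̄} h_{i l̄} T_{sp}^k conj(T_{rq}^l) dzⁱ ∧ dz̄ʲ`. -/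
def torsionCirc (g : MetricField n) (T : Fin n → Fin n → Fin n → ℂ) (x : Fin n → ℂ) :
    (Fin n → ℂ) [⋀^Fin 2]→L[ℝ] ℂ :=
  form11 fun i j => ∑ p, ∑ q, ∑ s, ∑ r, ∑ k, ∑ l,
    hUp g x p q * hUp g x s r * hMat g x k j * hMat g x i l * T s p k * star (T r q l)

/-- The `(1,0)`-vector `α^#` dual to the `(0,1)`-part of a 1-form: `(α^#)ᵖ = h^{p q̄} α_{q̄}`. -/
def sharp (g : MetricField n) (x : Fin n → ℂ) (α : (Fin n → ℂ) [⋀^Fin 1]→L[ℝ] ℂ) (p : Fin n) :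
    ℂ :=
  ∑ q, hUp g x p q * evalC α (fun _ => dZbar q)

/-- For a `(1,0)`-vector `v`, the `(1,1)`-form `T(v)` obtained from `T(v, ·)` by lowering the
upper index: `T(v) = vᵖ T_{pi}^m h_{m j̄} dzⁱ ∧ dz̄ʲ`. -/
def torsionContract (g : MetricField n) (T : Fin n → Fin n → Fin n → ℂ) (x : Fin n → ℂ)
    (v : Fin n → ℂ) : (Fin n → ℂ) [⋀^Fin 2]→L[ℝ] ℂ :=
  form11 fun i j => ∑ p, ∑ m, v p * T p i m * hMat g x m j

/-! ### Ricci and scalar curvatures of a tensor `R_{i j̄ k l̄}` -/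

section Ricci

variable (g : MetricField n) (x : Fin n → ℂ) (R : Fin n → Fin n → Fin n → Fin n → ℂ)

/-- `√-1 h^{k l̄} R_{i j̄ k l̄} dzⁱ ∧ dz̄ʲ`. -/
def ricci1 : (Fin n → ℂ) [⋀^Fin 2]→L[ℝ] ℂ :=
  form11 fun i j => I * ∑ k, ∑ l, hUp g x k l * R i j k l

/-- `√-1 h^{k l̄} R_{k l̄ i j̄} dzⁱ ∧ dz̄ʲ`. -/
def ricci2 : (Fin n → ℂ) [⋀^Fin 2]→L[ℝ] ℂ :=
  form11 fun i j => I * ∑ k, ∑ l, hUp g x k l * R k l i j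

/-- `√-1 h^{k l̄} R_{i l̄ k j̄} dzⁱ ∧ dz̄ʲ`. -/
def ricci3 : (Fin n → ℂ) [⋀^Fin 2]→L[ℝ] ℂ :=
  form11 fun i j => I * ∑ k, ∑ l, hUp g x k l * R i l k j

/-- `√-1 h^{k l̄} R_{k j̄ i l̄} dzⁱ ∧ dz̄ʲ`. -/
def ricci4 : (Fin n → ℂ) [⋀^Fin 2]→L[ℝ] ℂ :=
  form11 fun i j => I * ∑ k, ∑ l, hUp g x k l * R k j i l

/-- `h^{i j̄} h^{k l̄} R_{i j̄ k l̄}`. -/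
def scalar1 : ℂ := ∑ i, ∑ j, ∑ k, ∑ l, hUp g x i j * hUp g x k l * R i j k l

/-- `h^{i l̄} h^{k j̄} R_{i j̄ k l̄}`. -/
def scalar2 : ℂ := ∑ i, ∑ j, ∑ k, ∑ l, hUp g x i l * hUp g x k j * R i j k l

end Ricci

/-! ### Hermitian manifolds -/

section Manifold

variable {M : Type*} [TopologicalSpace M] [ChartedSpace (Fin n → ℂ) M]

/-- The complex structure `J` on the real tangent spaces of a complex manifold. -/
def J {p : M} (v : TangentSpace 𝓘(ℝ, Fin n → ℂ) p) : TangentSpace 𝓘(ℝ, Fin n → ℂ) p :=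
  mulI (n := n) v

/-- Smooth Riemannian metrics on the real tangent bundle of a complex manifold. -/
abbrev RMetric (n : ℕ) (M : Type*) [TopologicalSpace M] [ChartedSpace (Fin n → ℂ) M]
    [IsManifold 𝓘(ℂ, Fin n → ℂ) ω M] : Type _ :=
  Bundle.ContMDiffRiemannianMetric 𝓘(ℝ, Fin n → ℂ) ∞ (Fin n → ℂ)
    (fun p : M => TangentSpace 𝓘(ℝ, Fin n → ℂ) p)

/-- The metric in the chart `e`: the pullback of `g` by `e⁻¹`. -/
def chartMetric [IsManifold 𝓘(ℂ, Fin n → ℂ) ω M] (g : RMetric n M)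
    (e : OpenPartialHomeomorph M (Fin n → ℂ)) : MetricField n := fun x =>
  let D : (Fin n → ℂ) →L[ℝ] (Fin n → ℂ) :=
    mfderiv 𝓘(ℝ, Fin n → ℂ) 𝓘(ℝ, Fin n → ℂ) e.symm x
  let B : (Fin n → ℂ) →L[ℝ] (Fin n → ℂ) →L[ℝ] ℝ := g.inner (e.symm x)
  B.bilinearComp D D

theorem chartMetric_apply [IsManifold 𝓘(ℂ, Fin n → ℂ) ω M] (g : RMetric n M)
    (e : OpenPartialHomeomorph M (Fin n → ℂ)) (x v w : Fin n → ℂ) :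
    chartMetric g e x v w = g.inner (e.symm x)
      (mfderiv 𝓘(ℝ, Fin n → ℂ) 𝓘(ℝ, Fin n → ℂ) e.symm x v)
      (mfderiv 𝓘(ℝ, Fin n → ℂ) 𝓘(ℝ, Fin n → ℂ) e.symm x w) := rfl

end Manifold

end

end HermitianGeometry

namespace HermitianGeometry

noncomputable section

variable {n : ℕ}

/-! ### Complex linear extension of real linear maps -/

/-! Everything is local. `isLocalHermitian_chartMetric` turns the metric on the manifold into a
smooth J-invariant metric on the open target of a holomorphic chart, and the rest is a computation
with the matrix h_{i j̄}. Indices are kept lowered: the Chern torsion becomes T_{i j k̄} = ∂_i h_{j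
k̄} - ∂_j h_{i k̄} (`torsionLow`), and second derivatives enter through `metricHess`.

Connections. Metric compatibility together with the vanishing of the (0,1)-coefficients determines
the Chern connection: its lowered coefficients are ∂_i h_{k l̄}. Skew torsion forces the
Strominger–Bismut coefficients ∂_k h_{i l̄} along ∂/∂zⁱ and conj(T_{j l k̄}) along ∂/∂z̄ʲ. Hence ∇ᵗ
has lowered coefficients ∂_i h_{k l̄} - t T_{i k l̄} and t conj(T_{j l k̄}), and its curvature is
quadratic in t. The coefficient of t consists of Chern curvatures with exchanged indices, that of t²
is `torsionQuad` (`curv_gauduchon`, `curv_gauduchon_eq`).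

Adjoints. Pairing ∂β with ω and integrating by parts produces the divergence of h^{i j̄} times the
volume density. Jacobi's formula identifies it with the torsion trace τ, so ∂^*ω = -√-1 conj(τ_l)
dz̄ˡ and ∂̄^*ω = √-1 τ_l dzˡ. By the fundamental lemma of the calculus of variations formal adjoints
are unique (`eqOn_of_isFormalAdjoint`), so any `ds`, `dbs` may be replaced by these.

Ricci and scalar curvatures. Let θ₁, …, θ₄ be the four traces of the Chern curvature. A traced
Bianchi identity (`pdb_torsionTrace`) gives ∂∂^*ω = √-1(θ₁ - θ₃) and ∂̄∂̄^*ω = √-1(θ₁ - θ₄), and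
`Lam_del_delbar_eq` gives Λ∂∂̄ω = T ⊡ T̄ - (θ₁ + θ₂ - θ₃ - θ₄). These relations express θ₂, θ₃, θ₄
through θ₁. Together with the traces of `torsionQuad` they give the Ricci forms by comparing
coefficients. One more trace gives the scalar curvatures, using that 2|∂ω|² and |∂^*ω|² are the
traces of `boxLow` and `contractLow`. -/

theorem reC_add (Z W : CTan n) : reC (Z + W) = reC Z + reC W := by
  simp only [reC, Prod.fst_add, Prod.snd_add, star_add]; module

theorem imC_add (Z W : CTan n) : imC (Z + W) = imC Z + imC W := by
  simp only [imC, Prod.fst_add, Prod.snd_add, star_add]; module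

theorem reC_smul (c : ℂ) (Z : CTan n) : reC (c • Z) = c.re • reC Z - c.im • imC Z := by
  ext i
  apply Complex.ext <;> simp [reC, imC, Complex.normSq] <;> ring

theorem imC_smul (c : ℂ) (Z : CTan n) : imC (c • Z) = c.re • imC Z + c.im • reC Z := by
  ext i
  apply Complex.ext <;> simp [reC, imC, Complex.normSq] <;> ring

theorem reC_toC (v : Fin n → ℂ) : reC (toC v) = v := by
  simp only [reC, toC, star_star]; module

theorem imC_toC (v : Fin n → ℂ) : imC (toC v) = 0 := by
  simp [imC, toC]

section ext

variable {F : Type*} [NormedAddCommGroup F] [NormedSpace ℂ F]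

/-- The complex linear extension of a real linear map to complexified vectors. -/
def extC (L : (Fin n → ℂ) →L[ℝ] F) : CTan n →ₗ[ℂ] F where
  toFun Z := L (reC Z) + I • L (imC Z)
  map_add' Z W := by
    simp only [reC_add, imC_add, map_add]; module
  map_smul' c Z := by
    simp only [reC_smul, imC_smul, map_add, map_sub, map_smul, RingHom.id_apply]
    conv_rhs => rw [← Complex.re_add_im c]
    simp only [← Complex.coe_smul]
    match_scalars
    · ring
    · linear_combination (-(c.im : ℂ)) * I_mul_I

theorem extC_apply (L : (Fin n → ℂ) →L[ℝ] F) (Z : CTan n) :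
    extC L Z = L (reC Z) + I • L (imC Z) := rfl

theorem extC_toC (L : (Fin n → ℂ) →L[ℝ] F) (v : Fin n → ℂ) : extC L (toC v) = L v := by
  simp [extC_apply, reC_toC, imC_toC]

theorem cderiv_eq_extC (Z : CTan n) (f : (Fin n → ℂ) → F) (x : Fin n → ℂ) :
    cderiv Z f x = extC (fderiv ℝ f x) Z := rfl

theorem CTan_eq_sum (Z : CTan n) : Z = ∑ i, Z.1 i • dZ i + ∑ i, Z.2 i • dZbar i := by
  ext i
  · simp [dZ, dZbar, Prod.fst_sum, Finset.sum_apply, Pi.single_apply]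
  · simp [dZ, dZbar, Prod.snd_sum, Finset.sum_apply, Pi.single_apply]

theorem extC_eq_sum (L : (Fin n → ℂ) →L[ℝ] F) (Z : CTan n) :
    extC L Z = ∑ i, Z.1 i • extC L (dZ i) + ∑ i, Z.2 i • extC L (dZbar i) := by
  conv_lhs => rw [CTan_eq_sum Z]
  simp

theorem apply_eq_sum (L : (Fin n → ℂ) →L[ℝ] F) (v : Fin n → ℂ) :
    L v = ∑ i, v i • extC L (dZ i) + ∑ i, star (v i) • extC L (dZbar i) := by
  rw [← extC_toC, extC_eq_sum]; rfl

end ext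

theorem reC_dZ (i : Fin n) : reC (dZ i) = (1 / 2 : ℂ) • Pi.single i 1 := by simp [reC, dZ]

theorem imC_dZ (i : Fin n) : imC (dZ i) = (-I / 2 : ℂ) • Pi.single i 1 := by simp [imC, dZ]

theorem reC_dZbar (i : Fin n) : reC (dZbar i) = (1 / 2 : ℂ) • Pi.single i 1 := by
  simp [reC, dZbar]

theorem imC_dZbar (i : Fin n) : imC (dZbar i) = (I / 2 : ℂ) • Pi.single i 1 := by
  simp [imC, dZbar, neg_div]

/-! ### The operators `∂/∂zⁱ` and `∂/∂z̄ⁱ` on functions -/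

/-- `∂f/∂zⁱ`. -/
def pd (i : Fin n) (f : (Fin n → ℂ) → ℂ) (x : Fin n → ℂ) : ℂ := cderiv (dZ i) f x

/-- `∂f/∂z̄ⁱ`. -/
def pdb (i : Fin n) (f : (Fin n → ℂ) → ℂ) (x : Fin n → ℂ) : ℂ := cderiv (dZbar i) f x

section rules

variable {f g : (Fin n → ℂ) → ℂ} {x : Fin n → ℂ} {Z : CTan n}

theorem cderiv_congr {F : Type*} [NormedAddCommGroup F] [NormedSpace ℂ F]
    {f g : (Fin n → ℂ) → F} (h : f =ᶠ[nhds x] g) : cderiv Z f x = cderiv Z g x := by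
  simp only [cderiv, h.fderiv_eq]

theorem cderiv_const (c : ℂ) : cderiv Z (fun _ => c) x = 0 := by simp [cderiv]

theorem cderiv_sub (hf : DifferentiableAt ℝ f x) (hg : DifferentiableAt ℝ g x) :
    cderiv Z (fun y => f y - g y) x = cderiv Z f x - cderiv Z g x := by
  simp only [cderiv, fderiv_fun_sub hf hg, sub_apply]; module

theorem cderiv_mul (hf : DifferentiableAt ℝ f x) (hg : DifferentiableAt ℝ g x) :
    cderiv Z (fun y => f y * g y) x = cderiv Z f x * g x + f x * cderiv Z g x := by
  simp only [cderiv, fderiv_fun_mul hf hg, add_apply,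
    smul_apply, smul_eq_mul]; ring

theorem cderiv_const_mul (c : ℂ) (hg : DifferentiableAt ℝ g x) :
    cderiv Z (fun y => c * g y) x = c * cderiv Z g x := by
  rw [cderiv_mul (differentiableAt_const c) hg, cderiv_const]; ring

theorem cderiv_sum {ι : Type*} (s : Finset ι) {f : ι → (Fin n → ℂ) → ℂ}
    (hf : ∀ a ∈ s, DifferentiableAt ℝ (f a) x) :
    cderiv Z (fun y => ∑ a ∈ s, f a y) x = ∑ a ∈ s, cderiv Z (f a) x := by
  simp only [cderiv, fderiv_fun_sum hf, sum_apply, Finset.sum_add_distrib,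
    Finset.smul_sum]

/-- Conjugation of complexified tangent vectors. -/
def conjT (Z : CTan n) : CTan n := (star Z.2, star Z.1)

theorem conjT_dZ (i : Fin n) : conjT (dZ i) = dZbar i := by
  simp [conjT, dZ, dZbar]

theorem conjT_dZbar (i : Fin n) : conjT (dZbar i) = dZ i := by
  simp [conjT, dZ, dZbar]

theorem reC_conjT (Z : CTan n) : reC (conjT Z) = reC Z := by
  simp [reC, conjT, add_comm]

theorem imC_conjT (Z : CTan n) : imC (conjT Z) = - imC Z := by
  simp only [imC, conjT, star_star]; module

theorem cderiv_star (hf : DifferentiableAt ℝ f x) :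
    cderiv Z (fun y => star (f y)) x = star (cderiv (conjT Z) f x) := by
  have h : fderiv ℝ (fun y => star (f y)) x = (conjCLE : ℂ →L[ℝ] ℂ).comp (fderiv ℝ f x) :=
    ((conjCLE : ℂ →L[ℝ] ℂ).hasFDerivAt.comp x hf.hasFDerivAt).fderiv
  simp only [cderiv, h, reC_conjT, imC_conjT]
  simp

theorem pd_star (i : Fin n) (hf : DifferentiableAt ℝ f x) :
    pd i (fun y => star (f y)) x = star (pdb i f x) := by
  rw [pd, cderiv_star hf, conjT_dZ]; rfl

theorem pdb_star (i : Fin n) (hf : DifferentiableAt ℝ f x) :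
    pdb i (fun y => star (f y)) x = star (pd i f x) := by
  rw [pdb, cderiv_star hf, conjT_dZbar]; rfl

/-- Both sides are the second real derivative evaluated on real and imaginary parts, so its symmetry
suffices. In particular `metricHess` may be reached by differentiating in either order. -/
theorem cderiv_comm (hf : ContDiffAt ℝ 2 f x) (Z W : CTan n) :
    cderiv Z (fun y => cderiv W f y) x = cderiv W (fun y => cderiv Z f y) x := by
  have hd : DifferentiableAt ℝ (fderiv ℝ f) x :=
    (hf.fderiv_right (m := 1) (by norm_num)).differentiableAt (by norm_num)
  have hs : IsSymmSndFDerivAt ℝ f x := hf.isSymmSndFDerivAt (by simp)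
  have key : ∀ (W : CTan n) (v : Fin n → ℂ), fderiv ℝ (fun y => cderiv W f y) x v =
      fderiv ℝ (fderiv ℝ f) x v (reC W) + I • fderiv ℝ (fderiv ℝ f) x v (imC W) := by
    intro W v
    have h1 : ∀ w, HasFDerivAt (fun y => fderiv ℝ f y w)
        ((ContinuousLinearMap.apply ℝ ℂ w).comp (fderiv ℝ (fderiv ℝ f) x)) x := fun w =>
      (ContinuousLinearMap.apply ℝ ℂ w).hasFDerivAt.comp x hd.hasFDerivAt
    have h2 := (h1 (reC W)).add ((h1 (imC W)).const_smul I)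
    have h3 : fderiv ℝ (fun y => cderiv W f y) x = _ := h2.fderiv
    rw [h3]; simp
  rw [cderiv, cderiv]
  simp only [key, smul_eq_mul]
  rw [hs.eq (reC Z), hs.eq (imC Z), hs.eq (reC Z), hs.eq (imC Z)]
  ring

theorem contDiffOn_cderiv {U : Set (Fin n → ℂ)} (hU : IsOpen U) (Z : CTan n)
    (hf : ContDiffOn ℝ ∞ f U) : ContDiffOn ℝ ∞ (fun y => cderiv Z f y) U := by
  have h := hf.fderiv_of_isOpen hU (m := ∞) (by simp)
  exact (h.clm_apply contDiffOn_const).add ((h.clm_apply contDiffOn_const).const_smul I)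

end rules

/-! ### Hermitian metrics on open subsets of `ℂⁿ` -/

/-- `h` is a smooth `J`-invariant Riemannian metric on the open set `U`. -/
structure IsLocalHermitian (h : MetricField n) (U : Set (Fin n → ℂ)) : Prop where
  isOpen : IsOpen U
  smooth : ∀ v w, ContDiffOn ℝ ∞ (fun x => h x v w) U
  symm : ∀ x ∈ U, ∀ v w, h x v w = h x w v
  inv : ∀ x ∈ U, ∀ v w, h x (I • v) (I • w) = h x v w
  pos : ∀ x ∈ U, ∀ v, v ≠ 0 → 0 < h x v v

/-! ### The complex bilinear extension of the metric in the coordinate frame -/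

section bilinear

variable (g : MetricField n) (x : Fin n → ℂ)

theorem hC_add_left (Z Z' W : CTan n) : hC g x (Z + Z') W = hC g x Z W + hC g x Z' W := by
  simp only [hC, reC_add, imC_add, map_add, add_apply]; push_cast; ring

theorem hC_add_right (Z W W' : CTan n) : hC g x Z (W + W') = hC g x Z W + hC g x Z W' := by
  simp only [hC, reC_add, imC_add, map_add]; push_cast; ring

theorem hC_smul_left (c : ℂ) (Z W : CTan n) : hC g x (c • Z) W = c * hC g x Z W := by
  simp only [hC, reC_smul, imC_smul, map_add, map_sub, map_smul, add_apply, sub_apply, smul_apply,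
    smul_eq_mul]
  apply Complex.ext <;> simp <;> ring

theorem hC_smul_right (c : ℂ) (Z W : CTan n) : hC g x Z (c • W) = c * hC g x Z W := by
  simp only [hC, reC_smul, imC_smul, map_add, map_sub, map_smul, smul_eq_mul]
  apply Complex.ext <;> simp <;> ring

theorem hC_toC (v w : Fin n → ℂ) : hC g x (toC v) (toC w) = (g x v w : ℂ) := by
  simp [hC, reC_toC, imC_toC]

/-- `hC` as a linear map in the first argument. -/
def hCl (W : CTan n) : CTan n →ₗ[ℂ] ℂ where
  toFun Z := hC g x Z W
  map_add' Z Z' := hC_add_left g x Z Z' W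
  map_smul' c Z := hC_smul_left g x c Z W

/-- `hC` as a linear map in the second argument. -/
def hCr (Z : CTan n) : CTan n →ₗ[ℂ] ℂ where
  toFun W := hC g x Z W
  map_add' W W' := hC_add_right g x Z W W'
  map_smul' c W := hC_smul_right g x c Z W

theorem hC_eq_sum_left (Z W : CTan n) :
    hC g x Z W = ∑ i, Z.1 i * hC g x (dZ i) W + ∑ i, Z.2 i * hC g x (dZbar i) W := by
  have h := congrArg (hCl g x W) (CTan_eq_sum Z)
  rw [map_add, map_sum, map_sum] at h
  simpa only [map_smul, smul_eq_mul, hCl, LinearMap.coe_mk, AddHom.coe_mk] using h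

theorem hC_eq_sum_right (Z W : CTan n) :
    hC g x Z W = ∑ i, W.1 i * hC g x Z (dZ i) + ∑ i, W.2 i * hC g x Z (dZbar i) := by
  have h := congrArg (hCr g x Z) (CTan_eq_sum W)
  rw [map_add, map_sum, map_sum] at h
  simpa only [map_smul, smul_eq_mul, hCr, LinearMap.coe_mk, AddHom.coe_mk] using h

theorem hC_holo_dZbar (v : Fin n → ℂ) (l : Fin n) :
    hC g x (v, 0) (dZbar l) = ∑ p, v p * hMat g x p l := by
  rw [hC_eq_sum_left]; simp [hMat]

end bilinear

/-- The sesquilinear form `K(v, w) = ∑ h_{i j̄} vⁱ conj(wʲ)`. -/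
def herm (g : MetricField n) (x v w : Fin n → ℂ) : ℂ :=
  ∑ i, ∑ j, v i * star (w j) * hMat g x i j

/-! ### The matrix h_{i j̄}, its inverse and its determinant -/

namespace IsLocalHermitian

variable {h : MetricField n} {U : Set (Fin n → ℂ)} (L : IsLocalHermitian h U)
  {x : Fin n → ℂ} (hx : x ∈ U)

include L hx

theorem inv_left (v w : Fin n → ℂ) : h x (I • v) w = - h x v (I • w) := by
  have := L.inv x hx v (I • w)
  rw [smul_smul, I_mul_I, neg_one_smul, map_neg] at this
  linarith

/-- J-invariance makes the four real terms of `hC` coincide in pairs. Smoothness and derivatives of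
h_{i j̄} are reduced to those of g through this formula. -/
theorem hMat_apply (i j : Fin n) : hMat h x i j =
    1 / 2 * ((h x (Pi.single i 1) (Pi.single j 1) : ℂ) +
      I * (h x (Pi.single i 1) (I • Pi.single j 1) : ℂ)) := by
  have e1 : ∀ v : Fin n → ℂ, (1 / 2 : ℂ) • v = (1 / 2 : ℝ) • v := fun v => by
    rw [← Complex.coe_smul]; norm_num
  have e2 : ∀ v : Fin n → ℂ, (-I / 2 : ℂ) • v = -((1 / 2 : ℝ) • (I • v)) := fun v => by
    rw [← Complex.coe_smul, smul_smul, ← neg_smul]; congr 1; push_cast; ring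
  have e3 : ∀ v : Fin n → ℂ, (I / 2 : ℂ) • v = ((1 / 2 : ℝ) • (I • v)) := fun v => by
    rw [← Complex.coe_smul, smul_smul]; congr 1; push_cast; ring
  simp only [hMat, Matrix.of_apply, hC, reC_dZ, imC_dZ, reC_dZbar, imC_dZbar, e1, e2, e3, map_smul,
    map_neg, smul_apply, neg_apply, smul_eq_mul, L.inv x hx, L.inv_left hx]
  push_cast; ring

theorem star_hMat (i j : Fin n) : star (hMat h x i j) = hMat h x j i := by
  rw [L.hMat_apply hx, L.hMat_apply hx, L.symm x hx (Pi.single j 1) (Pi.single i 1),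
    L.symm x hx (Pi.single j 1), L.inv_left hx]
  simp

theorem hC_dZ_dZ (i j : Fin n) : hC h x (dZ i) (dZ j) = 0 := by
  have e1 : ∀ v : Fin n → ℂ, (1 / 2 : ℂ) • v = (1 / 2 : ℝ) • v := fun v => by
    rw [← Complex.coe_smul]; norm_num
  have e2 : ∀ v : Fin n → ℂ, (-I / 2 : ℂ) • v = -((1 / 2 : ℝ) • (I • v)) := fun v => by
    rw [← Complex.coe_smul, smul_smul, ← neg_smul]; congr 1; push_cast; ring
  simp only [hC, reC_dZ, imC_dZ, e1, e2, map_smul,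
    map_neg, smul_apply, neg_apply, smul_eq_mul, L.inv x hx, L.inv_left hx]
  push_cast; ring

theorem hC_dZbar_dZbar (i j : Fin n) : hC h x (dZbar i) (dZbar j) = 0 := by
  have e1 : ∀ v : Fin n → ℂ, (1 / 2 : ℂ) • v = (1 / 2 : ℝ) • v := fun v => by
    rw [← Complex.coe_smul]; norm_num
  have e3 : ∀ v : Fin n → ℂ, (I / 2 : ℂ) • v = ((1 / 2 : ℝ) • (I • v)) := fun v => by
    rw [← Complex.coe_smul, smul_smul]; congr 1; push_cast; ring
  simp only [hC, reC_dZbar, imC_dZbar, e1, e3, map_smul,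
    smul_apply, smul_eq_mul, L.inv x hx, L.inv_left hx]
  push_cast; ring

theorem hC_symm (Z W : CTan n) : hC h x Z W = hC h x W Z := by
  simp only [hC, L.symm x hx (reC W), L.symm x hx (imC W)]
  push_cast; ring

theorem hC_dZbar_dZ (i j : Fin n) : hC h x (dZbar i) (dZ j) = hMat h x j i := by
  rw [L.hC_symm hx]; rfl

/-- The bilinear extension vanishes on pairs of equal type, so only the two mixed terms survive, and
they are conjugate to each other. -/
theorem apply_eq_herm (v w : Fin n → ℂ) :
    (h x v w : ℂ) = herm h x v w + star (herm h x v w) := by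
  rw [← hC_toC, hC_eq_sum_left]
  simp only [hC_eq_sum_right h x (dZ _) (toC w), hC_eq_sum_right h x (dZbar _) (toC w), L.hC_dZ_dZ hx, L.hC_dZbar_dZbar hx, L.hC_dZbar_dZ hx,
    herm, star_sum, star_mul', star_star, L.star_hMat hx, mul_zero, Finset.sum_const_zero,
    zero_add, add_zero, Finset.mul_sum]
  simp only [hMat, Matrix.of_apply, mul_assoc, toC, Pi.star_apply]

theorem apply_eq_re_herm (v w : Fin n → ℂ) : h x v w = 2 * (herm h x v w).re := by
  have := congrArg Complex.re (L.apply_eq_herm hx v w)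
  simp at this
  linarith

/-- Polarisation: K is antilinear in w, so replacing w by √-1 w exposes its imaginary part. -/
theorem herm_eq (v w : Fin n → ℂ) :
    herm h x v w = 1 / 2 * ((h x v w : ℂ) + I * (h x v (I • w) : ℂ)) := by
  have hI : herm h x v (I • w) = -I * herm h x v w := by
    simp only [herm, Finset.mul_sum, Pi.smul_apply, smul_eq_mul, star_mul']
    refine Finset.sum_congr rfl fun i _ => Finset.sum_congr rfl fun j _ => ?_
    have : star I = -I := conj_I
    rw [this]; ring
  rw [L.apply_eq_herm hx, L.apply_eq_herm hx, hI]
  have : star I = -I := conj_I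
  rw [star_mul', star_neg, this]
  linear_combination (1 / 2 * ((herm h x v w) - star (herm h x v w))) * I_mul_I

open scoped ComplexOrder in
theorem posDef : (hMat h x).PosDef := by
  refine Matrix.PosDef.of_dotProduct_mulVec_pos ?_ fun v hv => ?_
  · ext i j
    rw [Matrix.conjTranspose_apply, L.star_hMat hx]
  -- The conjugated vector carries the first index of h_{i j̄} here, whereas `herm` conjugates its
  -- second argument; hence `star v` on the right.
  · have e : star v ⬝ᵥ (hMat h x).mulVec v = herm h x (star v) (star v) := by
      simp only [dotProduct, Matrix.mulVec, herm, Finset.mul_sum, Pi.star_apply, star_star]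
      refine Finset.sum_congr rfl fun i _ => Finset.sum_congr rfl fun j _ => by ring
    have h1 := L.pos x hx (star v) (by simpa using hv)
    have h2 := L.apply_eq_re_herm hx (star v) (star v)
    have h3 : star (herm h x (star v) (star v)) = herm h x (star v) (star v) := by
      simp only [herm, star_sum, star_mul', star_star, L.star_hMat hx]
      rw [Finset.sum_comm]
      refine Finset.sum_congr rfl fun i _ => Finset.sum_congr rfl fun j _ => by ring
    rw [e, Complex.lt_def]
    refine ⟨by simp; linarith, ?_⟩
    have := congrArg Complex.im h3
    simp at this
    simp; linarith

open scoped ComplexOrder in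
theorem isUnit_det : IsUnit (hMat h x).det := by
  exact (L.posDef hx).det_pos.ne'.isUnit

theorem hUp_mul (k p : Fin n) : ∑ l, hUp h x p l * hMat h x k l = if k = p then 1 else 0 := by
  have := congrFun (congrFun (Matrix.mul_nonsing_inv _ (L.isUnit_det hx)) k) p
  rw [Matrix.mul_apply, Matrix.one_apply] at this
  simpa [hUp, mul_comm] using this

theorem hUp_mul' (l m : Fin n) : ∑ p, hUp h x p l * hMat h x p m = if l = m then 1 else 0 := by
  have := congrFun (congrFun (Matrix.nonsing_inv_mul _ (L.isUnit_det hx)) l) m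
  rw [Matrix.mul_apply, Matrix.one_apply] at this
  simpa [hUp, mul_comm] using this

open scoped ComplexOrder in
theorem star_hUp (p l : Fin n) : star (hUp h x p l) = hUp h x l p := by
  have := (L.posDef hx).isHermitian.inv
  exact (Matrix.IsHermitian.apply this p l)

/-- Lowering, then raising an index. -/
theorem raise_lower (v : Fin n → ℂ) (p : Fin n) :
    ∑ l, hUp h x p l * ∑ k, v k * hMat h x k l = v p := by
  simp only [Finset.mul_sum]
  rw [Finset.sum_comm]
  calc _ = ∑ k, v k * ∑ l, hUp h x p l * hMat h x k l := by
        simp only [Finset.mul_sum]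
        exact Finset.sum_congr rfl fun i _ => Finset.sum_congr rfl fun j _ => by ring
    _ = v p := by simp [L.hUp_mul hx]

/-- Raising, then lowering an index. -/
theorem lower_raise (a : Fin n → ℂ) (m : Fin n) :
    ∑ p, (∑ l, hUp h x p l * a l) * hMat h x p m = a m := by
  simp only [Finset.sum_mul]
  rw [Finset.sum_comm]
  calc _ = ∑ l, a l * ∑ p, hUp h x p l * hMat h x p m := by
        simp only [Finset.mul_sum]
        exact Finset.sum_congr rfl fun i _ => Finset.sum_congr rfl fun j _ => by ring
    _ = a m := by simp [L.hUp_mul' hx]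

open scoped ComplexOrder in
theorem det_im : (hMat h x).det.im = 0 := by
  have := (Complex.lt_def.1 (L.posDef hx).det_pos).2
  simpa using this.symm

open scoped ComplexOrder in
theorem det_re_pos : 0 < (hMat h x).det.re := by
  have := (Complex.lt_def.1 (L.posDef hx).det_pos).1
  simpa using this

theorem volDensity_eq : (volDensity h x : ℂ) = 2 ^ n * (hMat h x).det := by
  have : (hMat h x).det = ((hMat h x).det.re : ℂ) := Complex.ext (by simp) (by simp [L.det_im hx])
  rw [volDensity, this]; simp

theorem volDensity_pos : 0 < volDensity h x := by
  have := L.det_re_pos hx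
  rw [volDensity]; positivity

omit hx

theorem contDiffOn_hMat (i j : Fin n) : ContDiffOn ℝ ∞ (fun x => hMat h x i j) U := by
  have e : ∀ v w, ContDiffOn ℝ ∞ (fun x => ((h x v w : ℝ) : ℂ)) U := fun v w =>
    Complex.ofRealCLM.contDiff.comp_contDiffOn (L.smooth v w)
  refine ContDiffOn.congr ?_ fun x hx => L.hMat_apply hx i j
  exact contDiffOn_const.mul ((e _ _).add (contDiffOn_const.mul (e _ _)))

theorem contDiffOn_det : ContDiffOn ℝ ∞ (fun x => (hMat h x).det) U := by
  simp only [Matrix.det_apply']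
  exact ContDiffOn.sum fun σ _ => contDiffOn_const.mul
    (contDiffOn_prod fun i _ => L.contDiffOn_hMat _ _)

theorem contDiffOn_hUp (i j : Fin n) : ContDiffOn ℝ ∞ (fun x => hUp h x i j) U := by
  have e : ∀ x, hUp h x i j = (hMat h x).det⁻¹ * ((hMat h x).updateRow i (Pi.single j 1)).det := by
    intro x
    rw [hUp, Matrix.inv_def, Matrix.smul_apply, Ring.inverse_eq_inv', Matrix.adjugate_apply,
      smul_eq_mul]
  simp only [e]
  refine (L.contDiffOn_det.inv fun x hx => (L.isUnit_det hx).ne_zero).mul ?_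
  simp only [Matrix.det_apply']
  refine ContDiffOn.sum fun σ _ => contDiffOn_const.mul (contDiffOn_prod fun k _ => ?_)
  by_cases hk : σ k = i
  · simp only [Matrix.updateRow_apply, hk, if_true]; exact contDiffOn_const
  · simp only [Matrix.updateRow_apply, hk, if_false]; exact L.contDiffOn_hMat _ _

include hx

theorem diffAt {F : Type*} [NormedAddCommGroup F] [NormedSpace ℝ F] {f : (Fin n → ℂ) → F}
    (hf : ContDiffOn ℝ ∞ f U) : DifferentiableAt ℝ f x :=
  (hf.contDiffAt (L.isOpen.mem_nhds hx)).differentiableAt (by simp)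

theorem contDiffAt_two {f : (Fin n → ℂ) → ℂ} (hf : ContDiffOn ℝ ∞ f U) : ContDiffAt ℝ 2 f x :=
  (hf.contDiffAt (L.isOpen.mem_nhds hx)).of_le (by norm_cast)

theorem cderiv_congr {f g : (Fin n → ℂ) → ℂ} {Z : CTan n} (hfg : ∀ y ∈ U, f y = g y) :
    cderiv Z f x = cderiv Z g x :=
  HermitianGeometry.cderiv_congr (Filter.eventuallyEq_of_mem (L.isOpen.mem_nhds hx) hfg)

theorem diffAt_hMat (i j : Fin n) : DifferentiableAt ℝ (fun x => hMat h x i j) x :=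
  L.diffAt hx (L.contDiffOn_hMat i j)

theorem diffAt_hUp (i j : Fin n) : DifferentiableAt ℝ (fun x => hUp h x i j) x :=
  L.diffAt hx (L.contDiffOn_hUp i j)

/-- Differentiate the relation between h and its inverse, then multiply by the inverse. -/
theorem cderiv_hUp (Z : CTan n) (p l : Fin n) : cderiv Z (fun y => hUp h y p l) x =
    - ∑ a, ∑ b, hUp h x p b * cderiv Z (fun y => hMat h y a b) x * hUp h x a l := by
  have e : ∀ m, ∑ q, hUp h x p q * cderiv Z (fun y => hMat h y m q) x +
      ∑ q, cderiv Z (fun y => hUp h y p q) x * hMat h x m q = 0 := by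
    intro m
    have h1 := L.cderiv_congr hx (Z := Z) (fun y hy => L.hUp_mul hy m p)
    rw [cderiv_const, cderiv_sum (f := fun q y => hUp h y p q * hMat h y m q) _
      fun q _ => (L.diffAt_hUp hx _ _).fun_mul (L.diffAt_hMat hx _ _)] at h1
    simp only [cderiv_mul (L.diffAt_hUp hx _ _) (L.diffAt_hMat hx _ _), Finset.sum_add_distrib] at h1
    rw [add_comm]; exact h1
  have h2 : ∑ m, hUp h x m l * ∑ q, cderiv Z (fun y => hUp h y p q) x * hMat h x m q =
      cderiv Z (fun y => hUp h y p l) x := by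
    simp only [Finset.mul_sum]
    rw [Finset.sum_comm]
    calc _ = ∑ q, cderiv Z (fun y => hUp h y p q) x * ∑ m, hUp h x m l * hMat h x m q := by
          simp only [Finset.mul_sum]
          exact Finset.sum_congr rfl fun i _ => Finset.sum_congr rfl fun j _ => by ring
      _ = _ := by simp [L.hUp_mul' hx]
  rw [← h2, ← Finset.sum_neg_distrib]
  refine Finset.sum_congr rfl fun m _ => ?_
  rw [← Finset.sum_mul, ← neg_eq_of_add_eq_zero_right (e m)]
  ring

/-- Jacobi's formula. The permutation expansion differentiates into determinants with one column
replaced; Cramer's rule turns these into adjugate entries, which are det · h^{p q̄}. -/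
theorem cderiv_det (Z : CTan n) : cderiv Z (fun y => (hMat h y).det) x =
    (hMat h x).det * ∑ p, ∑ q, hUp h x p q * cderiv Z (fun y => hMat h y p q) x := by
  have hprod : ∀ σ : Equiv.Perm (Fin n), cderiv Z (fun y => ∏ i, hMat h y (σ i) i) x =
      ∑ i, (∏ j ∈ Finset.univ.erase i, hMat h x (σ j) j) *
        cderiv Z (fun y => hMat h y (σ i) i) x := by
    intro σ
    have := (HasFDerivAt.finsetProd (u := Finset.univ) fun i _ =>
      (L.diffAt_hMat hx (σ i) i).hasFDerivAt).fderiv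
    simp only [cderiv, this, sum_apply, smul_apply, smul_eq_mul, Finset.mul_sum,
      ← Finset.sum_add_distrib]
    exact Finset.sum_congr rfl fun i _ => by ring
  have hd : ∀ σ : Equiv.Perm (Fin n), DifferentiableAt ℝ (fun y => ∏ i, hMat h y (σ i) i) x :=
    fun σ => (HasFDerivAt.finsetProd (u := Finset.univ) fun i _ =>
      (L.diffAt_hMat hx (σ i) i).hasFDerivAt).differentiableAt
  have hcol : ∀ (i : Fin n) (b : Fin n → ℂ), ((hMat h x).updateCol i b).det =
      ∑ σ : Equiv.Perm (Fin n), ((Equiv.Perm.sign σ : ℤ) : ℂ) *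
        ((∏ j ∈ Finset.univ.erase i, hMat h x (σ j) j) * b (σ i)) := by
    intro i b
    rw [Matrix.det_apply']
    refine Finset.sum_congr rfl fun σ _ => ?_
    rw [← Finset.prod_erase_mul _ _ (Finset.mem_univ i)]
    congr 2
    · refine Finset.prod_congr rfl fun j hj => ?_
      simp [Finset.ne_of_mem_erase hj]
    · simp
  have hadj : ∀ i p, (hMat h x).adjugate i p = (hMat h x).det * hUp h x p i := by
    intro i p
    rw [hUp, Matrix.inv_def, Matrix.smul_apply, Ring.inverse_eq_inv', smul_eq_mul,
      mul_inv_cancel_left₀ (L.isUnit_det hx).ne_zero]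
  simp only [Matrix.det_apply' (hMat h _)]
  rw [cderiv_sum _ fun σ _ => (hd σ).const_mul _]
  simp only [cderiv_const_mul _ (hd _), hprod, Finset.mul_sum]
  rw [Finset.sum_comm]
  simp only [← Matrix.det_apply' (hMat h _)]
  calc _ = ∑ i, ((hMat h x).updateCol i fun p => cderiv Z (fun y => hMat h y p i) x).det :=
        Finset.sum_congr rfl fun i _ => (hcol i _).symm
    _ = ∑ i, ∑ p, (hMat h x).adjugate i p * cderiv Z (fun y => hMat h y p i) x := by
        refine Finset.sum_congr rfl fun i _ => ?_
        rw [← Matrix.cramer_apply, Matrix.cramer_eq_adjugate_mulVec]; rfl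
    _ = _ := by
        rw [Finset.sum_comm]
        exact Finset.sum_congr rfl fun i _ => Finset.sum_congr rfl fun j _ => by rw [hadj]; ring

end IsLocalHermitian

/-! ### Connections in a holomorphic chart -/

/-- The tangent bundle of ℂⁿ is trivial, so sections are plain functions. This translates the
differentiability conditions in `IsCovariantDerivativeOn`. -/
theorem mdifferentiableAt_vectorField_iff
    {σ : (y : Fin n → ℂ) → TangentSpace 𝓘(ℝ, Fin n → ℂ) y} {x : Fin n → ℂ} :
    MDifferentiableAt 𝓘(ℝ, Fin n → ℂ) (𝓘(ℝ, Fin n → ℂ).prod 𝓘(ℝ, Fin n → ℂ))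
      (fun y => (Bundle.TotalSpace.mk' (Fin n → ℂ) y (σ y))) x ↔
      DifferentiableAt ℝ (E := Fin n → ℂ) (F := Fin n → ℂ) σ x := by
  refine (mdifferentiableAt_section _ _).trans (Iff.trans ?_ mdifferentiableAt_iff_differentiableAt)
  simp

theorem vec_eq_sum (w : Fin n → ℂ) : w = ∑ k, w k • (Pi.single k 1 : Fin n → ℂ) := by
  ext i; simp [Finset.sum_apply, Pi.single_apply]

section herm

variable (g : MetricField n) (x : Fin n → ℂ)

theorem herm_add_left (v v' w : Fin n → ℂ) :
    herm g x (v + v') w = herm g x v w + herm g x v' w := by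
  simp only [herm, Pi.add_apply, add_mul, Finset.sum_add_distrib]

theorem herm_add_right (v w w' : Fin n → ℂ) :
    herm g x v (w + w') = herm g x v w + herm g x v w' := by
  simp only [herm, Pi.add_apply, star_add, mul_add, add_mul, Finset.sum_add_distrib]

theorem herm_smul_left (c : ℂ) (v w : Fin n → ℂ) : herm g x (c • v) w = c * herm g x v w := by
  simp only [herm, Pi.smul_apply, smul_eq_mul, Finset.mul_sum, mul_assoc]

theorem herm_sub_left (v v' w : Fin n → ℂ) :
    herm g x (v - v') w = herm g x v w - herm g x v' w := by
  simp only [herm, Pi.sub_apply, sub_mul, Finset.sum_sub_distrib]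

theorem herm_smul_right (c : ℂ) (v w : Fin n → ℂ) :
    herm g x v (c • w) = star c * herm g x v w := by
  simp only [herm, Pi.smul_apply, smul_eq_mul, star_mul', Finset.mul_sum]
  exact Finset.sum_congr rfl fun i _ => Finset.sum_congr rfl fun j _ => by ring

theorem herm_sum_left {ι : Type*} (s : Finset ι) (v : ι → Fin n → ℂ) (w : Fin n → ℂ) :
    herm g x (∑ a ∈ s, v a) w = ∑ a ∈ s, herm g x (v a) w := by
  classical
  induction s using Finset.induction_on with
  | empty => simp [herm]
  | insert a s ha ih => rw [Finset.sum_insert ha, Finset.sum_insert ha, herm_add_left, ih]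

theorem herm_sum_right {ι : Type*} (s : Finset ι) (v : Fin n → ℂ) (w : ι → Fin n → ℂ) :
    herm g x v (∑ a ∈ s, w a) = ∑ a ∈ s, herm g x v (w a) := by
  classical
  induction s using Finset.induction_on with
  | empty => simp [herm]
  | insert a s ha ih => rw [Finset.sum_insert ha, Finset.sum_insert ha, herm_add_right, ih]

theorem herm_single_right (v : Fin n → ℂ) (l : Fin n) :
    herm g x v (Pi.single l 1) = ∑ p, v p * hMat g x p l := by
  simp [herm, Pi.single_apply, apply_ite star]

theorem herm_single_left (w : Fin n → ℂ) (k : Fin n) :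
    herm g x (Pi.single k 1) w = ∑ p, star (w p) * hMat g x k p := by
  simp [herm, Pi.single_apply, ite_mul]

end herm

namespace IsHermitianConn

variable {h : MetricField n} {U : Set (Fin n → ℂ)} {cov : Conn n} (C : IsHermitianConn h U cov)
  {x : Fin n → ℂ} (hx : x ∈ U)

include C hx

theorem cov_add {Y Z : (Fin n → ℂ) → (Fin n → ℂ)} (hY : DifferentiableAt ℝ Y x)
    (hZ : DifferentiableAt ℝ Z x) : cov (fun y => Y y + Z y) x = cov Y x + cov Z x :=
  @C.isCov.add Y Z x (mdifferentiableAt_vectorField_iff.2 hY)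
    (mdifferentiableAt_vectorField_iff.2 hZ) hx

theorem cov_smul {Y : (Fin n → ℂ) → (Fin n → ℂ)} {f : (Fin n → ℂ) → ℝ}
    (hf : DifferentiableAt ℝ f x) (hY : DifferentiableAt ℝ Y x) :
    cov (fun y => f y • Y y) x = f x • cov Y x + (fderiv ℝ f x).smulRight (Y x) := by
  refine (@C.isCov.leibniz Y f x (mdifferentiableAt_vectorField_iff.2 hY)
    hf.mdifferentiableAt hx).trans ?_
  rw [mvfderiv, mfderiv_eq_fderiv]
  rfl

/-- Compatibility with J upgrades the Leibniz rule from real to complex functions, by splitting f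
into real and imaginary parts. -/
theorem cov_csmul {Y : (Fin n → ℂ) → (Fin n → ℂ)} {f : (Fin n → ℂ) → ℂ}
    (hf : DifferentiableAt ℝ f x) (hY : DifferentiableAt ℝ Y x) (v : Fin n → ℂ) :
    cov (fun y => f y • Y y) x v = f x • cov Y x v + fderiv ℝ f x v • Y x := by
  have hre : DifferentiableAt ℝ (fun y => (f y).re) x :=
    Complex.reCLM.differentiableAt.comp x hf
  have him : DifferentiableAt ℝ (fun y => (f y).im) x :=
    Complex.imCLM.differentiableAt.comp x hf
  have hre' : fderiv ℝ (fun y => (f y).re) x = Complex.reCLM.comp (fderiv ℝ f x) :=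
    (Complex.reCLM.hasFDerivAt.comp x hf.hasFDerivAt).fderiv
  have him' : fderiv ℝ (fun y => (f y).im) x = Complex.imCLM.comp (fderiv ℝ f x) :=
    (Complex.imCLM.hasFDerivAt.comp x hf.hasFDerivAt).fderiv
  have e : (fun y => f y • Y y) = fun y => (f y).re • Y y + I • ((f y).im • Y y) := by
    funext y
    conv_lhs => rw [← Complex.re_add_im (f y)]
    simp only [← Complex.coe_smul]; module
  have e' : ∀ c : ℂ, ∀ w : Fin n → ℂ, c • w = c.re • w + I • (c.im • w) := by
    intro c w
    conv_lhs => rw [← Complex.re_add_im c]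
    simp only [← Complex.coe_smul]; module
  rw [e, C.cov_add hx (hre.fun_smul hY) ((him.fun_smul hY).fun_const_smul I), add_apply,
    C.complex x hx _ (him.fun_smul hY), C.cov_smul hx hre hY, C.cov_smul hx him hY, hre', him',
    e' (f x), e' (fderiv ℝ f x v)]
  simp only [add_apply, smul_apply, ContinuousLinearMap.smulRight_apply,
    ContinuousLinearMap.comp_apply, Complex.reCLM_apply, Complex.imCLM_apply, smul_add]
  abel

theorem cov_sum {ι : Type*} (s : Finset ι) {Y : ι → (Fin n → ℂ) → (Fin n → ℂ)}
    (hY : ∀ a ∈ s, DifferentiableAt ℝ (Y a) x) :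
    cov (fun y => ∑ a ∈ s, Y a y) x = ∑ a ∈ s, cov (Y a) x := by
  classical
  induction s using Finset.induction_on with
  | empty =>
    have := C.cov_smul hx (f := fun _ => (0 : ℝ)) (Y := fun _ => 0) (differentiableAt_const _)
      (differentiableAt_const _)
    simp only [smul_zero, fderiv_fun_const] at this
    simp only [Finset.sum_empty]
    rw [this]
    ext v
    simp
  | insert a s ha ih =>
    simp only [Finset.sum_insert ha]
    rw [C.cov_add hx (hY a (by simp))
      (DifferentiableAt.fun_sum fun b hb => hY b (by simp [hb])), ih fun b hb => hY b (by simp [hb])]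

theorem cov_apply {Y : (Fin n → ℂ) → (Fin n → ℂ)} (hY : DifferentiableAt ℝ Y x)
    (v : Fin n → ℂ) : cov Y x v =
      fderiv ℝ Y x v + ∑ k, Y x k • cov (fun _ => Pi.single k 1) x v := by
  have hk : ∀ k, DifferentiableAt ℝ (fun y => Y y k) x := fun k =>
    differentiableAt_pi.1 hY k
  have e : Y = fun y => ∑ k, Y y k • (Pi.single k 1 : Fin n → ℂ) := by
    funext y; exact vec_eq_sum (Y y)
  have e2 : fderiv ℝ Y x v = ∑ k, (fderiv ℝ (fun y => Y y k) x v) • (Pi.single k 1 : Fin n → ℂ) := by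
    rw [vec_eq_sum (fderiv ℝ Y x v)]
    refine Finset.sum_congr rfl fun k _ => ?_
    rw [fderiv_apply hY]; rfl
  conv_lhs => rw [e]
  rw [C.cov_sum hx _ fun k _ => (hk k).smul_const _, sum_apply, e2, ← Finset.sum_add_distrib]
  refine Finset.sum_congr rfl fun k _ => ?_
  rw [C.cov_csmul hx (hk k) (differentiableAt_const _), add_comm]

/-- The vector (s, 0) has real part s/2 and imaginary part -√-1 s/2, and `cov` commutes with
constant complex factors. From here on ρ(∇) is handled by complex linearity in Z. -/
theorem covC_holo {s : (Fin n → ℂ) → (Fin n → ℂ)} (hs : DifferentiableAt ℝ s x) (Z : CTan n) :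
    rho cov Z s x = extC (cov s x) Z := by
  have h1 : (fun y => reC (s y, 0)) = fun y => (1 / 2 : ℂ) • s y := by
    funext y; simp [reC]
  have h2 : (fun y => imC (s y, 0)) = fun y => I • ((-1 / 2 : ℂ) • s y) := by
    funext y; simp only [imC, star_zero, sub_zero, smul_smul]; congr 1; ring
  have h3 : ∀ (c : ℂ) v, cov (fun y => c • s y) x v = c • cov s x v := by
    intro c v
    have := C.cov_csmul hx (f := fun _ => c) (differentiableAt_const _) hs v
    simpa using this
  have h4 : ∀ v, cov (fun y => I • ((-1 / 2 : ℂ) • s y)) x v = (-I / 2) • cov s x v := by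
    intro v
    rw [C.complex x hx _ (hs.fun_const_smul _), h3, smul_smul]; congr 1; ring
  simp only [rho, covC, h1, h2, h3, toC, extC_apply, Prod.fst_add, Prod.smul_fst,
    smul_add, smul_smul]
  match_scalars
  · linear_combination (-1 / 2 : ℂ) * I_mul_I
  · ring

theorem rho_apply {s : (Fin n → ℂ) → (Fin n → ℂ)} (hs : DifferentiableAt ℝ s x) (Z : CTan n)
    (p : Fin n) : rho cov Z s x p =
      cderiv Z (fun y => s y p) x + ∑ k, s x k * rho cov Z (fun _ => Pi.single k 1) x p := by
  have hd : ∀ v, fderiv ℝ (fun y => s y p) x v = fderiv ℝ s x v p := by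
    intro v; rw [fderiv_apply hs]; rfl
  simp only [C.covC_holo hx hs, C.covC_holo hx (differentiableAt_const _), extC_apply, cderiv, hd,
    C.cov_apply hx hs, Pi.add_apply, Pi.smul_apply, Finset.sum_apply, smul_eq_mul, mul_add,
    Finset.mul_sum, Finset.sum_add_distrib]
  have : ∀ k a, I * (s x k * a) = s x k * (I * a) := fun k a => by ring
  simp only [this]; ring

theorem cov_const_smul (c : ℂ) (w v : Fin n → ℂ) :
    cov (fun _ => c • w) x v = c • cov (fun _ => w) x v := by
  have := C.cov_csmul hx (f := fun _ => c) (Y := fun _ => w) (differentiableAt_const _)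
    (differentiableAt_const _) v
  simpa using this

/-- Metric compatibility on constant frame fields. The second argument of the Hermitian form is
antilinear, which is why its term involves the conjugate of Z. -/
theorem cderiv_hMat (L : IsLocalHermitian h U) (Z : CTan n) (k l : Fin n) :
    cderiv Z (fun y => hMat h y k l) x =
      ∑ p, rho cov Z (fun _ => Pi.single k 1) x p * hMat h x p l +
      ∑ p, star (rho cov (conjT Z) (fun _ => Pi.single l 1) x p) * hMat h x k p := by
  have hr : ∀ v w a, fderiv ℝ (fun y => h y v w) x a =
      h x (cov (fun _ => v) x a) w + h x v (cov (fun _ => w) x a) := fun v w a =>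
    C.metric x hx (fun _ => v) (fun _ => w) (differentiableAt_const _) (differentiableAt_const _) a
  have hc : ∀ v w, HasFDerivAt (fun y => ((h y v w : ℝ) : ℂ))
      (Complex.ofRealCLM.comp (fderiv ℝ (fun y => h y v w) x)) x := fun v w =>
    Complex.ofRealCLM.hasFDerivAt.comp x (L.diffAt hx (L.smooth v w)).hasFDerivAt
  have key : ∀ a, fderiv ℝ (fun y => hMat h y k l) x a =
      herm h x (cov (fun _ => Pi.single k 1) x a) (Pi.single l 1) +
      herm h x (Pi.single k 1) (cov (fun _ => Pi.single l 1) x a) := by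
    intro a
    have e : (fun y => hMat h y k l) =ᶠ[nhds x] fun y =>
        (1 / 2 : ℂ) * ((h y (Pi.single k 1) (Pi.single l 1) : ℂ) +
      I * (h y (Pi.single k 1) (I • Pi.single l 1) : ℂ)) :=
      Filter.eventuallyEq_of_mem (L.isOpen.mem_nhds hx) fun y hy => L.hMat_apply hy k l
    have hf := ((hc (Pi.single k 1) (Pi.single l 1)).add
      ((hc (Pi.single k 1) (I • Pi.single l 1)).const_mul I)).const_mul (1 / 2 : ℂ)
    rw [e.fderiv_eq]
    refine (congrArg (fun T => T a) hf.fderiv).trans ?_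
    simp only [smul_apply, add_apply, ContinuousLinearMap.comp_apply, hr, L.herm_eq hx,
      smul_eq_mul, Complex.ofRealCLM_apply]
    rw [C.cov_const_smul hx]
    push_cast; ring
  simp only [← herm_single_right, ← herm_single_left]
  rw [cderiv, key, key, C.covC_holo hx (differentiableAt_const _),
    C.covC_holo hx (differentiableAt_const _), extC_apply, extC_apply, reC_conjT, imC_conjT,
    map_neg, smul_neg, ← neg_smul, herm_add_left, herm_add_right, herm_smul_left, herm_smul_right]
  have : star (-I) = I := by simp
  rw [this, smul_eq_mul]; ring

end IsHermitianConn

/-! ### The coefficients of the Chern and Strominger–Bismut connections -/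

/-- The coefficients of `∇_{∂/∂z̄ⁱ} ∂/∂zʲ`. -/
def christoffelBar (cov : Conn n) (x : Fin n → ℂ) (i j k : Fin n) : ℂ :=
  rho cov (dZbar i) (fun _ => Pi.single j 1) x k

/-- The torsion `T_{ij}^k` of the Chern connection with the upper index lowered. -/
def torsionLow (h : MetricField n) (x : Fin n → ℂ) (i j k : Fin n) : ℂ :=
  pd i (fun y => hMat h y j k) x - pd j (fun y => hMat h y i k) x

theorem IsLocalHermitian.pdb_hMat {h : MetricField n} {U : Set (Fin n → ℂ)}
    (L : IsLocalHermitian h U) {x : Fin n → ℂ} (hx : x ∈ U) (i j k : Fin n) :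
    pdb i (fun y => hMat h y j k) x = star (pd i (fun y => hMat h y k j) x) := by
  rw [← pdb_star i (L.diffAt_hMat hx k j)]
  exact L.cderiv_congr hx fun y hy => (L.star_hMat hy k j).symm

section coefficients

variable {h : MetricField n} {U : Set (Fin n → ℂ)} {cov : Conn n} (L : IsLocalHermitian h U)
  {x : Fin n → ℂ} (hx : x ∈ U)

include L hx

theorem IsHermitianConn.pd_hMat (C : IsHermitianConn h U cov) (i k l : Fin n) :
    pd i (fun y => hMat h y k l) x = ∑ p, christoffel cov x i k p * hMat h x p l +
      ∑ p, star (christoffelBar cov x i l p) * hMat h x k p := by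
  rw [pd, C.cderiv_hMat hx L, conjT_dZ]; rfl

omit L in
theorem IsRealChern.christoffelBar_eq (C : IsRealChern h U cov) (i j k : Fin n) :
    christoffelBar cov x i j k = 0 := by
  rw [christoffelBar, dZbar, C.holomorphic x hx _ (differentiableAt_const _)]
  simp [cderiv]

theorem IsRealChern.christoffel_low (C : IsRealChern h U cov) (i k l : Fin n) :
    ∑ p, christoffel cov x i k p * hMat h x p l = pd i (fun y => hMat h y k l) x := by
  rw [C.hermitian.pd_hMat L hx]; simp [C.christoffelBar_eq hx]

theorem eq_raise {v a : Fin n → ℂ} (hv : ∀ l, ∑ p, v p * hMat h x p l = a l) (p : Fin n) :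
    v p = ∑ l, hUp h x p l * a l := by
  rw [← L.raise_lower hx v p]; simp only [hv]

omit L in
theorem IsRealStromingerBismut.skew_coeff (C : IsRealStromingerBismut h U cov)
    (L : IsLocalHermitian h U) (i j k : Fin n) :
    ∑ p, (christoffel cov x i j p - christoffel cov x j i p) * hMat h x p k +
      star (∑ p, christoffelBar cov x i k p * hMat h x p j) = 0 := by
  have hH := C.hermitian
  set G : Fin n → Fin n → Fin n → ℂ := fun a b => rho cov (dZ a) (fun _ => Pi.single b 1) x with hG
  set B : Fin n → Fin n → Fin n → ℂ := fun a b => rho cov (dZbar a) (fun _ => Pi.single b 1) x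
    with hB
  have hcov : ∀ (α β : ℂ) (a b : Fin n), cov (fun _ => β • Pi.single b 1) x (α • Pi.single a 1) =
      β • (α • G a b + star α • B a b) := by
    intro α β a b
    rw [hH.cov_const_smul hx, apply_eq_sum]
    congr 1
    simp only [hG, hB, hH.covC_holo hx (differentiableAt_const _)]
    simp [Pi.single_apply, ite_smul, apply_ite]
  have htor : ∀ (α β : ℂ) (a b : Fin n),
      torsion cov (fun _ => α • Pi.single a 1) (fun _ => β • Pi.single b 1) x =
      (α * β) • (G a b - G b a) + (star α * β) • B a b - (α * star β) • B b a := by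
    intro α β a b
    simp only [torsion, hcov]
    rw [VectorField.lieBracket]
    simp only [fderiv_fun_const, Pi.zero_apply, zero_apply, sub_zero]
    module
  set K := fun v w => herm h x v w
  -- Skew-symmetry on the constant real fields α eᵢ, β eⱼ, γ eₖ only equates real parts; varying the
  -- complex factors separates the types.
  have E : ∀ α β γ : ℂ,
      (star γ * (α * β * K (G i j - G j i) (Pi.single k 1) + star α * β * K (B i j) (Pi.single k 1)
        - α * star β * K (B j i) (Pi.single k 1))).re =
      -(star β * (α * γ * K (G i k - G k i) (Pi.single j 1) + star α * γ * K (B i k) (Pi.single j 1)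
        - α * star γ * K (B k i) (Pi.single j 1))).re := by
    intro α β γ
    have h1 := C.skew x hx (fun _ => α • Pi.single i 1) (fun _ => β • Pi.single j 1)
      (fun _ => γ • Pi.single k 1) (differentiableAt_const _) (differentiableAt_const _)
      (differentiableAt_const _)
    rw [htor, htor, L.apply_eq_re_herm hx, L.apply_eq_re_herm hx, herm_smul_right, herm_smul_right,
      herm_sub_left, herm_sub_left] at h1
    simp only [herm_add_left, herm_smul_left] at h1
    linarith
  -- The eight choices of α, β, γ in {1, √-1} isolate the coefficient of α β conj(γ). The second
  -- summand comes from the term in conj(α) γ conj(β), conjugated.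
  have key : K (G i j - G j i) (Pi.single k 1) + star (K (B i k) (Pi.single j 1)) = 0 := by
    have e1 := E 1 1 1
    have e2 := E 1 1 I
    have e3 := E 1 I 1
    have e4 := E 1 I I
    have e5 := E I 1 1
    have e6 := E I 1 I
    have e7 := E I I 1
    have e8 := E I I I
    simp at e1 e2 e3 e4 e5 e6 e7 e8
    apply Complex.ext
    · simp; linarith
    · simp; linarith
  simp only [K, herm_single_right] at key
  exact key

/-- Subtracting the skew-symmetry relation from metric compatibility removes the (0,1)-coefficient.
What remains is the Chern coefficient with its lower indices exchanged. -/
theorem IsRealStromingerBismut.christoffel_low (C : IsRealStromingerBismut h U cov)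
    (i k l : Fin n) :
    ∑ p, christoffel cov x i k p * hMat h x p l = pd k (fun y => hMat h y i l) x := by
  have h1 := C.skew_coeff hx L i k l
  have h2 := C.hermitian.pd_hMat L hx k i l
  have h3 := C.skew_coeff hx L k i l
  have e : ∀ a b c, star (∑ p, christoffelBar cov x a b p * hMat h x p c) =
      ∑ p, star (christoffelBar cov x a b p) * hMat h x c p := by
    intro a b c
    simp only [star_sum, star_mul', L.star_hMat hx]
  rw [e] at h1 h3
  simp only [sub_mul, Finset.sum_sub_distrib] at h1 h3
  rw [h2]
  linear_combination -h3

/-- Once the (1,0)-coefficients are known, metric compatibility leaves exactly a difference of two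
derivatives of h, which is the Chern torsion. -/
theorem IsRealStromingerBismut.christoffelBar_low (C : IsRealStromingerBismut h U cov)
    (j k l : Fin n) :
    ∑ p, christoffelBar cov x j k p * hMat h x p l = star (torsionLow h x j l k) := by
  have h1 := C.christoffel_low L hx j l k
  have h2 := C.hermitian.pd_hMat L hx j l k
  rw [torsionLow, h2, h1]
  simp only [star_sub, star_add, star_sum, star_mul', star_star, L.star_hMat hx]
  ring

end coefficients

/-! ### Curvature of the Gauduchon connections -/

theorem rho_gauduchon (ch sb : Conn n) (t : ℝ) (Z : CTan n) (s : (Fin n → ℂ) → (Fin n → ℂ))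
    (x : Fin n → ℂ) :
    rho (gauduchon ch sb t) Z s x = (1 - t : ℂ) • rho ch Z s x + (t : ℂ) • rho sb Z s x := by
  have e : (1 - t : ℂ) = ((1 - t : ℝ) : ℂ) := by push_cast; ring
  rw [e]
  simp only [rho, covC, gauduchon, toC, add_apply, smul_apply, Prod.fst_add, Prod.smul_fst,
    Complex.coe_smul]
  module

/-- The Chern curvature is thereby the case t = 0 of the general computation (`curv_chern`). -/
theorem gauduchon_zero (ch sb : Conn n) : gauduchon ch sb 0 = ch := by
  funext Y x
  ext v : 1
  have : (0 : ℝ) • sb Y x v = 0 := zero_smul ℝ _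
  simp only [gauduchon, add_apply, smul_apply, sub_zero, one_smul, this, add_zero]

/-- `∂_i ∂_j̄ h_{k l̄}`. -/
def metricHess (h : MetricField n) (x : Fin n → ℂ) (i j k l : Fin n) : ℂ :=
  pd i (fun y => pdb j (fun z => hMat h z k l) y) x

section

variable {h : MetricField n} {U : Set (Fin n → ℂ)} (L : IsLocalHermitian h U)

include L

theorem IsLocalHermitian.contDiffOn_pd_hMat (i j k : Fin n) :
    ContDiffOn ℝ ∞ (fun y => pd i (fun z => hMat h z j k) y) U :=
  contDiffOn_cderiv L.isOpen _ (L.contDiffOn_hMat j k)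

theorem IsLocalHermitian.contDiffOn_pdb_hMat (i j k : Fin n) :
    ContDiffOn ℝ ∞ (fun y => pdb i (fun z => hMat h z j k) y) U :=
  contDiffOn_cderiv L.isOpen _ (L.contDiffOn_hMat j k)

theorem IsLocalHermitian.contDiffOn_torsionLow (i j k : Fin n) :
    ContDiffOn ℝ ∞ (fun y => torsionLow h y i j k) U :=
  (L.contDiffOn_pd_hMat i j k).sub (L.contDiffOn_pd_hMat j i k)

variable {x : Fin n → ℂ} (hx : x ∈ U)

include hx

theorem IsLocalHermitian.star_torsionLow (i j k : Fin n) : star (torsionLow h x i j k) =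
    pdb i (fun y => hMat h y k j) x - pdb j (fun y => hMat h y k i) x := by
  rw [torsionLow, star_sub, ← L.pdb_hMat hx, ← L.pdb_hMat hx]

theorem IsLocalHermitian.pdb_pd_hMat (i j k l : Fin n) :
    pdb j (fun y => pd i (fun z => hMat h z k l) y) x = metricHess h x i j k l :=
  cderiv_comm (L.contDiffAt_two hx (L.contDiffOn_hMat k l)) _ _

theorem IsLocalHermitian.pd_star_torsionLow (i j k l : Fin n) :
    pd i (fun y => star (torsionLow h y j k l)) x =
      metricHess h x i j l k - metricHess h x i k l j := by
  rw [pd, L.cderiv_congr hx fun y hy => L.star_torsionLow hy j k l,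
    cderiv_sub (L.diffAt hx (L.contDiffOn_pdb_hMat _ _ _))
      (L.diffAt hx (L.contDiffOn_pdb_hMat _ _ _))]
  rfl

theorem IsLocalHermitian.pdb_torsionLow (j i k l : Fin n) :
    pdb j (fun y => torsionLow h y i k l) x =
      metricHess h x i j k l - metricHess h x k j i l := by
  rw [← L.pdb_pd_hMat hx, ← L.pdb_pd_hMat hx]
  exact cderiv_sub (L.diffAt hx (L.contDiffOn_pd_hMat _ _ _))
      (L.diffAt hx (L.contDiffOn_pd_hMat _ _ _))

variable {ch sb : Conn n} (hch : IsRealChern h U ch) (hsb : IsRealStromingerBismut h U sb) (t : ℝ)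

include hch hsb

theorem christoffel_gauduchon_low (i k l : Fin n) :
    ∑ p, christoffel (gauduchon ch sb t) x i k p * hMat h x p l =
      pd i (fun y => hMat h y k l) x - t * torsionLow h x i k l := by
  simp only [christoffel, rho_gauduchon, Pi.add_apply, Pi.smul_apply, smul_eq_mul, add_mul,
    mul_assoc, Finset.sum_add_distrib, ← Finset.mul_sum]
  have h1 := hch.christoffel_low L hx i k l
  have h2 := hsb.christoffel_low L hx i k l
  simp only [christoffel] at h1 h2
  rw [h1, h2, torsionLow]; ring

theorem christoffelBar_gauduchon_low (j k l : Fin n) :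
    ∑ p, christoffelBar (gauduchon ch sb t) x j k p * hMat h x p l =
      t * star (torsionLow h x j l k) := by
  simp only [christoffelBar, rho_gauduchon, Pi.add_apply, Pi.smul_apply, smul_eq_mul, add_mul,
    mul_assoc, Finset.sum_add_distrib, ← Finset.mul_sum]
  have h1 : ∀ p, rho ch (dZbar j) (fun _ => Pi.single k 1) x p = 0 := fun p =>
    hch.christoffelBar_eq hx j k p
  have h2 := hsb.christoffelBar_low L hx j k l
  simp only [christoffelBar] at h2
  rw [h2]; simp [h1]

theorem christoffel_gauduchon_eq (i k p : Fin n) :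
    christoffel (gauduchon ch sb t) x i k p =
      ∑ l, hUp h x p l * (pd i (fun y => hMat h y k l) x - t * torsionLow h x i k l) :=
  eq_raise L hx (fun l => christoffel_gauduchon_low L hx hch hsb t i k l) p

theorem christoffelBar_gauduchon_eq (j k p : Fin n) :
    christoffelBar (gauduchon ch sb t) x j k p =
      ∑ l, hUp h x p l * (t * star (torsionLow h x j l k)) :=
  eq_raise L hx (fun l => christoffelBar_gauduchon_low L hx hch hsb t j k l) p

omit hch hsb in
theorem diffAt_of_eqOn {f g : (Fin n → ℂ) → ℂ} (hg : ContDiffOn ℝ ∞ g U)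
    (hfg : ∀ y ∈ U, f y = g y) : DifferentiableAt ℝ f x :=
  (L.diffAt hx hg).congr_of_eventuallyEq
    (Filter.eventuallyEq_of_mem (L.isOpen.mem_nhds hx) hfg)

theorem diffAt_christoffel_gauduchon (i k p : Fin n) :
    DifferentiableAt ℝ (fun y => christoffel (gauduchon ch sb t) y i k p) x := by
  refine diffAt_of_eqOn L hx ?_
    fun y hy => christoffel_gauduchon_eq L hy hch hsb t i k p
  exact ContDiffOn.sum fun l _ => (L.contDiffOn_hUp p l).mul
    ((L.contDiffOn_pd_hMat i k l).sub (contDiffOn_const.mul (L.contDiffOn_torsionLow i k l)))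

omit L hx hch hsb in
theorem contDiffOn_star {f : (Fin n → ℂ) → ℂ} (hf : ContDiffOn ℝ ∞ f U) :
    ContDiffOn ℝ ∞ (fun y => star (f y)) U :=
  (conjCLE : ℂ →L[ℝ] ℂ).contDiff.comp_contDiffOn hf

theorem diffAt_christoffelBar_gauduchon (j k p : Fin n) :
    DifferentiableAt ℝ (fun y => christoffelBar (gauduchon ch sb t) y j k p) x := by
  refine diffAt_of_eqOn L hx ?_
    fun y hy => christoffelBar_gauduchon_eq L hy hch hsb t j k p
  exact ContDiffOn.sum fun l _ => (L.contDiffOn_hUp p l).mul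
    (contDiffOn_const.mul (contDiffOn_star (L.contDiffOn_torsionLow j l k)))

omit L in
theorem rho_gauduchon_apply {s : (Fin n → ℂ) → (Fin n → ℂ)} (hs : DifferentiableAt ℝ s x)
    (Z : CTan n) (p : Fin n) : rho (gauduchon ch sb t) Z s x p =
      cderiv Z (fun y => s y p) x +
        ∑ k, s x k * rho (gauduchon ch sb t) Z (fun _ => Pi.single k 1) x p := by
  simp only [rho_gauduchon, Pi.add_apply, Pi.smul_apply, smul_eq_mul]
  rw [hch.hermitian.rho_apply hx hs, hsb.hermitian.rho_apply hx hs]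
  simp only [mul_add, Finset.sum_add_distrib, mul_left_comm _ (1 - (t : ℂ)),
    mul_left_comm _ (t : ℂ), ← Finset.mul_sum]
  ring

theorem curvature_gauduchon_apply (i j k p : Fin n) :
    curvature (gauduchon ch sb t) (fun _ => dZ i) (fun _ => dZbar j) (fun _ => Pi.single k 1) x p =
      pd i (fun y => christoffelBar (gauduchon ch sb t) y j k p) x
      + ∑ q, christoffelBar (gauduchon ch sb t) x j k q * christoffel (gauduchon ch sb t) x i q p
      - (pdb j (fun y => christoffel (gauduchon ch sb t) y i k p) x
      + ∑ q, christoffel (gauduchon ch sb t) x i k q *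
          christoffelBar (gauduchon ch sb t) x j q p) := by
  have hb : bracketC (fun _ => dZ i) (fun _ => dZbar j) x = 0 := by
    simp [bracketC, cderiv]
  have h0 : rho (gauduchon ch sb t) 0 (fun _ => Pi.single k 1) x = 0 := by
    rw [rho_gauduchon, hch.hermitian.covC_holo hx (differentiableAt_const _),
      hsb.hermitian.covC_holo hx (differentiableAt_const _), map_zero, map_zero]
    simp
  rw [curvature, hb, h0, sub_zero, Pi.sub_apply,
    rho_gauduchon_apply hx hch hsb t (s := fun y => rho (gauduchon ch sb t) (dZbar j)
      (fun _ => Pi.single k 1) y) (differentiableAt_pi.2 fun p =>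
      diffAt_christoffelBar_gauduchon L hx hch hsb t j k p),
    rho_gauduchon_apply hx hch hsb t (s := fun y => rho (gauduchon ch sb t) (dZ i)
      (fun _ => Pi.single k 1) y) (differentiableAt_pi.2 fun p =>
      diffAt_christoffel_gauduchon L hx hch hsb t i k p)]
  rfl

/-- The coefficients with raised index are never differentiated explicitly. The product rule is
applied to their lowered forms, and the terms containing derivatives of h that this creates cancel
against parts of the quadratic terms. -/
theorem curv_gauduchon (i j k l : Fin n) : curv h (gauduchon ch sb t) x i j k l =
    t * (metricHess h x i j k l - metricHess h x i l k j)
    - (metricHess h x i j k l - t * (metricHess h x i j k l - metricHess h x k j i l))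
    + ∑ p, ∑ q, hUp h x p q *
      ((pd i (fun y => hMat h y k q) x - t * torsionLow h x i k q) *
        star (pd j (fun y => hMat h y l p) x - t * torsionLow h x j l p)
      - (t * star (torsionLow h x j q k)) * (t * torsionLow h x i p l)) := by
  set cov := gauduchon ch sb t with hcov
  have hA := fun i k l => christoffel_gauduchon_low L hx hch hsb t i k l
  have hB := fun i k l => christoffelBar_gauduchon_low L hx hch hsb t i k l
  have dG := fun i k p => diffAt_christoffel_gauduchon L hx hch hsb t i k p
  have dB := fun i k p => diffAt_christoffelBar_gauduchon L hx hch hsb t i k p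
  have eA := christoffel_gauduchon_eq L hx hch hsb t i k
  have eB := christoffelBar_gauduchon_eq L hx hch hsb t j k
  rw [← hcov] at hA hB dG dB eA eB
  have dT : ∀ a b c, DifferentiableAt ℝ (fun y => torsionLow h y a b c) x := fun a b c =>
    L.diffAt hx (L.contDiffOn_torsionLow a b c)
  -- Here and in `h2` a known lowered coefficient is differentiated and the product rule is applied
  -- to its expression as a sum over p.
  have h1 : t * (metricHess h x i j k l - metricHess h x i l k j) =
      ∑ p, (pd i (fun y => christoffelBar cov y j k p) x * hMat h x p l +
        christoffelBar cov x j k p * pd i (fun y => hMat h y p l) x) := by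
    rw [← L.pd_star_torsionLow hx i j l k, pd,
      ← cderiv_const_mul _ (L.diffAt hx (contDiffOn_star
        (L.contDiffOn_torsionLow j l k))),
      ← L.cderiv_congr hx fun y hy => christoffelBar_gauduchon_low L hy hch hsb t j k l,
      cderiv_sum (f := fun p y => christoffelBar (gauduchon ch sb t) y j k p * hMat h y p l) _
        fun p _ => (dB j k p).fun_mul (L.diffAt_hMat hx p l)]
    exact Finset.sum_congr rfl fun p _ => cderiv_mul (dB j k p) (L.diffAt_hMat hx p l)
  have h2 : metricHess h x i j k l - t * (metricHess h x i j k l - metricHess h x k j i l) =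
      ∑ p, (pdb j (fun y => christoffel cov y i k p) x * hMat h x p l +
        christoffel cov x i k p * pdb j (fun y => hMat h y p l) x) := by
    rw [← L.pdb_torsionLow hx j i k l, ← L.pdb_pd_hMat hx i j k l, pdb, pdb,
      ← cderiv_const_mul _ (dT i k l),
      ← cderiv_sub (L.diffAt hx (L.contDiffOn_pd_hMat i k l)) ((dT i k l).const_mul _),
      ← L.cderiv_congr hx fun y hy => christoffel_gauduchon_low L hy hch hsb t i k l,
      cderiv_sum (f := fun p y => christoffel (gauduchon ch sb t) y i k p * hMat h y p l) _
        fun p _ => (dG i k p).fun_mul (L.diffAt_hMat hx p l)]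
    exact Finset.sum_congr rfl fun p _ => cderiv_mul (dG i k p) (L.diffAt_hMat hx p l)
  -- Lowering the free index of the quadratic terms, here and in `h4`, reproduces the
  -- derivative-of-h sums of `h1` and `h2` with the sign that cancels them.
  have h3 : ∑ p, (∑ q, christoffelBar cov x j k q * christoffel cov x i q p) * hMat h x p l =
      ∑ q, christoffelBar cov x j k q * pd i (fun y => hMat h y q l) x
      - ∑ p, ∑ q, hUp h x p q *
        ((t * star (torsionLow h x j q k)) * (t * torsionLow h x i p l)) := by
    simp only [Finset.sum_mul]
    rw [Finset.sum_comm, ← Finset.sum_sub_distrib]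
    refine Finset.sum_congr rfl fun q _ => ?_
    simp only [mul_assoc, ← Finset.mul_sum]
    rw [hA, mul_sub, eB]
    congr 1
    rw [Finset.sum_mul]
    exact Finset.sum_congr rfl fun r _ => by ring
  have h4 : ∑ p, (∑ q, christoffel cov x i k q * christoffelBar cov x j q p) * hMat h x p l =
      ∑ q, christoffel cov x i k q * pdb j (fun y => hMat h y q l) x
      - ∑ p, ∑ q, hUp h x p q *
      ((pd i (fun y => hMat h y k q) x - t * torsionLow h x i k q) *
        star (pd j (fun y => hMat h y l p) x - t * torsionLow h x j l p)) := by
    simp only [Finset.sum_mul]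
    rw [Finset.sum_comm, ← Finset.sum_sub_distrib]
    refine Finset.sum_congr rfl fun q _ => ?_
    simp only [mul_assoc, ← Finset.mul_sum]
    have ht : star (t : ℂ) = t := Complex.conj_ofReal t
    -- By metric compatibility the lowered (0,1)-coefficient is a derivative of h minus a conjugated
    -- (1,0)-coefficient, so the remaining quadratic term pairs two (1,0)-coefficients.
    have e : (t : ℂ) * star (torsionLow h x j l q) = pdb j (fun y => hMat h y q l) x -
        star (pd j (fun y => hMat h y l q) x - t * torsionLow h x j l q) := by
      rw [L.pdb_hMat hx, star_sub, star_mul', ht]; ring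
    rw [hB, e, mul_sub, eA]
    congr 1
    rw [Finset.sum_mul]
    exact Finset.sum_congr rfl fun r _ => by ring
  rw [curv, hC_holo_dZbar]
  simp only [hcov, curvature_gauduchon_apply L hx hch hsb t]
  conv_lhs =>
    simp only [← hcov, sub_mul, add_mul, Finset.sum_sub_distrib, Finset.sum_add_distrib]
  have h5 : ∀ A B : Fin n → Fin n → ℂ, ∑ p, ∑ q, (hUp h x p q * (A p q - B p q)) =
      ∑ p, ∑ q, hUp h x p q * A p q - ∑ p, ∑ q, hUp h x p q * B p q := fun A B => by
    simp only [← Finset.sum_sub_distrib, ← mul_sub]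
  rw [h3, h4, h1, h2, h5]
  simp only [Finset.sum_add_distrib]
  ring

theorem curv_chern (i j k l : Fin n) : curv h ch x i j k l =
    - metricHess h x i j k l + ∑ p, ∑ q, hUp h x p q *
      (pd i (fun y => hMat h y k q) x * star (pd j (fun y => hMat h y l p) x)) := by
  have := curv_gauduchon L hx hch hsb 0 i j k l
  rw [gauduchon_zero] at this
  rw [this]; simp

/-- The curvature of the Gauduchon connection, the torsion terms with lowered indices. -/
theorem curv_gauduchon_eq (i j k l : Fin n) : curv h (gauduchon ch sb t) x i j k l =
    curv h ch x i j k l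
    + t * (curv h ch x i l k j + curv h ch x k j i l - 2 * curv h ch x i j k l)
    + t ^ 2 * ∑ p, ∑ q, hUp h x p q *
      (torsionLow h x i k q * star (torsionLow h x j l p)
        - torsionLow h x i p l * star (torsionLow h x j q k)) := by
  have ht : star (t : ℂ) = t := Complex.conj_ofReal t
  simp only [curv_chern L hx hch hsb, curv_gauduchon L hx hch hsb t]
  -- Expansion in powers of t, term by term. As T_{i k q̄} antisymmetrises ∂_i h_{k q̄}, the linear
  -- coefficient is the quadratic part of the Chern curvature with j, l or i, k exchanged, minus
  -- twice the original.
  have key : ∑ p, ∑ q, hUp h x p q *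
      ((pd i (fun y => hMat h y k q) x - t * torsionLow h x i k q) *
        star (pd j (fun y => hMat h y l p) x - t * torsionLow h x j l p)
      - (t * star (torsionLow h x j q k)) * (t * torsionLow h x i p l)) =
    ∑ p, ∑ q, (hUp h x p q *
      (pd i (fun y => hMat h y k q) x * star (pd j (fun y => hMat h y l p) x)) +
      t * (hUp h x p q * (pd i (fun y => hMat h y k q) x * star (pd l (fun y => hMat h y j p) x)) +
        hUp h x p q * (pd k (fun y => hMat h y i q) x * star (pd j (fun y => hMat h y l p) x)) -
      2 * (hUp h x p q *
        (pd i (fun y => hMat h y k q) x * star (pd j (fun y => hMat h y l p) x)))) +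
      t ^ 2 * (hUp h x p q *
      (torsionLow h x i k q * star (torsionLow h x j l p)
        - torsionLow h x i p l * star (torsionLow h x j q k)))) := by
    refine Finset.sum_congr rfl fun p _ => Finset.sum_congr rfl fun q _ => ?_
    simp only [torsionLow, star_sub, star_mul', ht]
    ring
  rw [key]
  simp only [Finset.sum_add_distrib, Finset.sum_sub_distrib, ← Finset.mul_sum]
  ring

end

/-! ### Existence of the Chern and Strominger–Bismut connections -/

/-- The covariant derivative of `∂/∂zᵏ` for the connection with coefficients `G`, `B` along
`∂/∂zⁱ`, `∂/∂z̄ⁱ`. -/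
def connForm (G B : (Fin n → ℂ) → Fin n → Fin n → (Fin n → ℂ)) (x : Fin n → ℂ) (k : Fin n) :
    (Fin n → ℂ) →L[ℝ] (Fin n → ℂ) :=
  ∑ i, ((dz i).smulRight (G x i k) + (dzbar i).smulRight (B x i k))

/-- The complex linear connection with prescribed coefficients. -/
def connOf (G B : (Fin n → ℂ) → Fin n → Fin n → (Fin n → ℂ)) : Conn n := fun Y x =>
  fderiv ℝ Y x + ∑ k, Y x k • connForm G B x k

variable {h : MetricField n} {U : Set (Fin n → ℂ)}
  {G B : (Fin n → ℂ) → Fin n → Fin n → (Fin n → ℂ)}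

theorem dz_apply (i : Fin n) (v : Fin n → ℂ) : dz i v = v i := rfl

theorem dzbar_apply (i : Fin n) (v : Fin n → ℂ) : dzbar i v = star (v i) := rfl

theorem connForm_apply (x : Fin n → ℂ) (k : Fin n) (v : Fin n → ℂ) :
    connForm G B x k v = ∑ i, (v i • G x i k + star (v i) • B x i k) := by
  simp [connForm, dz_apply, dzbar_apply, sum_apply]

theorem connOf_apply (Y : (Fin n → ℂ) → (Fin n → ℂ)) (x v : Fin n → ℂ) :
    connOf G B Y x v = fderiv ℝ Y x v + ∑ k, Y x k • connForm G B x k v := by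
  simp [connOf, sum_apply]

theorem connOf_add {Y Z : (Fin n → ℂ) → (Fin n → ℂ)} {x : Fin n → ℂ}
    (hY : DifferentiableAt ℝ Y x) (hZ : DifferentiableAt ℝ Z x) :
    connOf G B (Y + Z) x = connOf G B Y x + connOf G B Z x := by
  ext v : 1
  simp only [connOf_apply, add_apply, fderiv_add hY hZ, Pi.add_apply, add_smul,
    Finset.sum_add_distrib]
  abel

theorem connOf_smul {Y : (Fin n → ℂ) → (Fin n → ℂ)} {f : (Fin n → ℂ) → ℝ} {x : Fin n → ℂ}
    (hf : DifferentiableAt ℝ f x) (hY : DifferentiableAt ℝ Y x) :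
    connOf G B (f • Y) x = f x • connOf G B Y x + (fderiv ℝ f x).smulRight (Y x) := by
  simp only [connOf, fderiv_smul hf hY, Pi.smul_apply', Pi.smul_apply, smul_add, Finset.smul_sum,
    smul_assoc]
  abel

/-- `connOf` commutes with J by construction. The hypothesis `hGB` is the ∂/∂zⁱ part of metric
compatibility, and the ∂/∂z̄ⁱ part is its conjugate; so prescribing coefficients suffices for both
existence proofs. -/
theorem isHermitianConn_connOf (L : IsLocalHermitian h U)
    (hGB : ∀ x ∈ U, ∀ i k l, pd i (fun y => hMat h y k l) x =
      ∑ p, G x i k p * hMat h x p l + ∑ p, star (B x i l p) * hMat h x k p) :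
    IsHermitianConn h U (connOf G B) where
  isCov :=
    { add := fun hσ hσ' _ => connOf_add (mdifferentiableAt_vectorField_iff.1 hσ)
        (mdifferentiableAt_vectorField_iff.1 hσ')
      leibniz := fun hσ hf _ => by
        refine Eq.trans (connOf_smul (mdifferentiableAt_iff_differentiableAt.1 hf)
          (mdifferentiableAt_vectorField_iff.1 hσ)) ?_
        rw [mvfderiv, mfderiv_eq_fderiv]
        rfl }
  metric := by
    intro x hx Y Z hY hZ v
    have hYk : ∀ k, DifferentiableAt ℝ (fun y => Y y k) x := differentiableAt_pi.1 hY
    have hZk : ∀ k, DifferentiableAt ℝ (fun y => Z y k) x := differentiableAt_pi.1 hZ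
    have hZs : ∀ k, DifferentiableAt ℝ (fun y => star (Z y k)) x := fun k =>
      ((conjCLE : ℂ →L[ℝ] ℂ).differentiableAt.comp x (hZk k))
    have hcd : ∀ f : (Fin n → ℂ) → ℂ, cderiv (toC v) f x = fderiv ℝ f x v := fun f => by
      simp [cderiv, reC_toC, imC_toC]
    have hconj : conjT (toC v) = toC v := by simp [conjT, toC]
    have hdY : ∀ k, cderiv (toC v) (fun y => Y y k) x = fderiv ℝ Y x v k := by
      intro k; rw [hcd, fderiv_apply hY]; rfl
    have hdZ : ∀ k, cderiv (toC v) (fun y => star (Z y k)) x = star (fderiv ℝ Z x v k) := by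
      intro k; rw [cderiv_star (hZk k), hconj, hcd, fderiv_apply hZ]; rfl
    have hdH : ∀ k l, cderiv (toC v) (fun y => hMat h y k l) x =
        herm h x (connForm G B x k v) (Pi.single l 1) +
        herm h x (Pi.single k 1) (connForm G B x l v) := by
      intro k l
      have e : ∀ a, pdb a (fun y => hMat h y k l) x =
          herm h x (B x a k) (Pi.single l 1) + herm h x (Pi.single k 1) (G x a l) := by
        intro a
        rw [L.pdb_hMat hx, hGB x hx, herm_single_right, herm_single_left]
        simp only [star_add, star_sum, star_mul', star_star, L.star_hMat hx]
        rw [add_comm]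
      have e' : ∀ a, pd a (fun y => hMat h y k l) x =
          herm h x (G x a k) (Pi.single l 1) + herm h x (Pi.single k 1) (B x a l) := by
        intro a
        rw [hGB x hx, herm_single_right, herm_single_left]
      rw [cderiv_eq_extC, extC_eq_sum]
      simp only [connForm_apply, herm_sum_left, herm_sum_right, herm_add_left, herm_add_right,
        herm_smul_left, herm_smul_right, star_star]
      simp only [← cderiv_eq_extC]
      rw [← Finset.sum_add_distrib, ← Finset.sum_add_distrib]
      refine Finset.sum_congr rfl fun a _ => ?_
      have e1 := e a
      have e2 := e' a
      rw [pdb] at e1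
      rw [pd] at e2
      rw [e1, e2]
      simp only [toC, smul_eq_mul, Pi.star_apply]
      ring
    -- The Hermitian form K is parallel; since g = 2 Re K, so is g.
    have hherm : cderiv (toC v) (fun y => herm h y (Y y) (Z y)) x =
        herm h x (connOf G B Y x v) (Z x) + herm h x (Y x) (connOf G B Z x v) := by
      have hd : ∀ i j, DifferentiableAt ℝ (fun y => Y y i * star (Z y j) * hMat h y i j) x :=
        fun i j => ((hYk i).fun_mul (hZs j)).fun_mul (L.diffAt_hMat hx i j)
      have e1 : herm h x (connOf G B Y x v) (Z x) = herm h x (fderiv ℝ Y x v) (Z x) +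
          ∑ i, ∑ j, Y x i * star (Z x j) * herm h x (connForm G B x i v) (Pi.single j 1) := by
        rw [connOf_apply, herm_add_left, herm_sum_left]
        congr 1
        refine Finset.sum_congr rfl fun i _ => ?_
        conv_lhs => rw [vec_eq_sum (Z x)]
        simp only [herm_sum_right, herm_smul_left, herm_smul_right, mul_assoc]
        exact Finset.sum_congr rfl fun j _ => by ring
      have e2 : herm h x (Y x) (connOf G B Z x v) = herm h x (Y x) (fderiv ℝ Z x v) +
          ∑ i, ∑ j, Y x i * star (Z x j) * herm h x (Pi.single i 1) (connForm G B x j v) := by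
        rw [connOf_apply, herm_add_right, herm_sum_right, Finset.sum_comm]
        congr 1
        refine Finset.sum_congr rfl fun i _ => ?_
        conv_lhs => rw [vec_eq_sum (Y x)]
        simp only [herm_sum_left, herm_smul_left, herm_smul_right, Finset.mul_sum, mul_assoc]
        exact Finset.sum_congr rfl fun j _ => by ring
      rw [e1, e2]
      simp only [herm]
      rw [cderiv_sum (f := fun i y => ∑ j, Y y i * star (Z y j) * hMat h y i j) _
        fun i _ => DifferentiableAt.fun_sum fun j _ => hd i j]
      simp only [fun i => cderiv_sum (Z := toC v) (f := fun j y => Y y i * star (Z y j) * hMat h y i j)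
        Finset.univ fun j _ => hd i j]
      simp only [← Finset.sum_add_distrib]
      refine Finset.sum_congr rfl fun i _ => Finset.sum_congr rfl fun j _ => ?_
      rw [cderiv_mul ((hYk i).fun_mul (hZs j)) (L.diffAt_hMat hx i j),
        cderiv_mul (hYk i) (hZs j), hdY, hdZ, hdH]
      simp only [herm]
      ring
    have hd : DifferentiableAt ℝ (fun y => herm h y (Y y) (Z y)) x :=
      DifferentiableAt.fun_sum fun i _ => DifferentiableAt.fun_sum fun j _ =>
        ((hYk i).fun_mul (hZs j)).fun_mul (L.diffAt_hMat hx i j)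
    have e : (fun y => h y (Y y) (Z y)) =ᶠ[nhds x] fun y => 2 * Complex.reCLM (herm h y (Y y) (Z y)) :=
      Filter.eventuallyEq_of_mem (L.isOpen.mem_nhds hx) fun y hy => L.apply_eq_re_herm hy _ _
    have hf := (Complex.reCLM.hasFDerivAt.comp x hd.hasFDerivAt).const_mul (2 : ℝ)
    rw [e.fderiv_eq, L.apply_eq_re_herm hx, L.apply_eq_re_herm hx, ← mul_add, ← Complex.add_re,
      ← hherm, hcd]
    refine (congrArg (fun T => T v) hf.fderiv).trans ?_
    simp
  complex := by
    intro x _ Y hY v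
    rw [connOf_apply, connOf_apply, fderiv_fun_const_smul hY]
    simp only [smul_apply, smul_add, Finset.smul_sum, Pi.smul_apply, smul_assoc]

/-- Raising the index of ∂_i h_{k l̄} and taking zero (0,1)-coefficients gives metric compatibility
by `lower_raise`. The (0,1)-part is ∂̄ because the connection form involves only the dzⁱ, which
vanish on (0,1)-vectors. -/
theorem exists_chern (L : IsLocalHermitian h U) : ∃ ch, IsRealChern h U ch := by
  let G : (Fin n → ℂ) → Fin n → Fin n → (Fin n → ℂ) := fun x i k p =>
    ∑ l, hUp h x p l * pd i (fun y => hMat h y k l) x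
  have hH : IsHermitianConn h U (connOf G fun _ _ _ => 0) :=
    isHermitianConn_connOf L fun x hx i k l => by
      simp only [G, L.lower_raise hx]; simp
  refine ⟨connOf G fun _ _ _ => 0, hH, fun x hx s hs b => ?_⟩
  rw [hH.covC_holo hx hs, cderiv_eq_extC, extC_apply, extC_apply, connOf_apply, connOf_apply]
  have e : ∀ k, connForm G (fun _ _ _ => 0) x k (reC (0, b)) +
      I • connForm G (fun _ _ _ => 0) x k (imC (0, b)) = 0 := by
    intro k
    rw [← extC_apply, extC_eq_sum]
    have e' : ∀ i, extC (connForm G (fun _ _ _ => 0) x k) (dZbar i) = 0 := by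
      intro i
      rw [extC_apply, connForm_apply, connForm_apply, Finset.smul_sum, ← Finset.sum_add_distrib]
      refine Finset.sum_eq_zero fun j _ => ?_
      rw [reC_dZbar, imC_dZbar]
      simp only [Pi.smul_apply, smul_eq_mul, smul_zero, add_zero, smul_smul, ← add_smul]
      have : (1 / 2 : ℂ) * (Pi.single i 1 : Fin n → ℂ) j +
          I * (I / 2 * (Pi.single i 1 : Fin n → ℂ) j) = 0 := by
        linear_combination (1 / 2 * (Pi.single i 1 : Fin n → ℂ) j) * I_mul_I
      rw [this, zero_smul]
    simp [e']
  have e2 : ∑ k, s x k • connForm G (fun _ _ _ => 0) x k (reC (0, b)) +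
      I • ∑ k, s x k • connForm G (fun _ _ _ => 0) x k (imC (0, b)) = 0 := by
    rw [Finset.smul_sum, ← Finset.sum_add_distrib]
    refine Finset.sum_eq_zero fun k _ => ?_
    rw [smul_comm I, ← smul_add, e, smul_zero]
  rw [smul_add, add_add_add_comm, e2, add_zero]

/-- A trilinear identity behind the total skew-symmetry of the Strominger–Bismut torsion. -/
theorem skew_sum_re (a b : Fin n → Fin n → Fin n → ℂ) (hb : ∀ i j k, b k j i = - b i j k)
    (hab : ∀ i j k, star (a i j k) = - b i k j) (X Y Z : Fin n → ℂ) :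
    (∑ i, ∑ j, ∑ k, (X i * Y j * star (Z k) * a i j k + star (X i) * Y j * star (Z k) * b i j k
        - X i * star (Y j) * star (Z k) * b j i k)).re =
    -(∑ i, ∑ j, ∑ k, (X i * Z j * star (Y k) * a i j k + star (X i) * Z j * star (Y k) * b i j k
        - X i * star (Z j) * star (Y k) * b j i k)).re := by
  have hba : ∀ i j k, star (b i j k) = - a i k j := fun i j k => by
    rw [← star_star (a i k j), hab, star_neg, neg_neg]
  -- Conjugation carries the a-sum with Y, Z exchanged to minus the first b-sum, and real parts do
  -- not see it. The last sum is already skew in Y, Z (`e2`).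
  have e1 : ∀ Y Z : Fin n → ℂ, star (∑ i, ∑ j, ∑ k, X i * Z j * star (Y k) * a i j k) =
      -∑ i, ∑ j, ∑ k, star (X i) * Y j * star (Z k) * b i j k := by
    intro Y Z
    simp only [star_sum, star_mul', star_star, hab, ← Finset.sum_neg_distrib]
    refine Finset.sum_congr rfl fun i _ => ?_
    rw [Finset.sum_comm]
    exact Finset.sum_congr rfl fun j _ => Finset.sum_congr rfl fun k _ => by ring
  have e2 : ∑ i, ∑ j, ∑ k, X i * star (Y j) * star (Z k) * b j i k =
      -∑ i, ∑ j, ∑ k, X i * star (Z j) * star (Y k) * b j i k := by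
    simp only [← Finset.sum_neg_distrib]
    refine Finset.sum_congr rfl fun i _ => ?_
    rw [Finset.sum_comm]
    refine Finset.sum_congr rfl fun j _ => Finset.sum_congr rfl fun k _ => ?_
    rw [hb]; ring
  simp only [Finset.sum_add_distrib, Finset.sum_sub_distrib]
  rw [e2]
  have r1 := congrArg Complex.re (e1 Y Z)
  have r2 := congrArg Complex.re (e1 Z Y)
  have hre : ∀ z : ℂ, (star z).re = z.re := Complex.conj_re
  rw [hre, Complex.neg_re] at r1 r2
  simp only [Complex.add_re, Complex.sub_re, Complex.neg_re]
  linarith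

/-- The coefficients are the ones forced by `IsRealStromingerBismut.christoffel_low` and
`christoffelBar_low`. The torsion then has components -T and conj(T), whose symmetries are the
assumptions of `skew_sum_re`. -/
theorem exists_strominger_bismut (L : IsLocalHermitian h U) :
    ∃ sb, IsRealStromingerBismut h U sb := by
  let G : (Fin n → ℂ) → Fin n → Fin n → (Fin n → ℂ) := fun x i k p =>
    ∑ l, hUp h x p l * pd k (fun y => hMat h y i l) x
  let B : (Fin n → ℂ) → Fin n → Fin n → (Fin n → ℂ) := fun x j k p =>
    ∑ l, hUp h x p l * star (torsionLow h x j l k)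
  have hGl : ∀ x ∈ U, ∀ i k l, ∑ p, G x i k p * hMat h x p l = pd k (fun y => hMat h y i l) x :=
    fun x hx i k l => by simp only [G, L.lower_raise hx]
  have hBl : ∀ x ∈ U, ∀ j k l, ∑ p, B x j k p * hMat h x p l = star (torsionLow h x j l k) :=
    fun x hx i k l => by simp only [B, L.lower_raise hx]
  have hH : IsHermitianConn h U (connOf G B) := by
    refine isHermitianConn_connOf L fun x hx i k l => ?_
    have e : ∑ p, star (B x i l p) * hMat h x k p = torsionLow h x i k l := by
      rw [← star_star (torsionLow h x i k l), ← hBl x hx]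
      simp only [star_sum, star_mul', L.star_hMat hx]
    rw [e, hGl x hx, torsionLow]; ring
  refine ⟨connOf G B, hH, fun x hx X Y Z hX hY hZ => ?_⟩
  set b : Fin n → Fin n → Fin n → ℂ := fun i j k => star (torsionLow h x i k j) with hb
  set a : Fin n → Fin n → Fin n → ℂ := fun i j k => - torsionLow h x i j k with ha
  have htor : ∀ X Y : (Fin n → ℂ) → (Fin n → ℂ), torsion (connOf G B) X Y x =
      ∑ i, ∑ j, ((X x i * Y x j) • (G x i j - G x j i) + (star (X x i) * Y x j) • B x i j
        - (X x i * star (Y x j)) • B x j i) := by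
    intro X Y
    rw [torsion, VectorField.lieBracket, connOf_apply, connOf_apply]
    have e : ∑ k, Y x k • connForm G B x k (X x) = ∑ i, ∑ j, ((X x i * Y x j) • G x i j +
        (star (X x i) * Y x j) • B x i j) := by
      simp only [connForm_apply, Finset.smul_sum, smul_add, smul_smul]
      rw [Finset.sum_comm]
      exact Finset.sum_congr rfl fun i _ => Finset.sum_congr rfl fun j _ => by
        rw [mul_comm (Y x j), mul_comm (Y x j)]
    have e' : ∑ k, X x k • connForm G B x k (Y x) = ∑ i, ∑ j, ((X x i * Y x j) • G x j i +
        (X x i * star (Y x j)) • B x j i) := by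
      simp only [connForm_apply, Finset.smul_sum, smul_add, smul_smul]
    -- P and R are the derivatives of the two fields; they cancel against the Lie bracket, so the
    -- torsion is tensorial.
    have e3 : ∀ P Q R S : Fin n → ℂ, P + Q - (R + S) - (P - R) = Q - S := fun P Q R S => by abel
    rw [e, e', e3]
    simp only [← Finset.sum_sub_distrib]
    refine Finset.sum_congr rfl fun i _ => Finset.sum_congr rfl fun j _ => ?_
    module
  have hherm : ∀ X Y Z : (Fin n → ℂ) → (Fin n → ℂ), herm h x (torsion (connOf G B) X Y x) (Z x) =
      ∑ i, ∑ j, ∑ k, (X x i * Y x j * star (Z x k) * a i j k +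
        star (X x i) * Y x j * star (Z x k) * b i j k
        - X x i * star (Y x j) * star (Z x k) * b j i k) := by
    intro X Y Z
    rw [htor]
    conv_lhs => rw [vec_eq_sum (Z x)]
    have e1 : ∀ i j k, herm h x (G x i j - G x j i) (Pi.single k 1) = a i j k := by
      intro i j k
      rw [herm_sub_left, herm_single_right, herm_single_right, hGl x hx, hGl x hx]
      simp only [ha, torsionLow]; ring
    have e2 : ∀ i j k, herm h x (B x i j) (Pi.single k 1) = b i j k := by
      intro i j k
      rw [herm_single_right, hBl x hx]
    simp only [herm_sum_left, herm_sub_left _ _ (_ + _), herm_add_left, herm_smul_left,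
      herm_sum_right, herm_smul_right, e1, e2, Finset.mul_sum]
    rw [Finset.sum_comm]
    refine Finset.sum_congr rfl fun i _ => ?_
    rw [Finset.sum_comm]
    refine Finset.sum_congr rfl fun j _ => ?_
    exact Finset.sum_congr rfl fun k _ => by ring
  rw [L.apply_eq_re_herm hx, L.apply_eq_re_herm hx, hherm, hherm, skew_sum_re]
  · ring
  · intro i j k
    simp only [hb, ← star_neg, torsionLow]
    congr 1; ring
  · intro i j k
    simp only [ha, hb, star_neg]

/-! ### Wedge products and contractions -/

/-- The 1-form attached to a real linear map. -/
def form1 (b : (Fin n → ℂ) →L[ℝ] ℂ) : (Fin n → ℂ) [⋀^Fin 1]→L[ℝ] ℂ :=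
  ContinuousAlternatingMap.ofSubsingleton ℝ (Fin n → ℂ) ℂ (0 : Fin 1) b

/-- The wedge product `a ∧ B` of a 1-form with a `k`-form. -/
def wedge1 {k : ℕ} (a : (Fin n → ℂ) →L[ℝ] ℂ) (B : (Fin n → ℂ) [⋀^Fin k]→L[ℝ] ℂ) :
    (Fin n → ℂ) [⋀^Fin (k + 1)]→L[ℝ] ℂ :=
  ContinuousAlternatingMap.alternatizeUncurryFin (a.smulRight B)

theorem wedge_eq (a b : (Fin n → ℂ) →L[ℝ] ℂ) : wedge a b = wedge1 a (form1 b) := rfl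

section scalars

variable {k : ℕ} {ι : Type*} (s : Finset ι) (a b : ℂ) (α : (Fin n → ℂ) [⋀^Fin k]→L[ℝ] ℂ)

theorem form_zero_smul : (0 : ℂ) • α = 0 := zero_smul ℂ α

theorem form_smul_zero : a • (0 : (Fin n → ℂ) [⋀^Fin k]→L[ℝ] ℂ) = 0 := by
  rw [← form_zero_smul (0 : (Fin n → ℂ) [⋀^Fin k]→L[ℝ] ℂ), smul_smul, mul_zero]

theorem form_neg_smul : (-a) • α = -(a • α) := neg_smul a α

theorem form_add_smul : (a + b) • α = a • α + b • α := add_smul a b α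

theorem form_sub_smul : (a - b) • α = a • α - b • α := sub_smul a b α

theorem form_sum_smul (f : ι → ℂ) : (∑ i ∈ s, f i) • α = ∑ i ∈ s, f i • α := by
  classical
  induction s using Finset.induction_on with
  | empty => exact form_zero_smul α
  | insert i s hi ih => rw [Finset.sum_insert hi, Finset.sum_insert hi, form_add_smul, ih]

end scalars

section algebra

variable {k : ℕ} {ι : Type*} (s : Finset ι) (a : (Fin n → ℂ) →L[ℝ] ℂ)

theorem alternatize_sum (f : ι → (Fin n → ℂ) →L[ℝ] (Fin n → ℂ) [⋀^Fin k]→L[ℝ] ℂ) :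
    ContinuousAlternatingMap.alternatizeUncurryFin (∑ i ∈ s, f i) =
      ∑ i ∈ s, ContinuousAlternatingMap.alternatizeUncurryFin (f i) :=
  map_sum (ContinuousAlternatingMap.alternatizeUncurryFinCLM ℝ (Fin n → ℂ) ℂ) f s

theorem wedge1_add (B C : (Fin n → ℂ) [⋀^Fin k]→L[ℝ] ℂ) :
    wedge1 a (B + C) = wedge1 a B + wedge1 a C := by
  rw [wedge1, wedge1, wedge1, ← ContinuousAlternatingMap.alternatizeUncurryFin_add]
  congr 1
  ext v : 1
  simp

theorem wedge1_smul (c : ℂ) (B : (Fin n → ℂ) [⋀^Fin k]→L[ℝ] ℂ) :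
    wedge1 a (c • B) = c • wedge1 a B := by
  rw [wedge1, wedge1, ← ContinuousAlternatingMap.alternatizeUncurryFin_smul]
  congr 1
  ext v : 1
  simp [smul_smul, mul_comm]

theorem wedge1_neg (B : (Fin n → ℂ) [⋀^Fin k]→L[ℝ] ℂ) : wedge1 a (-B) = - wedge1 a B := by
  have := wedge1_smul a (-1) B
  rwa [form_neg_smul, form_neg_smul, one_smul, one_smul] at this

theorem wedge1_sub (B C : (Fin n → ℂ) [⋀^Fin k]→L[ℝ] ℂ) :
    wedge1 a (B - C) = wedge1 a B - wedge1 a C := by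
  rw [sub_eq_add_neg, wedge1_add, wedge1_neg, sub_eq_add_neg]

variable (Z : CTan n)

theorem contract_add (α β : (Fin n → ℂ) [⋀^Fin (k + 1)]→L[ℝ] ℂ) :
    contract Z (α + β) = contract Z α + contract Z β := by
  simp only [contract, ContinuousAlternatingMap.curryLeft_add, add_apply]; module

theorem contract_smul (c : ℂ) (α : (Fin n → ℂ) [⋀^Fin (k + 1)]→L[ℝ] ℂ) :
    contract Z (c • α) = c • contract Z α := by
  ext v
  simp [contract]; ring

theorem contract_zero : contract Z (0 : (Fin n → ℂ) [⋀^Fin (k + 1)]→L[ℝ] ℂ) = 0 := by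
  have := contract_smul Z 0 (0 : (Fin n → ℂ) [⋀^Fin (k + 1)]→L[ℝ] ℂ)
  rwa [form_zero_smul, form_zero_smul] at this

theorem contract_neg (α : (Fin n → ℂ) [⋀^Fin (k + 1)]→L[ℝ] ℂ) :
    contract Z (-α) = - contract Z α := by
  have := contract_smul Z (-1) α
  rwa [form_neg_smul, form_neg_smul, one_smul, one_smul] at this

theorem contract_sub (α β : (Fin n → ℂ) [⋀^Fin (k + 1)]→L[ℝ] ℂ) :
    contract Z (α - β) = contract Z α - contract Z β := by
  rw [sub_eq_add_neg, contract_add, contract_neg, sub_eq_add_neg]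

theorem contract_sum (α : ι → (Fin n → ℂ) [⋀^Fin (k + 1)]→L[ℝ] ℂ) :
    contract Z (∑ i ∈ s, α i) = ∑ i ∈ s, contract Z (α i) := by
  classical
  induction s using Finset.induction_on with
  | empty => simp [contract_zero]
  | insert i s hi ih => rw [Finset.sum_insert hi, Finset.sum_insert hi, contract_add, ih]

/-- Interior multiplication is an antiderivation: the first term of the alternating sum feeds v to
a, the others leave v in the first slot of B with the sign shifted by one. -/
theorem curryLeft_wedge1 (B : (Fin n → ℂ) [⋀^Fin (k + 1)]→L[ℝ] ℂ) (v : Fin n → ℂ) :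
    (wedge1 a B).curryLeft v = a v • B - wedge1 a (B.curryLeft v) := by
  ext w
  rw [ContinuousAlternatingMap.curryLeft_apply_apply, wedge1,
    ContinuousAlternatingMap.alternatizeUncurryFin_apply, Fin.sum_univ_succ, wedge1,
    ContinuousAlternatingMap.sub_apply, ContinuousAlternatingMap.alternatizeUncurryFin_apply,
    sub_eq_add_neg, ← Finset.sum_neg_distrib]
  congr 1
  · simp [Matrix.vecCons]
  · refine Finset.sum_congr rfl fun i _ => ?_
    have e : (Fin.succ i).removeNth (Matrix.vecCons v w) = Matrix.vecCons v (i.removeNth w) := by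
      ext j
      refine Fin.cases ?_ (fun j => ?_) j
      · simp [Fin.removeNth, Matrix.vecCons]
      · simp [Fin.removeNth, Matrix.vecCons]
    rw [e]
    simp [pow_succ]

theorem contract_wedge1 (B : (Fin n → ℂ) [⋀^Fin (k + 1)]→L[ℝ] ℂ) :
    contract Z (wedge1 a B) = extC a Z • B - wedge1 a (contract Z B) := by
  rw [contract, curryLeft_wedge1, curryLeft_wedge1, contract, wedge1_add, wedge1_smul, extC_apply]
  module

/-- The constant `0`-form. -/
def form0 (c : ℂ) : (Fin n → ℂ) [⋀^Fin 0]→L[ℝ] ℂ :=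
  ContinuousAlternatingMap.constOfIsEmpty ℝ (Fin n → ℂ) (Fin 0) c

theorem contract_form1 (b : (Fin n → ℂ) →L[ℝ] ℂ) : contract Z (form1 b) = form0 (extC b Z) := by
  ext v
  simp [contract, form1, form0, extC_apply]

theorem wedge1_form0 (c : ℂ) : wedge1 a (form0 c) = c • form1 a := by
  ext v
  simp [wedge1, form0, form1, ContinuousAlternatingMap.alternatizeUncurryFin_apply, mul_comm]

theorem contract_wedge (b : (Fin n → ℂ) →L[ℝ] ℂ) :
    contract Z (wedge a b) = extC a Z • form1 b - extC b Z • form1 a := by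
  rw [wedge_eq, contract_wedge1, contract_form1, wedge1_form0]

theorem form2_ext {α β : (Fin n → ℂ) [⋀^Fin 2]→L[ℝ] ℂ} (h : ∀ v w, α ![v, w] = β ![v, w]) :
    α = β := by
  ext v
  have : v = ![v 0, v 1] := by
    ext i; fin_cases i <;> rfl
  rw [this, h]

theorem wedge_swap (b : (Fin n → ℂ) →L[ℝ] ℂ) : wedge a b = - wedge b a := by
  refine form2_ext fun v w => ?_
  rw [ContinuousAlternatingMap.neg_apply, wedge_apply, wedge_apply]; ring

end algebra

theorem extC_dz_dZ (i j : Fin n) : extC (dz i) (dZ j) = if i = j then 1 else 0 := by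
  rw [extC_apply, reC_dZ, imC_dZ, dz_apply, dz_apply]
  by_cases h : i = j
  · subst h
    simp only [Pi.smul_apply, Pi.single_eq_same, smul_eq_mul, if_true]
    linear_combination (-1 / 2 : ℂ) * I_mul_I
  · simp [h]

theorem extC_dz_dZbar (i j : Fin n) : extC (dz i) (dZbar j) = 0 := by
  rw [extC_apply, reC_dZbar, imC_dZbar, dz_apply, dz_apply]
  by_cases h : i = j
  · subst h
    simp only [Pi.smul_apply, Pi.single_eq_same, smul_eq_mul]
    linear_combination (1 / 2 : ℂ) * I_mul_I
  · simp [h]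

theorem extC_dzbar_dZ (i j : Fin n) : extC (dzbar i) (dZ j) = 0 := by
  have hI : star I = -I := conj_I
  rw [extC_apply, reC_dZ, imC_dZ, dzbar_apply, dzbar_apply]
  by_cases h : i = j
  · subst h
    simp only [Pi.smul_apply, Pi.single_eq_same, smul_eq_mul, star_mul', star_one, star_div₀,
      star_neg, hI, star_ofNat]
    linear_combination (1 / 2 : ℂ) * I_mul_I
  · simp [h]

theorem extC_dzbar_dZbar (i j : Fin n) : extC (dzbar i) (dZbar j) = if i = j then 1 else 0 := by
  have hI : star I = -I := conj_I
  rw [extC_apply, reC_dZbar, imC_dZbar, dzbar_apply, dzbar_apply]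
  by_cases h : i = j
  · subst h
    simp only [Pi.smul_apply, Pi.single_eq_same, smul_eq_mul, star_mul', star_one, star_div₀,
      hI, star_ofNat, if_true]
    linear_combination (-1 / 2 : ℂ) * I_mul_I
  · simp [h]

/-! ### `∂` and `∂̄` in coordinates -/

/-- Subtracting √-1 L(√-1 v) doubles the complex linear part of L and kills the antilinear part. -/
theorem holo_part (L : (Fin n → ℂ) →L[ℝ] ℂ) (v : Fin n → ℂ) :
    (1 / 2 : ℂ) * (L v - I * L (mulI v)) = ∑ a, v a * extC L (dZ a) := by
  rw [apply_eq_sum L v, apply_eq_sum L (mulI v)]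
  have hI : star I = -I := conj_I
  have e : ∀ a, (mulI v : Fin n → ℂ) a = I * v a := fun a => rfl
  simp only [e, star_mul', hI, smul_eq_mul, Finset.mul_sum, mul_add,
    ← Finset.sum_add_distrib, ← Finset.sum_sub_distrib]
  refine Finset.sum_congr rfl fun a _ => ?_
  linear_combination (1 / 2 * (- v a * extC L (dZ a) + star (v a) * extC L (dZbar a))) * I_mul_I

theorem antiholo_part (L : (Fin n → ℂ) →L[ℝ] ℂ) (v : Fin n → ℂ) :
    (1 / 2 : ℂ) * (L v + I * L (mulI v)) = ∑ a, star (v a) * extC L (dZbar a) := by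
  rw [apply_eq_sum L v, apply_eq_sum L (mulI v)]
  have hI : star I = -I := conj_I
  have e : ∀ a, (mulI v : Fin n → ℂ) a = I * v a := fun a => rfl
  simp only [e, star_mul', hI, smul_eq_mul, Finset.mul_sum, mul_add,
    ← Finset.sum_add_distrib]
  refine Finset.sum_congr rfl fun a _ => ?_
  linear_combination (1 / 2 * (v a * extC L (dZ a) - star (v a) * extC L (dZbar a))) * I_mul_I

section expansion

variable {k : ℕ} {ι : Type*} [Fintype ι] {α : DForm n k} {f : ι → (Fin n → ℂ) → ℂ}
  {B : ι → (Fin n → ℂ) [⋀^Fin k]→L[ℝ] ℂ} {x : Fin n → ℂ}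

theorem fderiv_expansion (hα : α =ᶠ[nhds x] fun y => ∑ s, f s y • B s)
    (hf : ∀ s, DifferentiableAt ℝ (f s) x) (v : Fin n → ℂ) :
    fderiv ℝ α x v = ∑ s, fderiv ℝ (f s) x v • B s := by
  have e : HasFDerivAt (fun y => ∑ s, f s y • B s)
      (∑ s, (fderiv ℝ (f s) x).smulRight (B s)) x :=
    HasFDerivAt.fun_sum fun s _ => (hf s).hasFDerivAt.smul_const (B s)
  rw [hα.fderiv_eq, e.fderiv, sum_apply]
  rfl

/-- The operator acts only on the coefficients of constant forms. An expansion near x is enough,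
because only the first derivative at x enters. -/
theorem del_eq_sum (hα : α =ᶠ[nhds x] fun y => ∑ s, f s y • B s)
    (hf : ∀ s, DifferentiableAt ℝ (f s) x) :
    del α x = ∑ s, ∑ a, pd a (f s) x • wedge1 (dz a) (B s) := by
  have e : ((1 / 2 : ℂ) • (fderiv ℝ α x - I • (fderiv ℝ α x).comp mulI)) =
      ∑ s, ∑ a, pd a (f s) x • (dz a).smulRight (B s) := by
    ext v : 1
    have e1 : ((1 / 2 : ℂ) • (fderiv ℝ α x - I • (fderiv ℝ α x).comp mulI)) v =
        (1 / 2 : ℂ) • (fderiv ℝ α x v - I • fderiv ℝ α x (mulI v)) := rfl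
    rw [e1, fderiv_expansion hα hf, fderiv_expansion hα hf, Finset.smul_sum,
      ← Finset.sum_sub_distrib, Finset.smul_sum, sum_apply]
    refine Finset.sum_congr rfl fun s _ => ?_
    rw [sum_apply, smul_smul, ← form_sub_smul, smul_smul, holo_part, form_sum_smul]
    refine Finset.sum_congr rfl fun a _ => ?_
    rw [mul_comm, ← smul_smul]
    rfl
  rw [del, e, alternatize_sum]
  refine Finset.sum_congr rfl fun s _ => ?_
  rw [alternatize_sum]
  exact Finset.sum_congr rfl fun a _ => ContinuousAlternatingMap.alternatizeUncurryFin_smul _ _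

theorem delbar_eq_sum (hα : α =ᶠ[nhds x] fun y => ∑ s, f s y • B s)
    (hf : ∀ s, DifferentiableAt ℝ (f s) x) :
    delbar α x = ∑ s, ∑ a, pdb a (f s) x • wedge1 (dzbar a) (B s) := by
  have e : ((1 / 2 : ℂ) • (fderiv ℝ α x + I • (fderiv ℝ α x).comp mulI)) =
      ∑ s, ∑ a, pdb a (f s) x • (dzbar a).smulRight (B s) := by
    ext v : 1
    have e1 : ((1 / 2 : ℂ) • (fderiv ℝ α x + I • (fderiv ℝ α x).comp mulI)) v =
        (1 / 2 : ℂ) • (fderiv ℝ α x v + I • fderiv ℝ α x (mulI v)) := rfl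
    rw [e1, fderiv_expansion hα hf, fderiv_expansion hα hf, Finset.smul_sum,
      ← Finset.sum_add_distrib, Finset.smul_sum, sum_apply]
    refine Finset.sum_congr rfl fun s _ => ?_
    rw [sum_apply, smul_smul, ← form_add_smul, smul_smul, antiholo_part, form_sum_smul]
    refine Finset.sum_congr rfl fun a _ => ?_
    rw [mul_comm, ← smul_smul]
    rfl
  rw [delbar, e, alternatize_sum]
  refine Finset.sum_congr rfl fun s _ => ?_
  rw [alternatize_sum]
  exact Finset.sum_congr rfl fun a _ => ContinuousAlternatingMap.alternatizeUncurryFin_smul _ _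

end expansion

theorem del_dzbar {α : DForm n 1} {f : Fin n → (Fin n → ℂ) → ℂ} {x : Fin n → ℂ}
    (hα : α =ᶠ[nhds x] fun y => ∑ l, f l y • form1 (dzbar l))
    (hf : ∀ s, DifferentiableAt ℝ (f s) x) :
    del α x = form11 fun i j => pd i (f j) x := by
  rw [del_eq_sum hα hf, Finset.sum_comm]
  rfl

/-- The sign comes from reordering dz̄ʲ ∧ dzⁱ. -/
theorem delbar_dz {α : DForm n 1} {f : Fin n → (Fin n → ℂ) → ℂ} {x : Fin n → ℂ}
    (hα : α =ᶠ[nhds x] fun y => ∑ l, f l y • form1 (dz l))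
    (hf : ∀ s, DifferentiableAt ℝ (f s) x) :
    delbar α x = form11 fun i j => - pdb j (f i) x := by
  rw [delbar_eq_sum hα hf]
  simp only [← wedge_eq, wedge_swap (dzbar _) (dz _), form11, smul_neg, form_neg_smul]

theorem form11_add (a b : Fin n → Fin n → ℂ) :
    form11 a + form11 b = form11 fun i j => a i j + b i j := by
  simp only [form11, form_add_smul, Finset.sum_add_distrib]

theorem form11_sub (a b : Fin n → Fin n → ℂ) :
    form11 a - form11 b = form11 fun i j => a i j - b i j := by
  simp only [form11, form_sub_smul, Finset.sum_sub_distrib]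

theorem form11_smul (c : ℂ) (a : Fin n → Fin n → ℂ) :
    c • form11 a = form11 fun i j => c * a i j := by
  simp only [form11, Finset.smul_sum, smul_smul]

/-- Conjugation exchanges the two factors of dzⁱ ∧ dz̄ʲ, and restoring their order costs the sign.
-/
theorem conjForm_form11 (a : Fin n → Fin n → ℂ) :
    conjForm (form11 a) = form11 fun i j => - star (a j i) := by
  have e : ∀ (b : Fin n → Fin n → ℂ) (v w : Fin n → ℂ), form11 b ![v, w] =
      ∑ i, ∑ j, b i j * (v i * star (w j) - w i * star (v j)) := by
    intro b v w
    simp only [form11, ContinuousAlternatingMap.sum_apply, ContinuousAlternatingMap.smul_apply,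
      wedge_apply, smul_eq_mul]
    rfl
  refine form2_ext fun v w => ?_
  have e2 : conjForm (form11 a) ![v, w] = star (form11 a ![v, w]) := rfl
  rw [e2, e, e, Finset.sum_comm]
  simp only [star_sum, star_mul', star_sub, star_star]
  exact Finset.sum_congr rfl fun i _ => Finset.sum_congr rfl fun j _ => by ring

/-! ### `∂ω` and `Λ∂∂̄ω` -/

section fundamental

variable {h : MetricField n} {U : Set (Fin n → ℂ)} (L : IsLocalHermitian h U)
  {x : Fin n → ℂ} (hx : x ∈ U)

theorem fundForm_eq_sum : fundForm h = fun y => ∑ s : Fin n × Fin n,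
    (I * hMat h y s.1 s.2) • wedge (dz s.1) (dzbar s.2) := by
  funext y
  rw [Fintype.sum_prod_type]; rfl

include L hx

theorem del_fundForm : del (fundForm h) x = ∑ i, ∑ j, ∑ a,
    (I * pd a (fun y => hMat h y i j) x) • wedge1 (dz a) (wedge (dz i) (dzbar j)) := by
  rw [del_eq_sum (Filter.EventuallyEq.of_eq fundForm_eq_sum)
    fun s => (L.diffAt_hMat hx s.1 s.2).const_mul I, Fintype.sum_prod_type]
  refine Finset.sum_congr rfl fun i _ => Finset.sum_congr rfl fun j _ =>
    Finset.sum_congr rfl fun a _ => ?_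
  rw [pd, cderiv_const_mul _ (L.diffAt_hMat hx i j)]; rfl

theorem delbar_fundForm : delbar (fundForm h) x = ∑ s : (Fin n × Fin n) × Fin n,
    (I * pdb s.2 (fun y => hMat h y s.1.1 s.1.2) x) •
      wedge1 (dzbar s.2) (wedge (dz s.1.1) (dzbar s.1.2)) := by
  rw [delbar_eq_sum (Filter.EventuallyEq.of_eq fundForm_eq_sum)
    fun s => (L.diffAt_hMat hx s.1 s.2).const_mul I, Fintype.sum_prod_type (α₁ := Fin n × Fin n)]
  refine Finset.sum_congr rfl fun s _ => Finset.sum_congr rfl fun a _ => ?_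
  rw [pdb, cderiv_const_mul _ (L.diffAt_hMat hx s.1 s.2)]; rfl

theorem del_delbar_fundForm : del (delbar (fundForm h)) x = ∑ i, ∑ j, ∑ b, ∑ a,
    (I * metricHess h x a b i j) •
      wedge1 (dz a) (wedge1 (dzbar b) (wedge (dz i) (dzbar j))) := by
  rw [del_eq_sum (Filter.eventuallyEq_of_mem (L.isOpen.mem_nhds hx) fun y hy => delbar_fundForm L hy)
    fun s => (L.diffAt hx (L.contDiffOn_pdb_hMat s.2 s.1.1 s.1.2)).const_mul I,
    Fintype.sum_prod_type, Fintype.sum_prod_type]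
  refine Finset.sum_congr rfl fun i _ => Finset.sum_congr rfl fun j _ =>
    Finset.sum_congr rfl fun b _ => Finset.sum_congr rfl fun a _ => ?_
  rw [pd, cderiv_const_mul _ (L.diffAt hx (L.contDiffOn_pdb_hMat b i j))]; rfl

end fundamental

theorem Lam_sum (h : MetricField n) (x : Fin n → ℂ) {k : ℕ} {ι : Type*} (s : Finset ι)
    (α : ι → (Fin n → ℂ) [⋀^Fin (k + 2)]→L[ℝ] ℂ) :
    Lam h x (∑ a ∈ s, α a) = ∑ a ∈ s, Lam h x (α a) := by
  simp only [Lam, contract_sum, Finset.smul_sum]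
  rw [Finset.sum_comm]
  conv_rhs => rw [Finset.sum_comm]
  rw [Finset.sum_comm]
  exact Finset.sum_congr rfl fun i _ => Finset.sum_comm

theorem Lam_smul (h : MetricField n) (x : Fin n → ℂ) {k : ℕ} (c : ℂ)
    (α : (Fin n → ℂ) [⋀^Fin (k + 2)]→L[ℝ] ℂ) : Lam h x (c • α) = c • Lam h x α := by
  simp only [Lam, contract_smul, Finset.smul_sum, smul_smul, mul_comm c]

theorem contract_dZ_wedge (c i j : Fin n) : contract (dZ c) (wedge (dz i) (dzbar j)) =
    (if i = c then (1 : ℂ) else 0) • form1 (dzbar j) := by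
  rw [contract_wedge, extC_dz_dZ, extC_dzbar_dZ, form_zero_smul, sub_zero]

theorem contract_dZbar_wedge (d i j : Fin n) : contract (dZbar d) (wedge (dz i) (dzbar j)) =
    -((if j = d then (1 : ℂ) else 0) • form1 (dz i)) := by
  rw [contract_wedge, extC_dz_dZbar, extC_dzbar_dZbar, form_zero_smul, zero_sub]

/-- Each contraction can hit either of the two factors of its type; the four choices are the four
terms. -/
theorem contract_contract_basis (a b i j c d : Fin n) :
    contract (dZbar d) (contract (dZ c)
      (wedge1 (dz a) (wedge1 (dzbar b) (wedge (dz i) (dzbar j))))) =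
      (if a = c then (1 : ℂ) else 0) • ((if b = d then (1 : ℂ) else 0) • wedge (dz i) (dzbar j)
        - (if j = d then (1 : ℂ) else 0) • wedge (dz i) (dzbar b))
      + (if i = c then (1 : ℂ) else 0) • ((if j = d then (1 : ℂ) else 0) • wedge (dz a) (dzbar b)
        - (if b = d then (1 : ℂ) else 0) • wedge (dz a) (dzbar j)) := by
  rw [contract_wedge1, contract_wedge1, contract_dZ_wedge, wedge1_smul, ← wedge_eq, extC_dz_dZ,
    extC_dzbar_dZ, form_zero_smul, zero_sub, wedge1_neg, wedge1_smul, sub_neg_eq_add, contract_add,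
    contract_smul, contract_smul, contract_wedge1, contract_dZbar_wedge, wedge1_neg, wedge1_smul,
    ← wedge_eq, contract_wedge1, contract_wedge, wedge1_sub, wedge1_smul, wedge1_smul, ← wedge_eq,
    ← wedge_eq, extC_dz_dZbar, extC_dzbar_dZbar, extC_dzbar_dZbar, form_zero_smul,
    wedge_swap (dzbar b) (dz i)]
  module

theorem sum_ite_smul (a b : Fin n) (c : Fin n → Fin n → ℂ)
    (α : (Fin n → ℂ) [⋀^Fin 2]→L[ℝ] ℂ) :
    ∑ i, ∑ j, c i j • ((if a = i then (1 : ℂ) else 0) • ((if b = j then (1 : ℂ) else 0) • α)) =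
      c a b • α := by
  simp only [smul_smul, ← form_sum_smul]
  congr 1
  simp [mul_ite]

theorem Lam_basis (h : MetricField n) (x : Fin n → ℂ) (a b i j : Fin n) :
    Lam h x (wedge1 (dz a) (wedge1 (dzbar b) (wedge (dz i) (dzbar j)))) =
      (-I) • (hUp h x a b • wedge (dz i) (dzbar j) - hUp h x a j • wedge (dz i) (dzbar b)
        - hUp h x i b • wedge (dz a) (dzbar j) + hUp h x i j • wedge (dz a) (dzbar b)) := by
  have key := fun (a b : Fin n) => sum_ite_smul a b (fun i j => -I * hUp h x i j)
  simp only [Lam, contract_contract_basis, smul_add, smul_sub, Finset.sum_add_distrib,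
    Finset.sum_sub_distrib, key]
  module

section sums

variable {V : Type*} [AddCommMonoid V] (F : Fin n → Fin n → Fin n → Fin n → V)

/-- This and the next three relabellings bring the four terms of `Lam_basis` to the common basis
element dzⁱ ∧ dz̄ʲ in `IsLocalHermitian.Lam_del_delbar`. -/
theorem sum4_comm_ab : ∑ i, ∑ j, ∑ b, ∑ a, F a b i j = ∑ i, ∑ j, ∑ a, ∑ b, F a b i j :=
  Finset.sum_congr rfl fun _ _ => Finset.sum_congr rfl fun _ _ => Finset.sum_comm

theorem sum4_comm_jb : ∑ i, ∑ j, ∑ b, ∑ a, F a b i j = ∑ i, ∑ j, ∑ a, ∑ b, F a j i b := by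
  refine Finset.sum_congr rfl fun i _ => ?_
  rw [Finset.sum_comm]
  exact Finset.sum_congr rfl fun b _ => Finset.sum_comm

theorem sum4_comm_ia : ∑ i, ∑ j, ∑ b, ∑ a, F a b i j = ∑ i, ∑ j, ∑ a, ∑ b, F i b a j := by
  rw [Finset.sum_comm]
  conv_rhs => rw [Finset.sum_comm]
  refine Finset.sum_congr rfl fun j _ => ?_
  calc ∑ i, ∑ b, ∑ a, F a b i j = ∑ i, ∑ a, ∑ b, F a b i j :=
        Finset.sum_congr rfl fun _ _ => Finset.sum_comm
    _ = _ := Finset.sum_comm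

theorem sum4_comm_pairs : ∑ i, ∑ j, ∑ b, ∑ a, F a b i j = ∑ i, ∑ j, ∑ a, ∑ b, F i j a b := by
  calc ∑ i, ∑ j, ∑ b, ∑ a, F a b i j = ∑ i, ∑ b, ∑ a, ∑ j, F a b i j := by
        refine Finset.sum_congr rfl fun i _ => ?_
        rw [Finset.sum_comm]
        exact Finset.sum_congr rfl fun b _ => Finset.sum_comm
    _ = ∑ b, ∑ a, ∑ i, ∑ j, F a b i j := by
        rw [Finset.sum_comm]
        exact Finset.sum_congr rfl fun b _ => Finset.sum_comm
    _ = _ := Finset.sum_comm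

end sums

theorem IsLocalHermitian.Lam_del_delbar {h : MetricField n} {U : Set (Fin n → ℂ)}
    (L : IsLocalHermitian h U) {x : Fin n → ℂ} (hx : x ∈ U) :
    Lam h x (del (delbar (fundForm h)) x) = form11 fun i j => ∑ a, ∑ b, hUp h x a b *
      (metricHess h x a b i j - metricHess h x a j i b - metricHess h x i b a j
        + metricHess h x i j a b) := by
  have e : ∀ a b i j : Fin n, (I * metricHess h x a b i j) •
      Lam h x (wedge1 (dz a) (wedge1 (dzbar b) (wedge (dz i) (dzbar j)))) =
      (hUp h x a b * metricHess h x a b i j) • wedge (dz i) (dzbar j)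
      - (hUp h x a j * metricHess h x a b i j) • wedge (dz i) (dzbar b)
      - (hUp h x i b * metricHess h x a b i j) • wedge (dz a) (dzbar j)
      + (hUp h x i j * metricHess h x a b i j) • wedge (dz a) (dzbar b) := by
    intro a b i j
    have hI : I * metricHess h x a b i j * (-I) = metricHess h x a b i j := by
      linear_combination - metricHess h x a b i j * I_mul_I
    rw [Lam_basis, smul_smul, hI]
    module
  simp only [del_delbar_fundForm L hx, Lam_sum, Lam_smul, e, form11, form_sum_smul,
    Finset.sum_add_distrib, Finset.sum_sub_distrib, mul_add, mul_sub, form_add_smul, form_sub_smul]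
  refine congrArg₂ _ (congrArg₂ _ (congrArg₂ _ ?_ ?_) ?_) ?_
  · exact sum4_comm_ab _
  · exact sum4_comm_jb fun a b i j => (hUp h x a j * metricHess h x a b i j) • wedge (dz i) (dzbar b)
  · exact sum4_comm_ia fun a b i j => (hUp h x i b * metricHess h x a b i j) • wedge (dz a) (dzbar j)
  · exact sum4_comm_pairs
      fun a b i j => (hUp h x i j * metricHess h x a b i j) • wedge (dz a) (dzbar b)

/-! ### The inner product of forms -/

/-- The value of the complex linear extension of a 1-form on a complexified tangent vector. -/
def ev1 (α : (Fin n → ℂ) [⋀^Fin 1]→L[ℝ] ℂ) (Z : CTan n) : ℂ := contract Z α ![]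

/-- The value of the complex bilinear extension of a 2-form on complexified tangent vectors. -/
def ev2 (α : (Fin n → ℂ) [⋀^Fin 2]→L[ℝ] ℂ) (Z W : CTan n) : ℂ := ev1 (contract Z α) W

theorem evalC_one (α : (Fin n → ℂ) [⋀^Fin 1]→L[ℝ] ℂ) (Z : CTan n) :
    evalC α (fun _ => Z) = ev1 α Z := rfl

section ev

variable {ι : Type*} (s : Finset ι) (Z W : CTan n)

theorem ev1_add (α β : (Fin n → ℂ) [⋀^Fin 1]→L[ℝ] ℂ) : ev1 (α + β) Z = ev1 α Z + ev1 β Z := by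
  rw [ev1, contract_add]; rfl

theorem ev1_smul (c : ℂ) (α : (Fin n → ℂ) [⋀^Fin 1]→L[ℝ] ℂ) : ev1 (c • α) Z = c * ev1 α Z := by
  rw [ev1, contract_smul]; rfl

theorem ev1_neg (α : (Fin n → ℂ) [⋀^Fin 1]→L[ℝ] ℂ) : ev1 (-α) Z = - ev1 α Z := by
  rw [ev1, contract_neg]; rfl

theorem ev1_sub (α β : (Fin n → ℂ) [⋀^Fin 1]→L[ℝ] ℂ) : ev1 (α - β) Z = ev1 α Z - ev1 β Z := by
  rw [ev1, contract_sub]; rfl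

theorem ev1_sum (α : ι → (Fin n → ℂ) [⋀^Fin 1]→L[ℝ] ℂ) :
    ev1 (∑ i ∈ s, α i) Z = ∑ i ∈ s, ev1 (α i) Z := by
  rw [ev1, contract_sum, ContinuousAlternatingMap.sum_apply]; rfl

theorem ev1_form1 (b : (Fin n → ℂ) →L[ℝ] ℂ) : ev1 (form1 b) Z = extC b Z := by
  rw [ev1, contract_form1]; rfl

theorem ev2_add (α β : (Fin n → ℂ) [⋀^Fin 2]→L[ℝ] ℂ) :
    ev2 (α + β) Z W = ev2 α Z W + ev2 β Z W := by
  rw [ev2, contract_add, ev1_add]; rfl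

theorem ev2_smul (c : ℂ) (α : (Fin n → ℂ) [⋀^Fin 2]→L[ℝ] ℂ) :
    ev2 (c • α) Z W = c * ev2 α Z W := by
  rw [ev2, contract_smul, ev1_smul]; rfl

theorem ev2_sum (α : ι → (Fin n → ℂ) [⋀^Fin 2]→L[ℝ] ℂ) :
    ev2 (∑ i ∈ s, α i) Z W = ∑ i ∈ s, ev2 (α i) Z W := by
  rw [ev2, contract_sum, ev1_sum]; rfl

theorem ev2_wedge (a b : (Fin n → ℂ) →L[ℝ] ℂ) :
    ev2 (wedge a b) Z W = extC a Z * extC b W - extC b Z * extC a W := by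
  rw [ev2, contract_wedge, ev1_sub, ev1_smul, ev1_smul, ev1_form1, ev1_form1]

theorem ev2_swap (α : (Fin n → ℂ) [⋀^Fin 2]→L[ℝ] ℂ) : ev2 α Z W = - ev2 α W Z := by
  have sw : ∀ v w : Fin n → ℂ, α ![v, w] = - α ![w, v] := fun v w => by
    have := α.map_swap ![w, v] (i := 0) (j := 1) (by decide)
    refine Eq.trans (congrArg α ?_) this
    ext i
    fin_cases i <;> rfl
  have e : ∀ Z W : CTan n, ev2 α Z W = α ![reC Z, reC W] + I * α ![imC Z, reC W]
      + I * (α ![reC Z, imC W] + I * α ![imC Z, imC W]) := by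
    intro Z W
    rfl
  rw [e, e, sw (reC Z), sw (imC Z) (reC W), sw (reC Z) (imC W), sw (imC Z) (imC W)]
  ring

theorem ev2_form11 (a : Fin n → Fin n → ℂ) (i j : Fin n) :
    ev2 (form11 a) (dZ i) (dZbar j) = a i j := by
  simp only [form11, ev2_sum, ev2_smul, ev2_wedge, extC_dz_dZ, extC_dz_dZbar, extC_dzbar_dZ,
    extC_dzbar_dZbar]
  simp

theorem ev1_apply (α : (Fin n → ℂ) [⋀^Fin 1]→L[ℝ] ℂ) :
    ev1 α Z = α (fun _ => reC Z) + I * α (fun _ => imC Z) := by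
  have e : ∀ v : Fin n → ℂ, (Matrix.vecCons v ![] : Fin 1 → Fin n → ℂ) = fun _ => v := by
    intro v; ext i; fin_cases i; rfl
  simp only [ev1, contract, ContinuousAlternatingMap.add_apply,
    ContinuousAlternatingMap.smul_apply, ContinuousAlternatingMap.curryLeft_apply_apply, e,
    smul_eq_mul]

theorem form_one_eq_sum (α : (Fin n → ℂ) [⋀^Fin 1]→L[ℝ] ℂ) :
    α = ∑ s : Fin n ⊕ Fin n, ev1 α (frame s) • form1 (Sum.elim dz dzbar s) := by
  ext v
  have hv : v = fun _ => v 0 := by ext i; fin_cases i; rfl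
  rw [hv]
  generalize v 0 = w
  let A : (Fin n → ℂ) →L[ℝ] ℂ := (ContinuousAlternatingMap.ofSubsingleton ℝ (Fin n → ℂ) ℂ (0 : Fin 1)).symm α
  have hA : ∀ Z, ev1 α Z = extC A Z := fun Z => by
    rw [ev1_apply, extC_apply]; rfl
  have hw : α (fun _ => w) = A w := rfl
  rw [hw, apply_eq_sum A w, ContinuousAlternatingMap.sum_apply, Fintype.sum_sum_type]
  simp only [hA, ContinuousAlternatingMap.smul_apply, smul_eq_mul]
  congr 1 <;> exact Finset.sum_congr rfl fun i _ => mul_comm _ _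

end ev

theorem formInner_zero (g : MetricField n) (x : Fin n → ℂ) (α β : (Fin n → ℂ) [⋀^Fin 0]→L[ℝ] ℂ) :
    formInner g x α β = α ![] * star (β ![]) := by
  simp [formInner, evalC]

/-- Splitting off the first entry of both multi-indices leaves the factor k!/(k+1)!. Inner products
are thereby computed recursively through contractions with the frame. -/
theorem formInner_succ (g : MetricField n) (x : Fin n → ℂ) {k : ℕ}
    (α β : (Fin n → ℂ) [⋀^Fin (k + 1)]→L[ℝ] ℂ) :
    formInner g x α β = 1 / ((k : ℂ) + 1) * ∑ a, ∑ b, dualMetric g x a b *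
      formInner g x (contract (frame a) α) (contract (frame b) β) := by
  have key : ∀ F : (Fin (k + 1) → Fin n ⊕ Fin n) → ℂ,
      ∑ A, F A = ∑ a, ∑ A : Fin k → Fin n ⊕ Fin n, F (Fin.cons a A) := by
    intro F
    rw [← Fintype.sum_prod_type']
    exact (Fintype.sum_equiv (Fin.consEquiv fun _ => Fin n ⊕ Fin n) _ _ fun _ => rfl).symm
  simp only [formInner]
  rw [key]
  simp only [key, Fin.prod_univ_succ, Fin.cons_zero, Fin.cons_succ, evalC, Nat.factorial_succ,
    Finset.mul_sum]
  refine Finset.sum_congr rfl fun a _ => ?_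
  rw [Finset.sum_comm]
  refine Finset.sum_congr rfl fun b _ => Finset.sum_congr rfl fun A _ =>
    Finset.sum_congr rfl fun B _ => ?_
  have e : ∀ (c : Fin n ⊕ Fin n) (C : Fin k → Fin n ⊕ Fin n),
      Fin.tail (fun m => frame ((Fin.cons c C : Fin (k + 1) → Fin n ⊕ Fin n) m)) =
        fun m => frame (n := n) (C m) := fun _ _ => rfl
  rw [e, e]
  have hk : ((k : ℂ) + 1) ≠ 0 := by exact_mod_cast Nat.succ_ne_zero k
  have hf : (k.factorial : ℂ) ≠ 0 := by exact_mod_cast k.factorial_ne_zero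
  push_cast
  field_simp

theorem formInner_split (g : MetricField n) (x : Fin n → ℂ) {k : ℕ}
    (α β : (Fin n → ℂ) [⋀^Fin (k + 1)]→L[ℝ] ℂ) :
    formInner g x α β = 1 / ((k : ℂ) + 1) *
      (∑ i, ∑ j, hUp g x i j * formInner g x (contract (dZ i) α) (contract (dZ j) β) +
        ∑ i, ∑ j, hUp g x i j * formInner g x (contract (dZbar j) α) (contract (dZbar i) β)) := by
  rw [formInner_succ, Fintype.sum_sum_type]
  simp only [Fintype.sum_sum_type, dualMetric, zero_mul, Finset.sum_const_zero, add_zero, zero_add]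
  congr 2
  exact Finset.sum_comm

theorem formInner_one (g : MetricField n) (x : Fin n → ℂ)
    (α β : (Fin n → ℂ) [⋀^Fin 1]→L[ℝ] ℂ) : formInner g x α β =
      ∑ i, ∑ j, hUp g x i j * (ev1 α (dZ i) * star (ev1 β (dZ j))) +
        ∑ i, ∑ j, hUp g x i j * (ev1 α (dZbar j) * star (ev1 β (dZbar i))) := by
  rw [formInner_split]
  simp only [formInner_zero, ev1]
  simp

theorem formInner_two (g : MetricField n) (x : Fin n → ℂ)
    (α β : (Fin n → ℂ) [⋀^Fin 2]→L[ℝ] ℂ) : formInner g x α β = 1 / 2 *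
      (∑ i, ∑ j, hUp g x i j * formInner g x (contract (dZ i) α) (contract (dZ j) β) +
        ∑ i, ∑ j, hUp g x i j * formInner g x (contract (dZbar j) α) (contract (dZbar i) β)) := by
  rw [formInner_split]; norm_num

theorem formInner_three (g : MetricField n) (x : Fin n → ℂ)
    (α β : (Fin n → ℂ) [⋀^Fin 3]→L[ℝ] ℂ) : formInner g x α β = 1 / 3 *
      (∑ i, ∑ j, hUp g x i j * formInner g x (contract (dZ i) α) (contract (dZ j) β) +
        ∑ i, ∑ j, hUp g x i j * formInner g x (contract (dZbar j) α) (contract (dZbar i) β)) := by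
  rw [formInner_split]; norm_num

theorem contract_dZ_form11 (a : Fin n → Fin n → ℂ) (c : Fin n) :
    contract (dZ c) (form11 a) = ∑ j, a c j • form1 (dzbar j) := by
  simp only [form11, contract_sum, contract_smul, contract_dZ_wedge]
  rw [Finset.sum_comm]
  simp only [smul_smul, ← form_sum_smul]
  simp

theorem contract_dZbar_form11 (a : Fin n → Fin n → ℂ) (c : Fin n) :
    contract (dZbar c) (form11 a) = - ∑ i, a i c • form1 (dz i) := by
  simp only [form11, contract_sum, contract_smul, contract_dZbar_wedge, smul_neg,
    Finset.sum_neg_distrib]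
  simp only [smul_smul, ← form_sum_smul]
  simp

theorem ev1_sum_dz_dZ (f : Fin n → ℂ) (i : Fin n) :
    ev1 (∑ l, f l • form1 (dz l)) (dZ i) = f i := by
  simp [ev1_sum, ev1_smul, ev1_form1, extC_dz_dZ]

theorem ev1_sum_dz_dZbar (f : Fin n → ℂ) (i : Fin n) :
    ev1 (∑ l, f l • form1 (dz l)) (dZbar i) = 0 := by
  simp [ev1_sum, ev1_smul, ev1_form1, extC_dz_dZbar]

theorem ev1_sum_dzbar_dZ (f : Fin n → ℂ) (i : Fin n) :
    ev1 (∑ l, f l • form1 (dzbar l)) (dZ i) = 0 := by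
  simp [ev1_sum, ev1_smul, ev1_form1, extC_dzbar_dZ]

theorem ev1_sum_dzbar_dZbar (f : Fin n → ℂ) (i : Fin n) :
    ev1 (∑ l, f l • form1 (dzbar l)) (dZbar i) = f i := by
  simp [ev1_sum, ev1_smul, ev1_form1, extC_dzbar_dZbar]

theorem formInner_dz (g : MetricField n) (x : Fin n → ℂ) (α : (Fin n → ℂ) [⋀^Fin 1]→L[ℝ] ℂ)
    (f : Fin n → ℂ) : formInner g x α (∑ l, f l • form1 (dz l)) =
      ∑ i, ∑ j, hUp g x i j * (ev1 α (dZ i) * star (f j)) := by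
  rw [formInner_one]
  simp only [ev1_sum_dz_dZ, ev1_sum_dz_dZbar, star_zero, mul_zero, Finset.sum_const_zero, add_zero]

theorem formInner_dzbar (g : MetricField n) (x : Fin n → ℂ) (α : (Fin n → ℂ) [⋀^Fin 1]→L[ℝ] ℂ)
    (f : Fin n → ℂ) : formInner g x α (∑ l, f l • form1 (dzbar l)) =
      ∑ i, ∑ j, hUp g x i j * (ev1 α (dZbar j) * star (f i)) := by
  rw [formInner_one]
  simp only [ev1_sum_dzbar_dZ, ev1_sum_dzbar_dZbar, star_zero, mul_zero, Finset.sum_const_zero,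
    zero_add]

theorem formInner_neg (g : MetricField n) (x : Fin n → ℂ) (α β : (Fin n → ℂ) [⋀^Fin 1]→L[ℝ] ℂ) :
    formInner g x α (-β) = - formInner g x α β := by
  simp only [formInner_one, ev1_neg, star_neg, mul_neg, Finset.sum_neg_distrib]
  ring

theorem sum4_swap {V : Type*} [AddCommMonoid V] (G : Fin n → Fin n → Fin n → Fin n → V) :
    ∑ k, ∑ l, ∑ i, ∑ j, G k l i j = ∑ i, ∑ j, ∑ k, ∑ l, G k l i j :=
  (sum4_comm_ab fun a b i j => G i j a b).symm.trans (sum4_comm_pairs fun a b i j => G i j a b)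

/-- By antisymmetry of α the contractions with ∂/∂z and with ∂/∂z̄ contribute equally, which cancels
the factor 1/2. -/
theorem formInner_form11_right (g : MetricField n) (x : Fin n → ℂ)
    (α : (Fin n → ℂ) [⋀^Fin 2]→L[ℝ] ℂ) (b : Fin n → Fin n → ℂ) :
    formInner g x α (form11 b) = ∑ i, ∑ j, ∑ k, ∑ l,
      hUp g x i j * hUp g x k l * (ev2 α (dZ i) (dZbar l) * star (b j k)) := by
  rw [formInner_two]
  simp only [contract_dZ_form11, contract_dZbar_form11, formInner_neg, formInner_dz,
    formInner_dzbar]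
  have e1 : ∑ i, ∑ j, hUp g x i j *
        ∑ k, ∑ l, hUp g x k l * (ev1 (contract (dZ i) α) (dZbar l) * star (b j k)) =
      ∑ i, ∑ j, ∑ k, ∑ l,
        hUp g x i j * hUp g x k l * (ev2 α (dZ i) (dZbar l) * star (b j k)) := by
    simp only [Finset.mul_sum, mul_assoc, ev2]
  have e2 : ∑ k, ∑ l, hUp g x k l *
        - ∑ i, ∑ j, hUp g x i j * (ev1 (contract (dZbar l) α) (dZ i) * star (b j k)) =
      ∑ i, ∑ j, ∑ k, ∑ l,
        hUp g x i j * hUp g x k l * (ev2 α (dZ i) (dZbar l) * star (b j k)) := by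
    rw [← sum4_swap]
    simp only [Finset.mul_sum, ← Finset.sum_neg_distrib]
    refine Finset.sum_congr rfl fun k _ => Finset.sum_congr rfl fun l _ =>
      Finset.sum_congr rfl fun i _ => Finset.sum_congr rfl fun j _ => ?_
    rw [ev2_swap (dZ i), ev2]
    ring
  rw [e1, e2]
  ring

theorem formInner_form11 (g : MetricField n) (x : Fin n → ℂ) (a b : Fin n → Fin n → ℂ) :
    formInner g x (form11 a) (form11 b) =
      ∑ i, ∑ j, ∑ k, ∑ l, hUp g x i j * hUp g x k l * (a i l * star (b j k)) := by
  simp only [formInner_form11_right, ev2_form11]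

/-- One of the two inverse metrics cancels the matrix of ω; what is left is the trace of the
(1,1)-part of α. -/
theorem IsLocalHermitian.formInner_fundForm {h : MetricField n} {U : Set (Fin n → ℂ)}
    (L : IsLocalHermitian h U) {x : Fin n → ℂ} (hx : x ∈ U)
    (α : (Fin n → ℂ) [⋀^Fin 2]→L[ℝ] ℂ) :
    formInner h x α (fundForm h x) =
      -I * ∑ i, ∑ j, hUp h x i j * ev2 α (dZ i) (dZbar j) := by
  have hI : star I = -I := conj_I
  rw [fundForm, formInner_form11_right, Finset.mul_sum]
  refine Finset.sum_congr rfl fun i _ => ?_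
  calc ∑ j, ∑ k, ∑ l, hUp h x i j * hUp h x k l *
        (ev2 α (dZ i) (dZbar l) * star (I * hMat h x j k)) =
      ∑ k, (∑ j, hUp h x i j * hMat h x k j) *
        ∑ l, -I * (hUp h x k l * ev2 α (dZ i) (dZbar l)) := by
        rw [Finset.sum_comm]
        refine Finset.sum_congr rfl fun k _ => ?_
        rw [Finset.sum_mul]
        refine Finset.sum_congr rfl fun j _ => ?_
        rw [Finset.mul_sum]
        refine Finset.sum_congr rfl fun l _ => ?_
        rw [star_mul', hI, L.star_hMat hx]
        ring
    _ = _ := by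
        simp only [L.hUp_mul hx, ite_mul, one_mul, zero_mul, Finset.sum_ite_eq', Finset.mem_univ,
          if_true]
        rw [Finset.mul_sum]

theorem formInner_dz_dz (g : MetricField n) (x : Fin n → ℂ) (a b : Fin n → Fin n → ℂ) :
    formInner g x (∑ i, ∑ j, a i j • wedge (dz i) (dz j)) (∑ i, ∑ j, b i j • wedge (dz i) (dz j)) =
      1 / 2 * ∑ i, ∑ j, ∑ k, ∑ l, hUp g x i j * hUp g x k l *
        ((a i k - a k i) * star (b j l - b l j)) := by
  have e1 : ∀ (a : Fin n → Fin n → ℂ) (c : Fin n),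
      contract (dZ c) (∑ i, ∑ j, a i j • wedge (dz i) (dz j)) =
        ∑ k, (a c k - a k c) • form1 (dz k) := by
    intro a c
    simp only [contract_sum, contract_smul, contract_wedge, extC_dz_dZ, smul_sub,
      Finset.sum_sub_distrib, form_sub_smul]
    congr 1
    · rw [Finset.sum_comm]
      simp only [smul_smul, ← form_sum_smul]
      simp
    · simp only [smul_smul, ← form_sum_smul]
      simp
  have e2 : ∀ (a : Fin n → Fin n → ℂ) (c : Fin n),
      contract (dZbar c) (∑ i, ∑ j, a i j • wedge (dz i) (dz j)) =
        ∑ k, (0 : ℂ) • form1 (dz k) := by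
    intro a c
    simp only [contract_sum, contract_smul, contract_wedge, extC_dz_dZbar, form_zero_smul,
      sub_zero, form_smul_zero, Finset.sum_const_zero]
  rw [formInner_two]
  simp only [e1, e2, formInner_dz, ev1_sum_dz_dZ, star_zero, mul_zero, Finset.sum_const_zero,
    add_zero, Finset.mul_sum, mul_assoc]

/-! ### The norm of ∂ω -/

section norm

variable {h : MetricField n} {U : Set (Fin n → ℂ)} (L : IsLocalHermitian h U)
  {x : Fin n → ℂ} (hx : x ∈ U)

include L hx

/-- Contracting ∂_a h_{i j̄} dzᵃ ∧ dzⁱ ∧ dz̄ʲ with a (1,0)-vector antisymmetrises in a and i, which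
produces the torsion. -/
theorem IsLocalHermitian.contract_dZ_del_fundForm (c : Fin n) :
    contract (dZ c) (del (fundForm h) x) = form11 fun i j => I * torsionLow h x c i j := by
  rw [del_fundForm L hx]
  simp only [contract_sum, contract_smul, contract_wedge1, contract_dZ_wedge, extC_dz_dZ,
    wedge1_smul, ← wedge_eq, smul_sub, Finset.sum_sub_distrib, torsionLow, mul_sub, form11,
    form_sub_smul]
  congr 1
  · simp only [smul_smul, ← form_sum_smul]
    simp
  · rw [Finset.sum_comm]
    refine Eq.trans ?_ Finset.sum_comm
    refine Finset.sum_congr rfl fun j _ => ?_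
    rw [Finset.sum_comm]
    simp only [smul_smul, ← form_sum_smul]
    simp

theorem IsLocalHermitian.contract_dZbar_del_fundForm (c : Fin n) :
    contract (dZbar c) (del (fundForm h) x) =
      ∑ i, ∑ j, (I * pd i (fun y => hMat h y j c) x) • wedge (dz i) (dz j) := by
  rw [del_fundForm L hx]
  simp only [contract_sum, contract_smul, contract_wedge1, contract_dZbar_wedge, extC_dz_dZbar,
    wedge1_neg, wedge1_smul, ← wedge_eq, form_zero_smul, zero_sub, neg_neg]
  refine Eq.trans ?_ Finset.sum_comm
  refine Finset.sum_congr rfl fun i _ => ?_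
  rw [Finset.sum_comm]
  simp only [smul_smul, ← form_sum_smul]
  simp

/-- Let S be the right-hand side. The ∂/∂z contractions contribute S and the ∂/∂z̄ contractions S/2,
where the half comes from the dz ∧ dz forms; with the prefactor 1/3 this is S/2. -/
theorem IsLocalHermitian.formInner_del_fundForm :
    2 * formInner h x (del (fundForm h) x) (del (fundForm h) x) =
      ∑ c, ∑ d, ∑ i, ∑ j, ∑ k, ∑ l, hUp h x c d * hUp h x i j * hUp h x k l *
        (torsionLow h x c i l * star (torsionLow h x d j k)) := by
  have hI : star I = -I := conj_I
  have hII : ∀ a b : ℂ, I * a * star (I * b) = a * star b := fun a b => by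
    rw [star_mul', hI]; linear_combination - a * star b * I_mul_I
  rw [formInner_three]
  simp only [L.contract_dZ_del_fundForm hx, L.contract_dZbar_del_fundForm hx, formInner_form11,
    formInner_dz_dz, ← mul_sub, ← torsionLow.eq_1, hII]
  have e : ∑ k, ∑ l, hUp h x k l * (1 / 2 * ∑ c, ∑ d, ∑ i, ∑ j, hUp h x c d * hUp h x i j *
        (torsionLow h x c i l * star (torsionLow h x d j k))) =
      1 / 2 * ∑ c, ∑ d, ∑ i, ∑ j, ∑ k, ∑ l, hUp h x c d * hUp h x i j * hUp h x k l *
        (torsionLow h x c i l * star (torsionLow h x d j k)) := by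
    simp only [Finset.mul_sum]
    rw [sum4_swap]
    refine Finset.sum_congr rfl fun c _ => Finset.sum_congr rfl fun d _ => ?_
    rw [sum4_swap]
    refine Finset.sum_congr rfl fun i _ => Finset.sum_congr rfl fun j _ =>
      Finset.sum_congr rfl fun k _ => Finset.sum_congr rfl fun l _ => ?_
    ring
  rw [e]
  simp only [Finset.mul_sum, ← Finset.sum_add_distrib]
  refine Finset.sum_congr rfl fun c _ => Finset.sum_congr rfl fun d _ =>
    Finset.sum_congr rfl fun i _ => Finset.sum_congr rfl fun j _ =>
      Finset.sum_congr rfl fun k _ => Finset.sum_congr rfl fun l _ => ?_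
  ring

end norm

open MeasureTheory

/-! ### Divergence of the volume density -/

/-- The torsion trace `τ_l = ∑ h^{p q̄} T_{l p q̄}`. -/
def torsionTrace (h : MetricField n) (x : Fin n → ℂ) (l : Fin n) : ℂ :=
  ∑ p, ∑ q, hUp h x p q * torsionLow h x l p q

namespace IsLocalHermitian

variable {h : MetricField n} {U : Set (Fin n → ℂ)} (L : IsLocalHermitian h U)

include L

theorem contDiffOn_torsionTrace (l : Fin n) : ContDiffOn ℝ ∞ (fun x => torsionTrace h x l) U :=
  ContDiffOn.sum fun p _ => ContDiffOn.sum fun q _ =>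
    (L.contDiffOn_hUp p q).mul (L.contDiffOn_torsionLow l p q)

theorem contDiffOn_volDensity : ContDiffOn ℝ ∞ (fun x => (volDensity h x : ℂ)) U :=
  (contDiffOn_const.mul L.contDiffOn_det).congr fun _ hx => L.volDensity_eq hx

variable {x : Fin n → ℂ} (hx : x ∈ U)

include hx

theorem cderiv_volDensity (Z : CTan n) : cderiv Z (fun y => (volDensity h y : ℂ)) x =
    volDensity h x * ∑ p, ∑ q, hUp h x p q * cderiv Z (fun y => hMat h y p q) x := by
  rw [L.cderiv_congr hx fun y hy => L.volDensity_eq hy,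
    cderiv_const_mul _ (L.diffAt hx L.contDiffOn_det), L.cderiv_det hx, L.volDensity_eq hx]
  ring

/-- The derivative of the density gives a trace of ∂_l h_{p q̄}; the derivative of the inverse
subtracts the same trace of ∂_p h_{l q̄}. The difference is the torsion trace. -/
theorem divergence_hUp (j : Fin n) :
    ∑ i, pd i (fun y => hUp h y i j * (volDensity h y : ℂ)) x =
      volDensity h x * ∑ l, hUp h x l j * torsionTrace h x l := by
  have e : ∀ i, pd i (fun y => hUp h y i j * (volDensity h y : ℂ)) x =
      volDensity h x * ((∑ p, ∑ q, hUp h x i j * (hUp h x p q * pd i (fun y => hMat h y p q) x))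
        - ∑ a, ∑ b, hUp h x i b * pd i (fun y => hMat h y a b) x * hUp h x a j) := by
    intro i
    rw [pd, cderiv_mul (L.diffAt_hUp hx i j) (L.diffAt hx L.contDiffOn_volDensity),
      L.cderiv_volDensity hx, L.cderiv_hUp hx]
    simp only [← Finset.mul_sum, ← pd.eq_1]
    ring
  simp only [e, ← Finset.mul_sum, Finset.sum_sub_distrib]
  congr 1
  simp only [torsionTrace, torsionLow, mul_sub, Finset.sum_sub_distrib, Finset.mul_sum]
  congr 1
  rw [Finset.sum_comm]
  refine Finset.sum_congr rfl fun a _ => Finset.sum_congr rfl fun i _ =>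
    Finset.sum_congr rfl fun b _ => ?_
  ring

theorem divergence_hUp_bar (i : Fin n) :
    ∑ j, pdb j (fun y => hUp h y i j * (volDensity h y : ℂ)) x =
      volDensity h x * ∑ l, hUp h x i l * star (torsionTrace h x l) := by
  have e : ∀ j, pdb j (fun y => hUp h y i j * (volDensity h y : ℂ)) x =
      star (pd j (fun y => hUp h y j i * (volDensity h y : ℂ)) x) := by
    intro j
    rw [← pdb_star j (L.diffAt hx ((L.contDiffOn_hUp j i).mul L.contDiffOn_volDensity))]
    refine L.cderiv_congr hx fun y hy => ?_
    rw [star_mul', L.star_hUp hy]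
    congr 1
    exact (conj_ofReal _).symm
  simp only [e]
  rw [← star_sum, L.divergence_hUp hx, star_mul', star_sum]
  simp only [star_mul', L.star_hUp hx]
  congr 1
  exact conj_ofReal _

end IsLocalHermitian

/-! ### Integration by parts -/

section parts

variable {U : Set (Fin n → ℂ)} (hU : IsOpen U) {F φ : (Fin n → ℂ) → ℂ}

include hU

theorem contDiff_mul_of_tsupport_subset (hF : ContDiffOn ℝ ∞ F U) (hφ : ContDiff ℝ ∞ φ)
    (hs : tsupport φ ⊆ U) : ContDiff ℝ ∞ fun y => F y * φ y := by
  rw [contDiff_iff_contDiffAt]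
  intro x
  by_cases hx : x ∈ tsupport φ
  · exact (hF.contDiffAt (hU.mem_nhds (hs hx))).mul hφ.contDiffAt
  · have : (fun y => F y * φ y) =ᶠ[nhds x] fun _ => 0 := by
      filter_upwards [notMem_tsupport_iff_eventuallyEq.mp hx] with y hy
      simp [hy]
    exact contDiffAt_const.congr_of_eventuallyEq this

theorem integrable_mul_of_tsupport_subset (hF : ContDiffOn ℝ ∞ F U) (hφ : ContDiff ℝ ∞ φ)
    (hc : HasCompactSupport φ) (hs : tsupport φ ⊆ U) : Integrable fun y => F y * φ y :=
  (contDiff_mul_of_tsupport_subset hU hF hφ hs).continuous.integrable_of_hasCompactSupport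
    hc.mul_left

omit hU in
theorem integral_fderiv_eq_zero {W : (Fin n → ℂ) → ℂ} (hW : ContDiff ℝ ∞ W)
    (hc : HasCompactSupport W) (v : Fin n → ℂ) : ∫ x, fderiv ℝ W x v = 0 := by
  have hi : Integrable fun x => fderiv ℝ W x v :=
    ((hW.continuous_fderiv (by simp)).clm_apply continuous_const).integrable_of_hasCompactSupport
      (hc.fderiv_apply ℝ v)
  have h0 : ∀ x, fderiv ℝ (fun _ : Fin n → ℂ => (1 : ℂ)) x v = 0 := fun x => by simp
  have := integral_mul_fderiv_eq_neg_fderiv_mul_of_integrable (μ := volume)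
    (f := fun _ : Fin n → ℂ => (1 : ℂ)) (g := W) (v := v) (by simp) (by simpa using hi)
    (by simpa using hW.continuous.integrable_of_hasCompactSupport hc)
    (fun x _ => differentiableAt_const _) (fun x _ => hW.differentiable (by simp) x)
  simpa [h0] using this

/-- F is controlled only on U, but the support of φ lies in U, so the product is smooth with compact
support on all of ℂⁿ and its derivatives integrate to zero. -/
theorem integrable_cderiv_mul (hF : ContDiffOn ℝ ∞ F U) (hφ : ContDiff ℝ ∞ φ)
    (hc : HasCompactSupport φ) (hs : tsupport φ ⊆ U) (Z : CTan n) :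
    Integrable (fun x => cderiv Z (fun y => F y * φ y) x) ∧
      ∫ x in U, cderiv Z (fun y => F y * φ y) x = 0 := by
  have hW := contDiff_mul_of_tsupport_subset hU hF hφ hs
  have hcW : HasCompactSupport fun y => F y * φ y := hc.mul_left
  have hi : ∀ v, Integrable fun x => fderiv ℝ (fun y => F y * φ y) x v := fun v =>
    ((hW.continuous_fderiv (by simp)).clm_apply continuous_const).integrable_of_hasCompactSupport
      (hcW.fderiv_apply ℝ v)
  refine ⟨(hi _).add ((hi _).smul I), ?_⟩
  rw [setIntegral_eq_integral_of_forall_compl_eq_zero]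
  · have e := integral_add (hi (reC Z)) ((hi (imC Z)).smul I)
    simp only [Pi.smul_apply, integral_smul, integral_fderiv_eq_zero hW hcW, smul_zero,
      add_zero] at e
    exact e
  · intro x hx
    have hx' : x ∉ tsupport φ := fun hh => hx (hs hh)
    have : (fun y => F y * φ y) =ᶠ[nhds x] fun _ => 0 := by
      filter_upwards [notMem_tsupport_iff_eventuallyEq.mp hx'] with y hy
      simp [hy]
    simp [cderiv, this.fderiv_eq]

end parts

/-- Integration by parts in the form used below: integrands that differ by a combination of total
derivatives have the same integral. -/
theorem setIntegral_eq_of_divergence {U : Set (Fin n → ℂ)} (hU : IsOpen U)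
    {A B : (Fin n → ℂ) → ℂ} {D : Fin n → Fin n → (Fin n → ℂ) → ℂ} {c : ℂ} (hB : IntegrableOn B U)
    (hD : ∀ i j, Integrable (D i j) ∧ ∫ x in U, D i j x = 0)
    (key : ∀ x ∈ U, A x = B x + c * ∑ i, ∑ j, D i j x) : ∫ x in U, A x = ∫ x in U, B x := by
  have hi : ∀ i, Integrable (fun x => ∑ j, D i j x) (volume.restrict U) := fun i =>
    integrable_finsetSum _ fun j _ => (hD i j).1.integrableOn
  rw [setIntegral_congr_fun hU.measurableSet key, integral_add hB
    ((integrable_finsetSum _ fun i _ => hi i).const_mul c), integral_const_mul,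
    integral_finsetSum _ fun i _ => hi i]
  have : ∀ i, ∫ x in U, ∑ j, D i j x = 0 := fun i => by
    rw [integral_finsetSum _ fun j _ => (hD i j).1.integrableOn]
    exact Finset.sum_eq_zero fun j _ => (hD i j).2
  simp [this]

/-! ### Components of test 1-forms -/

theorem contDiff_ev1 {β : DForm n 1} (hβ : ContDiff ℝ ∞ β) (Z : CTan n) :
    ContDiff ℝ ∞ fun y => ev1 (β y) Z := by
  simp only [ev1_apply]
  exact ((ContinuousAlternatingMap.apply ℝ (Fin n → ℂ) ℂ fun _ => reC Z).contDiff.comp hβ).add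
    (contDiff_const.mul
      ((ContinuousAlternatingMap.apply ℝ (Fin n → ℂ) ℂ fun _ => imC Z).contDiff.comp hβ))

theorem contDiffOn_ev1 {β : DForm n 1} {U : Set (Fin n → ℂ)} (hβ : ContDiffOn ℝ ∞ β U)
    (Z : CTan n) : ContDiffOn ℝ ∞ (fun y => ev1 (β y) Z) U := by
  simp only [ev1_apply]
  exact ((ContinuousAlternatingMap.apply ℝ (Fin n → ℂ) ℂ
    fun _ => reC Z).contDiff.comp_contDiffOn hβ).add (contDiffOn_const.mul
      ((ContinuousAlternatingMap.apply ℝ (Fin n → ℂ) ℂ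
        fun _ => imC Z).contDiff.comp_contDiffOn hβ))

theorem ev1_zero (Z : CTan n) : ev1 (0 : (Fin n → ℂ) [⋀^Fin 1]→L[ℝ] ℂ) Z = 0 := by
  rw [ev1_apply]; simp

theorem tsupport_ev1 (β : DForm n 1) (Z : CTan n) :
    tsupport (fun y => ev1 (β y) Z) ⊆ tsupport β := by
  refine closure_mono fun y hy => ?_
  rw [Function.mem_support] at hy ⊢
  exact fun h0 => hy (by rw [h0, ev1_zero])

theorem ev2_del {β : DForm n 1} (hβ : ContDiff ℝ ∞ β) (x : Fin n → ℂ) (i j : Fin n) :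
    ev2 (del β x) (dZ i) (dZbar j) = pd i (fun y => ev1 (β y) (dZbar j)) x := by
  have e : del β x = ∑ s, ∑ a, pd a (fun y => ev1 (β y) (frame s)) x •
      wedge (dz a) (Sum.elim dz dzbar s) :=
    del_eq_sum (Filter.EventuallyEq.of_eq (funext fun y => form_one_eq_sum (β y)))
      fun s => (contDiff_ev1 hβ _).differentiable (by simp) x
  rw [e]
  simp only [ev2_sum, ev2_smul, ev2_add, ev2_wedge, Fintype.sum_sum_type, Sum.elim_inl,
    Sum.elim_inr, extC_dz_dZ, extC_dz_dZbar, extC_dzbar_dZ, extC_dzbar_dZbar, frame]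
  simp

theorem ev2_delbar {β : DForm n 1} (hβ : ContDiff ℝ ∞ β) (x : Fin n → ℂ) (i j : Fin n) :
    ev2 (delbar β x) (dZ i) (dZbar j) = - pdb j (fun y => ev1 (β y) (dZ i)) x := by
  have e : delbar β x = ∑ s, ∑ a, pdb a (fun y => ev1 (β y) (frame s)) x •
      wedge (dzbar a) (Sum.elim dz dzbar s) :=
    delbar_eq_sum (Filter.EventuallyEq.of_eq (funext fun y => form_one_eq_sum (β y)))
      fun s => (contDiff_ev1 hβ _).differentiable (by simp) x
  rw [e]
  simp only [ev2_sum, ev2_smul, ev2_add, ev2_wedge, Fintype.sum_sum_type, Sum.elim_inl,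
    Sum.elim_inr, extC_dz_dZ, extC_dz_dZbar, extC_dzbar_dZ, extC_dzbar_dZbar, frame]
  simp

/-- The 1-form `∂^* ω = -√-1 ∑ conj(τ_l) dz̄ˡ`. -/
def delStarOmega (h : MetricField n) : DForm n 1 := fun x =>
  ∑ l, (-I * star (torsionTrace h x l)) • form1 (dzbar l)

/-- The 1-form `∂̄^* ω = √-1 ∑ τ_l dzˡ`. -/
def delbarStarOmega (h : MetricField n) : DForm n 1 := fun x =>
  ∑ l, (I * torsionTrace h x l) • form1 (dz l)

/-! ### The explicit 1-forms are formal adjoints at ω -/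

namespace IsLocalHermitian

variable {h : MetricField n} {U : Set (Fin n → ℂ)} (L : IsLocalHermitian h U)

include L

theorem isFormalAdjoint_delStarOmega : IsFormalAdjoint h U del (fundForm h) (delStarOmega h) := by
  have hI : star I = -I := conj_I
  refine ⟨ContDiffOn.sum fun l _ => (contDiffOn_const.mul
    (contDiffOn_star (L.contDiffOn_torsionTrace l))).smul contDiffOn_const, fun β hβ hc hs => ?_⟩
  have hg := fun j => contDiff_ev1 hβ (dZbar (n := n) j)
  have hgs : ∀ j : Fin n, tsupport (fun y => ev1 (β y) (dZbar j)) ⊆ U :=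
    fun j => (tsupport_ev1 β _).trans hs
  have hgc : ∀ j : Fin n, HasCompactSupport (fun y => ev1 (β y) (dZbar j)) :=
    fun j => hc.of_isClosed_subset (isClosed_tsupport _) (tsupport_ev1 β _)
  have hF := fun i j => (L.contDiffOn_hUp i j).mul L.contDiffOn_volDensity
  have hD := fun i j => integrable_cderiv_mul L.isOpen (hF i j) (hg j) (hgc j) (hgs j) (dZ i)
  -- The left side is -√-1 h^{i j̄} ∂_i β_{j̄} times the density. Moving the derivative off β leaves
  -- a total derivative and, by `divergence_hUp`, the pairing of β with the torsion trace.
  have key : ∀ x ∈ U, formInner h x (del β x) (fundForm h x) * (volDensity h x : ℂ) =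
      formInner h x (β x) (delStarOmega h x) * (volDensity h x : ℂ) +
        -I * ∑ i, ∑ j,
          cderiv (dZ i) (fun y => hUp h y i j * (volDensity h y : ℂ) * ev1 (β y) (dZbar j)) x := by
    intro x hx
    have e1 : ∀ i j, cderiv (dZ i)
        (fun y => hUp h y i j * (volDensity h y : ℂ) * ev1 (β y) (dZbar j)) x =
        pd i (fun y => hUp h y i j * (volDensity h y : ℂ)) x * ev1 (β x) (dZbar j) +
          volDensity h x * (hUp h x i j * pd i (fun y => ev1 (β y) (dZbar j)) x) := by
      intro i j
      rw [cderiv_mul (L.diffAt hx (hF i j)) ((hg j).differentiable (by simp) x), pd, pd]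
      ring
    have e2 : ∑ i, ∑ j, pd i (fun y => hUp h y i j * (volDensity h y : ℂ)) x *
        ev1 (β x) (dZbar j) = volDensity h x * ∑ i, ∑ j, hUp h x i j *
          (ev1 (β x) (dZbar j) * torsionTrace h x i) := by
      rw [Finset.sum_comm]
      simp only [← Finset.sum_mul, L.divergence_hUp hx]
      simp only [Finset.mul_sum, Finset.sum_mul]
      rw [Finset.sum_comm]
      refine Finset.sum_congr rfl fun i _ => Finset.sum_congr rfl fun j _ => ?_
      ring
    simp only [e1, Finset.sum_add_distrib]
    rw [L.formInner_fundForm hx, delStarOmega, formInner_dzbar, e2]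
    simp only [ev2_del hβ, star_mul', star_star, star_neg, hI, neg_neg, ← Finset.mul_sum]
    have e3 : ∑ i, ∑ j, hUp h x i j * (ev1 (β x) (dZbar j) * (I * torsionTrace h x i)) =
        I * ∑ i, ∑ j, hUp h x i j * (ev1 (β x) (dZbar j) * torsionTrace h x i) := by
      simp only [Finset.mul_sum]
      refine Finset.sum_congr rfl fun i _ => Finset.sum_congr rfl fun j _ => ?_
      ring
    rw [e3]
    ring
  refine setIntegral_eq_of_divergence L.isOpen ?_ hD key
  simp only [delStarOmega, formInner_dzbar, Finset.sum_mul]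
  refine (integrable_finsetSum _ fun i _ => integrable_finsetSum _ fun j _ => ?_).integrableOn
  refine (integrable_mul_of_tsupport_subset L.isOpen (F := fun x => hUp h x i j *
    star (-I * star (torsionTrace h x i)) * (volDensity h x : ℂ)) (((L.contDiffOn_hUp i j).mul
      (contDiffOn_star (contDiffOn_const.mul (contDiffOn_star (L.contDiffOn_torsionTrace i))))).mul
        L.contDiffOn_volDensity) (hg j) (hgc j) (hgs j)).congr (Filter.Eventually.of_forall fun x => ?_)
  simp only
  ring

theorem isFormalAdjoint_delbarStarOmega :
    IsFormalAdjoint h U delbar (fundForm h) (delbarStarOmega h) := by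
  have hI : star I = -I := conj_I
  refine ⟨ContDiffOn.sum fun l _ => (contDiffOn_const.mul
    (L.contDiffOn_torsionTrace l)).smul contDiffOn_const, fun β hβ hc hs => ?_⟩
  have hg := fun j => contDiff_ev1 hβ (dZ (n := n) j)
  have hgs : ∀ j : Fin n, tsupport (fun y => ev1 (β y) (dZ j)) ⊆ U :=
    fun j => (tsupport_ev1 β _).trans hs
  have hgc : ∀ j : Fin n, HasCompactSupport (fun y => ev1 (β y) (dZ j)) :=
    fun j => hc.of_isClosed_subset (isClosed_tsupport _) (tsupport_ev1 β _)
  have hF := fun i j => (L.contDiffOn_hUp i j).mul L.contDiffOn_volDensity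
  have hD := fun i j => integrable_cderiv_mul L.isOpen (hF i j) (hg i) (hgc i) (hgs i) (dZbar j)
  have key : ∀ x ∈ U, formInner h x (delbar β x) (fundForm h x) * (volDensity h x : ℂ) =
      formInner h x (β x) (delbarStarOmega h x) * (volDensity h x : ℂ) +
        I * ∑ i, ∑ j,
          cderiv (dZbar j) (fun y => hUp h y i j * (volDensity h y : ℂ) * ev1 (β y) (dZ i)) x := by
    intro x hx
    have e1 : ∀ i j, cderiv (dZbar j)
        (fun y => hUp h y i j * (volDensity h y : ℂ) * ev1 (β y) (dZ i)) x =
        pdb j (fun y => hUp h y i j * (volDensity h y : ℂ)) x * ev1 (β x) (dZ i) +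
          volDensity h x * (hUp h x i j * pdb j (fun y => ev1 (β y) (dZ i)) x) := by
      intro i j
      rw [cderiv_mul (L.diffAt hx (hF i j)) ((hg i).differentiable (by simp) x), pdb, pdb]
      ring
    have e2 : ∑ i, ∑ j, pdb j (fun y => hUp h y i j * (volDensity h y : ℂ)) x *
        ev1 (β x) (dZ i) = volDensity h x * ∑ i, ∑ j, hUp h x i j *
          (ev1 (β x) (dZ i) * star (torsionTrace h x j)) := by
      simp only [← Finset.sum_mul, L.divergence_hUp_bar hx]
      simp only [Finset.mul_sum, Finset.sum_mul]
      refine Finset.sum_congr rfl fun i _ => Finset.sum_congr rfl fun j _ => ?_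
      ring
    simp only [e1, Finset.sum_add_distrib]
    rw [L.formInner_fundForm hx, delbarStarOmega, formInner_dz, e2]
    simp only [ev2_delbar hβ, star_mul', hI, ← Finset.mul_sum, mul_neg, Finset.sum_neg_distrib]
    have e3 : ∑ i, ∑ j, hUp h x i j * (ev1 (β x) (dZ i) * (-I * star (torsionTrace h x j))) =
        -I * ∑ i, ∑ j, hUp h x i j * (ev1 (β x) (dZ i) * star (torsionTrace h x j)) := by
      simp only [Finset.mul_sum]
      refine Finset.sum_congr rfl fun i _ => Finset.sum_congr rfl fun j _ => ?_
      ring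
    rw [e3]
    ring
  refine setIntegral_eq_of_divergence L.isOpen ?_ hD key
  simp only [delbarStarOmega, formInner_dz, Finset.sum_mul]
  refine (integrable_finsetSum _ fun i _ => integrable_finsetSum _ fun j _ => ?_).integrableOn
  refine (integrable_mul_of_tsupport_subset L.isOpen (F := fun x => hUp h x i j *
    star (I * torsionTrace h x j) * (volDensity h x : ℂ)) (((L.contDiffOn_hUp i j).mul
      (contDiffOn_star (contDiffOn_const.mul (L.contDiffOn_torsionTrace j)))).mul
        L.contDiffOn_volDensity) (hg i) (hgc i) (hgs i)).congr (Filter.Eventually.of_forall fun x => ?_)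
  simp only
  ring

end IsLocalHermitian

open MeasureTheory

/-! ### Uniqueness of formal adjoints -/

theorem formInner_smul_left (g : MetricField n) (x : Fin n → ℂ) (c : ℂ)
    (α β : (Fin n → ℂ) [⋀^Fin 1]→L[ℝ] ℂ) :
    formInner g x (c • α) β = c * formInner g x α β := by
  simp only [formInner_one, ev1_smul, mul_add, Finset.mul_sum]
  congr 1 <;> exact Finset.sum_congr rfl fun i _ => Finset.sum_congr rfl fun j _ => by ring

namespace IsLocalHermitian

variable {h : MetricField n} {U : Set (Fin n → ℂ)} (L : IsLocalHermitian h U)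

include L

theorem contDiffOn_formInner_one {α : DForm n 1} (hα : ContDiffOn ℝ ∞ α U)
    (B : (Fin n → ℂ) [⋀^Fin 1]→L[ℝ] ℂ) :
    ContDiffOn ℝ ∞ (fun y => formInner h y B (α y) * (volDensity h y : ℂ)) U := by
  simp only [formInner_one]
  refine ContDiffOn.mul (ContDiffOn.add ?_ ?_) L.contDiffOn_volDensity
  · exact ContDiffOn.sum fun i _ => ContDiffOn.sum fun j _ => (L.contDiffOn_hUp i j).mul
      (contDiffOn_const.mul (contDiffOn_star (contDiffOn_ev1 hα _)))
  · exact ContDiffOn.sum fun i _ => ContDiffOn.sum fun j _ => (L.contDiffOn_hUp i j).mul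
      (contDiffOn_const.mul (contDiffOn_star (contDiffOn_ev1 hα _)))

theorem formInner_eq_of_isFormalAdjoint {D : DForm n 1 → DForm n 2} {η : DForm n 2}
    {α α' : DForm n 1} (hα : IsFormalAdjoint h U D η α) (hα' : IsFormalAdjoint h U D η α')
    (B : (Fin n → ℂ) [⋀^Fin 1]→L[ℝ] ℂ) {x : Fin n → ℂ} (hx : x ∈ U) :
    formInner h x B (α x) = formInner h x B (α' x) := by
  have hF := L.contDiffOn_formInner_one hα.1 B
  have hF' := L.contDiffOn_formInner_one hα'.1 B
  have hG := hF.sub hF'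
  -- Fundamental lemma of the calculus of variations with the test forms φ B, where φ is a real bump
  -- function and B is constant. Continuity then upgrades almost everywhere to everywhere.
  have ae := IsOpen.ae_eq_zero_of_integral_contDiff_smul_eq_zero (μ := volume) L.isOpen
    (hG.continuousOn.locallyIntegrableOn L.isOpen.measurableSet) (fun φ hφ hc hs => by
      have hφC : ContDiff ℝ ∞ fun y => (φ y : ℂ) := ofRealCLM.contDiff.comp hφ
      have hsR : tsupport (fun y => (φ y : ℂ)) ⊆ tsupport φ :=
        closure_mono fun y hy h0 => hy (by simp only [h0, ofReal_zero])
      have hsC := hsR.trans hs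
      have hcC : HasCompactSupport fun y => (φ y : ℂ) :=
        hc.of_isClosed_subset (isClosed_tsupport _) hsR
      have hβ : ContDiff ℝ ∞ fun y => (φ y : ℂ) • B := hφC.smul contDiff_const
      have hs' : tsupport (fun y => (φ y : ℂ) • B) ⊆ tsupport fun y => (φ y : ℂ) :=
        closure_mono fun y hy h0 => hy (by
          have h0' : (φ y : ℂ) = 0 := h0
          change (φ y : ℂ) • B = 0
          rw [h0', form_zero_smul])
      have hβc : HasCompactSupport fun y => (φ y : ℂ) • B :=
        hcC.of_isClosed_subset (isClosed_tsupport _) hs'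
      have e := (hα.2 _ hβ hβc (hs'.trans hsC)).symm.trans (hα'.2 _ hβ hβc (hs'.trans hsC))
      have i1 := integrable_mul_of_tsupport_subset L.isOpen hF hφC hcC hsC
      have i2 := integrable_mul_of_tsupport_subset L.isOpen hF' hφC hcC hsC
      rw [← setIntegral_eq_integral_of_forall_compl_eq_zero (s := U)]
      · simp only [formInner_smul_left] at e
        have e2 := integral_sub i1.integrableOn i2.integrableOn (μ := volume.restrict U)
        have e3 : ∀ A : (Fin n → ℂ) → ℂ, ∫ y in U, A y * (volDensity h y : ℂ) * (φ y : ℂ) =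
            ∫ y in U, (φ y : ℂ) * A y * (volDensity h y : ℂ) := fun A =>
          integral_congr_ae (Filter.Eventually.of_forall fun y => by simp only; ring)
        rw [e3, e3, e, sub_self] at e2
        rw [← e2]
        refine integral_congr_ae (Filter.Eventually.of_forall fun y => ?_)
        simp only [real_smul]
        ring
      · intro y hy
        rw [image_eq_zero_of_notMem_tsupport fun hh => hy (hs hh), zero_smul])
  have eq := Measure.eqOn_open_of_ae_eq (μ := volume) (U := U) (g := fun _ => (0 : ℂ))
    (by rw [Filter.EventuallyEq, ae_restrict_iff' L.isOpen.measurableSet]; exact ae) L.isOpen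
    hG.continuousOn continuousOn_const hx
  have hv : (volDensity h x : ℂ) ≠ 0 := by exact_mod_cast (L.volDensity_pos hx).ne'
  simp only at eq
  exact mul_right_cancel₀ hv (sub_eq_zero.mp eq)

/-- Pairing with dzᵃ and dz̄ᵃ gives the components with a raised index, and lowering recovers them.
Any adjoint thus agrees with the explicit one on U and has the same derivatives there. -/
theorem eqOn_of_isFormalAdjoint {D : DForm n 1 → DForm n 2} {η : DForm n 2}
    {α α' : DForm n 1} (hα : IsFormalAdjoint h U D η α) (hα' : IsFormalAdjoint h U D η α')
    {x : Fin n → ℂ} (hx : x ∈ U) : α x = α' x := by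
  have h1 : ∀ γ a, formInner h x (form1 (dz a)) γ = ∑ l, hUp h x a l * star (ev1 γ (dZ l)) := by
    intro γ a
    simp only [formInner_one, ev1_form1, extC_dz_dZ, extC_dz_dZbar, ite_mul, mul_ite, one_mul,
      zero_mul, mul_zero, Finset.sum_const_zero, add_zero]
    rw [Finset.sum_comm]
    simp
  have h2 : ∀ γ a, formInner h x (form1 (dzbar a)) γ =
      star (∑ l, hUp h x a l * ev1 γ (dZbar l)) := by
    intro γ a
    simp only [formInner_one, ev1_form1, extC_dzbar_dZ, extC_dzbar_dZbar, ite_mul, mul_ite,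
      one_mul, zero_mul, mul_zero, Finset.sum_const_zero, zero_add, star_sum, star_mul',
      L.star_hUp hx]
    simp
  have e1 : ∀ l, ev1 (α x) (dZ l) = ev1 (α' x) (dZ l) := fun l => by
    rw [← star_inj, ← L.lower_raise hx (fun l => star (ev1 (α x) (dZ l))),
      ← L.lower_raise hx (fun l => star (ev1 (α' x) (dZ l)))]
    simp only [← h1, L.formInner_eq_of_isFormalAdjoint hα hα' _ hx]
  have e2 : ∀ l, ev1 (α x) (dZbar l) = ev1 (α' x) (dZbar l) := fun l => by
    rw [← L.lower_raise hx (fun l => (ev1 (α x) (dZbar l))),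
      ← L.lower_raise hx (fun l => (ev1 (α' x) (dZbar l)))]
    have : ∀ a, ∑ l, hUp h x a l * ev1 (α x) (dZbar l) = ∑ l, hUp h x a l * ev1 (α' x) (dZbar l) :=
      fun a => by
        rw [← star_inj, ← h2, ← h2, L.formInner_eq_of_isFormalAdjoint hα hα' _ hx]
    simp only [this]
  rw [form_one_eq_sum (α x), form_one_eq_sum (α' x)]
  refine Finset.sum_congr rfl fun s _ => ?_
  rcases s with l | l
  · exact congrArg (· • _) (e1 l)
  · exact congrArg (· • _) (e2 l)

end IsLocalHermitian

/-! ### Metrics in charts -/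

section Chart

variable {M M' : Type*} [TopologicalSpace M] [ChartedSpace (Fin n → ℂ) M]
  [TopologicalSpace M'] [ChartedSpace (Fin n → ℂ) M']

theorem contMDiffAt_real_of_complex {f : M → M'} {x : M}
    (hf : ContMDiffAt 𝓘(ℂ, Fin n → ℂ) 𝓘(ℂ, Fin n → ℂ) ω f x) :
    ContMDiffAt 𝓘(ℝ, Fin n → ℂ) 𝓘(ℝ, Fin n → ℂ) ∞ f x := by
  rw [contMDiffAt_iff] at hf ⊢
  exact ⟨hf.1, (hf.2.restrict_scalars ℝ).of_le le_top⟩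

/-- The real derivative of a holomorphic map is its complex derivative with scalars restricted,
hence complex linear. -/
theorem mfderiv_real_J {f : M → M'} {x : M}
    (hf : MDifferentiableAt 𝓘(ℂ, Fin n → ℂ) 𝓘(ℂ, Fin n → ℂ) f x)
    (v : TangentSpace 𝓘(ℝ, Fin n → ℂ) x) :
    mfderiv 𝓘(ℝ, Fin n → ℂ) 𝓘(ℝ, Fin n → ℂ) f x (J v) =
      J (mfderiv 𝓘(ℝ, Fin n → ℂ) 𝓘(ℝ, Fin n → ℂ) f x v) := by
  let D : (Fin n → ℂ) →L[ℂ] (Fin n → ℂ) := mfderiv 𝓘(ℂ, Fin n → ℂ) 𝓘(ℂ, Fin n → ℂ) f x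
  have h1 : HasMFDerivAt 𝓘(ℝ, Fin n → ℂ) 𝓘(ℝ, Fin n → ℂ) f x (D.restrictScalars ℝ) :=
    ⟨hf.hasMFDerivAt.1, hf.hasMFDerivAt.2.restrictScalars ℝ⟩
  rw [h1.mfderiv]
  exact D.map_smul I v

variable {e : OpenPartialHomeomorph M (Fin n → ℂ)}
  (he : e ∈ IsManifold.maximalAtlas 𝓘(ℂ, Fin n → ℂ) ω M)

include he

theorem contMDiffOn_symm_real :
    ContMDiffOn 𝓘(ℝ, Fin n → ℂ) 𝓘(ℝ, Fin n → ℂ) ∞ e.symm e.target := fun _ hx =>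
  (contMDiffAt_real_of_complex (contMDiffAt_symm_of_mem_maximalAtlas he hx)).contMDiffWithinAt

theorem mfderiv_symm_injective {x : Fin n → ℂ} (hx : x ∈ e.target) :
    Function.Injective (mfderiv 𝓘(ℝ, Fin n → ℂ) 𝓘(ℝ, Fin n → ℂ) e.symm x) := by
  have h1 : e.MDifferentiable 𝓘(ℝ, Fin n → ℂ) 𝓘(ℝ, Fin n → ℂ) :=
    ⟨fun y hy => ((contMDiffAt_real_of_complex
      (contMDiffAt_of_mem_maximalAtlas he hy)).mdifferentiableAt (by simp)).mdifferentiableWithinAt,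
    (contMDiffOn_symm_real he).mdifferentiableOn (by simp)⟩
  intro v w hvw
  have h2 := h1.comp_symm_deriv hx
  have h3 := congrArg (mfderiv 𝓘(ℝ, Fin n → ℂ) 𝓘(ℝ, Fin n → ℂ) e (e.symm x)) hvw
  have h4 := fun u => congrArg (fun A => A u) h2
  exact (h4 v).symm.trans (h3.trans (h4 w))

variable [IsManifold 𝓘(ℂ, Fin n → ℂ) ω M]

theorem contMDiffOn_mfderiv_symm (v : Fin n → ℂ) :
    ContMDiffOn 𝓘(ℝ, Fin n → ℂ) 𝓘(ℝ, Fin n → ℂ).tangent ∞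
      (fun x => (⟨e.symm x, mfderiv 𝓘(ℝ, Fin n → ℂ) 𝓘(ℝ, Fin n → ℂ) e.symm x v⟩ :
        TangentBundle 𝓘(ℝ, Fin n → ℂ) M)) e.target := by
  have h1 := (contMDiffOn_symm_real he).contMDiffOn_tangentMapWithin (m := ∞) (by simp)
    e.open_target.uniqueMDiffOn
  have h2 : ContMDiffOn 𝓘(ℝ, Fin n → ℂ) 𝓘(ℝ, Fin n → ℂ).tangent ∞
      (fun x : Fin n → ℂ => (⟨x, v⟩ : TangentBundle 𝓘(ℝ, Fin n → ℂ) (Fin n → ℂ))) e.target := by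
    intro x hx
    exact (contMDiffWithinAt_vectorSpace_iff_contDiffWithinAt (V := fun _ => v)).2
      contDiffWithinAt_const
  refine (h1.comp h2 fun x hx => hx).congr fun x hx => ?_
  simp only [Function.comp, tangentMapWithin]
  rw [mfderivWithin_of_isOpen e.open_target hx]

theorem isLocalHermitian_chartMetric (g : RMetric n M)
    (hJ : ∀ (p : M) (v w : TangentSpace 𝓘(ℝ, Fin n → ℂ) p),
      g.inner p (J v) (J w) = g.inner p v w) : IsLocalHermitian (chartMetric g e) e.target where
  isOpen := e.open_target
  smooth v w := by
    have hv := contMDiffOn_mfderiv_symm he v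
    have hw := contMDiffOn_mfderiv_symm he w
    -- The smooth bundle metric is evaluated on the smooth vectors D(e⁻¹)v and D(e⁻¹)w along e⁻¹;
    -- the fibre component in the trivial line bundle is the wanted function.
    have : ContMDiffOn 𝓘(ℝ, Fin n → ℂ) (𝓘(ℝ, Fin n → ℂ).prod 𝓘(ℝ)) ∞
      (fun x => Bundle.TotalSpace.mk' ℝ (E := Bundle.Trivial M ℝ) (e.symm x)
        (chartMetric g e x v w)) e.target := by
      intro x hx
      refine ContMDiffWithinAt.clm_bundle_apply₂ (F₁ := Fin n → ℂ) (F₂ := Fin n → ℂ) ?_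
        (hv x hx) (hw x hx)
      exact ContMDiffAt.comp_contMDiffWithinAt x g.contMDiff.contMDiffAt
        (contMDiffOn_symm_real he x hx)
    rw [← contMDiffOn_iff_contDiffOn]
    intro x hx
    have h3 := this x hx
    simp only [Bundle.contMDiffWithinAt_totalSpace] at h3
    exact h3.2
  symm x _ v w := by
    rw [chartMetric_apply, chartMetric_apply, g.symm]
  inv x hx v w := by
    have hd := (contMDiffAt_symm_of_mem_maximalAtlas he hx).mdifferentiableAt (by simp)
    rw [chartMetric_apply, chartMetric_apply]
    refine Eq.trans ?_ (hJ _ _ _)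
    congr 1
    · exact congrArg _ (mfderiv_real_J hd v)
    · exact mfderiv_real_J hd w
  pos x hx v hv := by
    rw [chartMetric_apply]
    refine g.pos _ _ fun h0 => hv ?_
    exact mfderiv_symm_injective he hx (h0.trans (map_zero _).symm)

end Chart

/-! ### Traces of curvature-like tensors -/

section traces

variable (h : MetricField n) (x : Fin n → ℂ)

/-- `h^{k l̄} R_{i j̄ k l̄}`. -/
def tr1 (R : Fin n → Fin n → Fin n → Fin n → ℂ) (i j : Fin n) : ℂ :=
  ∑ k, ∑ l, hUp h x k l * R i j k l

/-- `h^{k l̄} R_{k l̄ i j̄}`. -/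
def tr2 (R : Fin n → Fin n → Fin n → Fin n → ℂ) (i j : Fin n) : ℂ :=
  ∑ k, ∑ l, hUp h x k l * R k l i j

/-- `h^{k l̄} R_{i l̄ k j̄}`. -/
def tr3 (R : Fin n → Fin n → Fin n → Fin n → ℂ) (i j : Fin n) : ℂ :=
  ∑ k, ∑ l, hUp h x k l * R i l k j

/-- `h^{k l̄} R_{k j̄ i l̄}`. -/
def tr4 (R : Fin n → Fin n → Fin n → Fin n → ℂ) (i j : Fin n) : ℂ :=
  ∑ k, ∑ l, hUp h x k l * R k j i l

/-- The full trace `h^{i j̄} a_{i j̄}`. -/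
def trace (a : Fin n → Fin n → ℂ) : ℂ := ∑ i, ∑ j, hUp h x i j * a i j

/-- The components of `T ⊡ T̄` in terms of the torsion with all indices lowered. -/
def boxLow (i j : Fin n) : ℂ := ∑ a, ∑ b, ∑ p, ∑ q, hUp h x a b * hUp h x p q *
  (torsionLow h x i a q * star (torsionLow h x j b p))

/-- The components of `T ∘ T̄` in terms of the torsion with all indices lowered. -/
def circLow (i j : Fin n) : ℂ := ∑ a, ∑ b, ∑ p, ∑ q, hUp h x a b * hUp h x p q *
  (torsionLow h x a p j * star (torsionLow h x b q i))

/-- The contraction of the torsion with the conjugate of its trace. -/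
def contractLow (i j : Fin n) : ℂ := ∑ p, ∑ q, hUp h x p q *
  (star (torsionTrace h x q) * torsionLow h x p i j)

/-- The quadratic torsion term in the curvature of the Gauduchon connections. -/
def torsionQuad (i j k l : Fin n) : ℂ := ∑ p, ∑ q, hUp h x p q *
  (torsionLow h x i k q * star (torsionLow h x j l p)
    - torsionLow h x i p l * star (torsionLow h x j q k))

theorem torsionLow_swap (i j k : Fin n) : torsionLow h x i j k = - torsionLow h x j i k := by
  rw [torsionLow, torsionLow]; ring

variable {h x} in
theorem IsLocalHermitian.star_torsionTrace {U : Set (Fin n → ℂ)} (L : IsLocalHermitian h U)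
    (hx : x ∈ U) (q : Fin n) : star (torsionTrace h x q) =
      ∑ k, ∑ l, hUp h x k l * star (torsionLow h x q l k) := by
  rw [torsionTrace, Finset.sum_comm]
  simp only [star_sum, star_mul', L.star_hUp hx]

/-- Renaming (k, l) ↔ (p, q) exchanges the two halves. This is why the first Ricci form is affine in
t. -/
theorem tr1_torsionQuad (i j : Fin n) : tr1 h x (torsionQuad h x) i j = 0 := by
  have e : ∑ k, ∑ l, ∑ p, ∑ q, hUp h x k l * (hUp h x p q *
        (torsionLow h x i p l * star (torsionLow h x j q k))) =
      ∑ k, ∑ l, ∑ p, ∑ q, hUp h x k l * (hUp h x p q *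
        (torsionLow h x i k q * star (torsionLow h x j l p))) := by
    rw [sum4_swap]
    refine Finset.sum_congr rfl fun _ _ => Finset.sum_congr rfl fun _ _ =>
      Finset.sum_congr rfl fun _ _ => Finset.sum_congr rfl fun _ _ => by ring
  simp only [tr1, torsionQuad, mul_sub, Finset.mul_sum, Finset.sum_sub_distrib, e, sub_self]

theorem tr2_torsionQuad (i j : Fin n) :
    tr2 h x (torsionQuad h x) i j = boxLow h x i j - circLow h x i j := by
  simp only [tr2, torsionQuad, boxLow, circLow, mul_sub, Finset.mul_sum, Finset.sum_sub_distrib]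
  refine congrArg₂ _ ?_ ?_
  · refine Finset.sum_congr rfl fun k _ => Finset.sum_congr rfl fun l _ =>
      Finset.sum_congr rfl fun _ _ => Finset.sum_congr rfl fun _ _ => ?_
    rw [torsionLow_swap h x k, torsionLow_swap h x l, star_neg]
    ring
  · refine Finset.sum_congr rfl fun k _ => Finset.sum_congr rfl fun l _ =>
      Finset.sum_congr rfl fun _ _ => Finset.sum_congr rfl fun _ _ => by ring

variable {h x} {U : Set (Fin n → ℂ)} (L : IsLocalHermitian h U) (hx : x ∈ U)

include L hx

/-- The first half gives -T ⊡ T̄ after one swap of indices. In the second half the contracted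
indices meet on one torsion factor and form a torsion trace, whence the term with ∂^*ω. -/
theorem IsLocalHermitian.tr3_torsionQuad (i j : Fin n) :
    tr3 h x (torsionQuad h x) i j = - boxLow h x i j - contractLow h x i j := by
  simp only [tr3, torsionQuad, boxLow, contractLow, mul_sub, Finset.mul_sum,
    Finset.sum_sub_distrib, L.star_torsionTrace hx, Finset.sum_mul, ← Finset.sum_neg_distrib]
  refine congrArg₂ _ ?_ ?_
  · refine Finset.sum_congr rfl fun k _ => Finset.sum_congr rfl fun l _ =>
      Finset.sum_congr rfl fun _ _ => Finset.sum_congr rfl fun _ _ => ?_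
    rw [torsionLow_swap h x l, star_neg]
    ring
  · rw [sum4_swap]
    refine Finset.sum_congr rfl fun p _ => Finset.sum_congr rfl fun q _ =>
      Finset.sum_congr rfl fun k _ => Finset.sum_congr rfl fun l _ => ?_
    rw [torsionLow_swap h x l, torsionLow_swap h x i, star_neg]
    ring

theorem IsLocalHermitian.tr4_torsionQuad (i j : Fin n) :
    tr4 h x (torsionQuad h x) i j = - boxLow h x i j - star (contractLow h x j i) := by
  have e : star (contractLow h x j i) = ∑ p, ∑ q, hUp h x p q *
      (torsionTrace h x p * star (torsionLow h x q j i)) := by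
    rw [contractLow, Finset.sum_comm]
    simp only [star_sum, star_mul', star_star, L.star_hUp hx]
  rw [e]
  simp only [tr4, torsionQuad, boxLow, torsionTrace, mul_sub, Finset.mul_sum,
    Finset.sum_sub_distrib, Finset.sum_mul, ← Finset.sum_neg_distrib]
  refine congrArg₂ _ ?_ ?_
  · refine Finset.sum_congr rfl fun k _ => Finset.sum_congr rfl fun l _ =>
      Finset.sum_congr rfl fun _ _ => Finset.sum_congr rfl fun _ _ => ?_
    rw [torsionLow_swap h x k]
    ring
  · rw [sum4_swap]
    refine Finset.sum_congr rfl fun p _ => Finset.sum_congr rfl fun q _ =>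
      Finset.sum_congr rfl fun k _ => Finset.sum_congr rfl fun l _ => ?_
    rw [torsionLow_swap h x k, torsionLow_swap h x j, star_neg]
    ring

end traces

/-! ### Traces of the curvature polynomial in t, and double traces -/

section linear

variable (h : MetricField n) (x : Fin n → ℂ) (Th Q : Fin n → Fin n → Fin n → Fin n → ℂ) (t : ℂ)
  (i j : Fin n)

/-- The shape of the curvature of the Gauduchon connections. -/
def gauduchonTensor (i j k l : Fin n) : ℂ :=
  Th i j k l + t * (Th i l k j + Th k j i l - 2 * Th i j k l) + t ^ 2 * Q i j k l

theorem tr1_gauduchonTensor : tr1 h x (gauduchonTensor Th Q t) i j =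
    tr1 h x Th i j + t * (tr3 h x Th i j + tr4 h x Th i j - 2 * tr1 h x Th i j)
      + t ^ 2 * tr1 h x Q i j := by
  simp only [tr1, tr3, tr4, gauduchonTensor, Finset.mul_sum, ← Finset.sum_add_distrib,
    ← Finset.sum_sub_distrib]
  exact Finset.sum_congr rfl fun _ _ => Finset.sum_congr rfl fun _ _ => by ring

theorem tr2_gauduchonTensor : tr2 h x (gauduchonTensor Th Q t) i j =
    tr2 h x Th i j + t * (tr3 h x Th i j + tr4 h x Th i j - 2 * tr2 h x Th i j)
      + t ^ 2 * tr2 h x Q i j := by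
  simp only [tr2, tr3, tr4, gauduchonTensor, Finset.mul_sum, ← Finset.sum_add_distrib,
    ← Finset.sum_sub_distrib]
  exact Finset.sum_congr rfl fun _ _ => Finset.sum_congr rfl fun _ _ => by ring

theorem tr3_gauduchonTensor : tr3 h x (gauduchonTensor Th Q t) i j =
    tr3 h x Th i j + t * (tr1 h x Th i j + tr2 h x Th i j - 2 * tr3 h x Th i j)
      + t ^ 2 * tr3 h x Q i j := by
  simp only [tr1, tr2, tr3, gauduchonTensor, Finset.mul_sum, ← Finset.sum_add_distrib,
    ← Finset.sum_sub_distrib]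
  exact Finset.sum_congr rfl fun _ _ => Finset.sum_congr rfl fun _ _ => by ring

theorem tr4_gauduchonTensor : tr4 h x (gauduchonTensor Th Q t) i j =
    tr4 h x Th i j + t * (tr1 h x Th i j + tr2 h x Th i j - 2 * tr4 h x Th i j)
      + t ^ 2 * tr4 h x Q i j := by
  simp only [tr1, tr2, tr4, gauduchonTensor, Finset.mul_sum, ← Finset.sum_add_distrib,
    ← Finset.sum_sub_distrib]
  exact Finset.sum_congr rfl fun _ _ => Finset.sum_congr rfl fun _ _ => by ring

theorem trace_tr1_eq_tr2 : trace h x (tr1 h x Th) = trace h x (tr2 h x Th) := by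
  simp only [trace, tr1, tr2, Finset.mul_sum]
  rw [sum4_swap]
  exact Finset.sum_congr rfl fun _ _ => Finset.sum_congr rfl fun _ _ =>
    Finset.sum_congr rfl fun _ _ => Finset.sum_congr rfl fun _ _ => by ring

theorem trace_tr3_eq_tr4 : trace h x (tr3 h x Th) = trace h x (tr4 h x Th) := by
  simp only [trace, tr3, tr4, Finset.mul_sum]
  rw [sum4_swap]
  exact Finset.sum_congr rfl fun _ _ => Finset.sum_congr rfl fun _ _ =>
    Finset.sum_congr rfl fun _ _ => Finset.sum_congr rfl fun _ _ => by ring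

theorem scalar1_eq_trace : scalar1 h x Th = trace h x (tr1 h x Th) := by
  simp only [scalar1, trace, tr1, Finset.mul_sum, mul_assoc]

theorem scalar2_eq_trace : scalar2 h x Th = trace h x (tr3 h x Th) := by
  simp only [scalar2, trace, tr3, Finset.mul_sum]
  refine Finset.sum_congr rfl fun i _ => ?_
  calc ∑ j, ∑ k, ∑ l, hUp h x i l * hUp h x k j * Th i j k l =
      ∑ j, ∑ l, ∑ k, hUp h x i l * hUp h x k j * Th i j k l :=
        Finset.sum_congr rfl fun _ _ => Finset.sum_comm
    _ = ∑ l, ∑ j, ∑ k, hUp h x i l * hUp h x k j * Th i j k l := Finset.sum_comm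
    _ = _ := Finset.sum_congr rfl fun l _ => by
        rw [Finset.sum_comm]
        simp only [mul_assoc]

theorem trace_add (a b : Fin n → Fin n → ℂ) :
    trace h x (fun i j => a i j + b i j) = trace h x a + trace h x b := by
  simp only [trace, mul_add, Finset.sum_add_distrib]

theorem trace_sub (a b : Fin n → Fin n → ℂ) :
    trace h x (fun i j => a i j - b i j) = trace h x a - trace h x b := by
  simp only [trace, mul_sub, Finset.sum_sub_distrib]

theorem trace_const_mul (c : ℂ) (a : Fin n → Fin n → ℂ) :
    trace h x (fun i j => c * a i j) = c * trace h x a := by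
  simp only [trace, Finset.mul_sum]
  exact Finset.sum_congr rfl fun _ _ => Finset.sum_congr rfl fun _ _ => by ring

end linear

/-! ### Derivatives of the torsion trace and the Chern curvature -/

section chern

variable {h : MetricField n} {U : Set (Fin n → ℂ)} (L : IsLocalHermitian h U)
  {x : Fin n → ℂ} (hx : x ∈ U) {ch sb : Conn n} (hch : IsRealChern h U ch)
  (hsb : IsRealStromingerBismut h U sb)

include L hx

theorem IsLocalHermitian.star_metricHess (i j k l : Fin n) :
    star (metricHess h x i j k l) = metricHess h x j i l k := by
  rw [← L.pdb_pd_hMat hx j i l k, metricHess,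
    ← pdb_star i (L.diffAt hx (L.contDiffOn_pdb_hMat j k l))]
  refine L.cderiv_congr hx fun y hy => ?_
  rw [← pd_star j (L.diffAt_hMat hy k l)]
  exact L.cderiv_congr hy fun z hz => L.star_hMat hz k l

include hch hsb

/-- Hermitian symmetry makes the first trace Hermitian and the third and fourth conjugate
transposes, so `pdb_torsionTrace` also determines ∂∂^*ω. -/
theorem star_curv_chern (i j k l : Fin n) :
    star (curv h ch x i j k l) = curv h ch x j i l k := by
  rw [curv_chern L hx hch hsb, curv_chern L hx hch hsb, star_add, star_neg,
    L.star_metricHess hx]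
  refine congrArg₂ _ rfl ?_
  rw [Finset.sum_comm]
  simp only [star_sum, star_mul', star_star, L.star_hUp hx]
  exact Finset.sum_congr rfl fun _ _ => Finset.sum_congr rfl fun _ _ => by ring

theorem star_tr1_chern (i j : Fin n) :
    star (tr1 h x (curv h ch x) j i) = tr1 h x (curv h ch x) i j := by
  rw [tr1, tr1, Finset.sum_comm]
  simp only [star_sum, star_mul', L.star_hUp hx, star_curv_chern L hx hch hsb]

theorem star_tr4_chern (i j : Fin n) :
    star (tr4 h x (curv h ch x) j i) = tr3 h x (curv h ch x) i j := by
  rw [tr4, tr3, Finset.sum_comm]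
  simp only [star_sum, star_mul', L.star_hUp hx, star_curv_chern L hx hch hsb]

/-- A traced Bianchi identity of the Chern connection: ∂_ī T is a difference of curvatures plus a
term quadratic in first derivatives of h, and the derivative of h^{p q̄} cancels that term. -/
theorem pdb_torsionTrace (i l : Fin n) : pdb i (fun y => torsionTrace h y l) x =
    tr4 h x (curv h ch x) l i - tr1 h x (curv h ch x) l i := by
  have d1 := fun p q => L.diffAt_hUp hx p q
  have d2 := fun p q => L.diffAt hx (L.contDiffOn_torsionLow l p q)
  have d3 : ∀ p q, DifferentiableAt ℝ (fun y => hUp h y p q * torsionLow h y l p q) x :=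
    fun p q => (d1 p q).mul (d2 p q)
  have e1 : pdb i (fun y => torsionTrace h y l) x = ∑ p, ∑ q,
      (pdb i (fun y => hUp h y p q) x * torsionLow h x l p q +
        hUp h x p q * (metricHess h x l i p q - metricHess h x p i l q)) := by
    simp only [torsionTrace, pdb]
    rw [cderiv_sum _ fun p _ => DifferentiableAt.fun_sum fun q _ => d3 p q]
    refine Finset.sum_congr rfl fun p _ => ?_
    rw [cderiv_sum _ fun q _ => d3 p q]
    refine Finset.sum_congr rfl fun q _ => ?_
    rw [cderiv_mul (d1 p q) (d2 p q), ← L.pdb_torsionLow hx i l p q]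
    rfl
  -- Difference of two Chern curvatures with l and p exchanged; their quadratic parts combine into T
  -- times one derivative of h.
  have e2 : ∀ p q, metricHess h x l i p q - metricHess h x p i l q =
      curv h ch x p i l q - curv h ch x l i p q + ∑ a, ∑ b, hUp h x a b *
        (torsionLow h x l p b * star (pd i (fun y => hMat h y q a) x)) := by
    intro p q
    simp only [curv_chern L hx hch hsb, torsionLow, sub_mul, mul_sub, Finset.sum_sub_distrib]
    ring
  have e3 : ∀ p q, pdb i (fun y => hUp h y p q) x = - ∑ a, ∑ b, hUp h x p b *
      star (pd i (fun y => hMat h y b a) x) * hUp h x a q := by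
    intro p q
    rw [pdb, L.cderiv_hUp hx]
    simp only [← pdb.eq_1, L.pdb_hMat hx]
  simp only [e1, e2, e3, mul_add, mul_sub, Finset.sum_add_distrib, Finset.sum_sub_distrib, tr1,
    tr4, neg_mul, Finset.sum_neg_distrib]
  -- The contribution of the derivative of h^{p q̄} equals that of the quadratic term in `e2`; they
  -- occur with opposite signs.
  have e4 : ∀ p, ∑ q, (∑ a, ∑ b, hUp h x p b * star (pd i (fun y => hMat h y b a) x) *
      hUp h x a q) * torsionLow h x l p q = ∑ q, hUp h x p q * ∑ a, ∑ b, hUp h x a b *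
        (torsionLow h x l p b * star (pd i (fun y => hMat h y q a) x)) := by
    intro p
    simp only [Finset.mul_sum, Finset.sum_mul]
    calc _ = ∑ q, ∑ b, ∑ a, hUp h x p b * star (pd i (fun y => hMat h y b a) x) *
      hUp h x a q * torsionLow h x l p q := Finset.sum_congr rfl fun _ _ => Finset.sum_comm
      _ = ∑ b, ∑ q, ∑ a, hUp h x p b * star (pd i (fun y => hMat h y b a) x) *
      hUp h x a q * torsionLow h x l p q := Finset.sum_comm
      _ = _ := Finset.sum_congr rfl fun q _ => by
        rw [Finset.sum_comm]
        exact Finset.sum_congr rfl fun a _ => Finset.sum_congr rfl fun b _ => by ring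
  simp only [e4]
  ring

/-- Each Hessian is minus a Chern curvature plus a quadratic term. The four quadratic terms form a
product of two antisymmetrised derivatives, that is T times conj(T). -/
theorem Lam_del_delbar_eq : Lam h x (del (delbar (fundForm h)) x) = form11 fun i j =>
    boxLow h x i j - (tr1 h x (curv h ch x) i j + tr2 h x (curv h ch x) i j
      - tr3 h x (curv h ch x) i j - tr4 h x (curv h ch x) i j) := by
  rw [L.Lam_del_delbar hx]
  congr 1
  funext i j
  simp only [tr1, tr2, tr3, tr4, boxLow, ← Finset.sum_add_distrib, ← Finset.sum_sub_distrib]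
  refine Finset.sum_congr rfl fun a _ => Finset.sum_congr rfl fun b _ => ?_
  have e : ∑ p, ∑ q, hUp h x a b * hUp h x p q *
      (torsionLow h x i a q * star (torsionLow h x j b p)) = hUp h x a b *
      (∑ p, ∑ q, hUp h x p q * (pd a (fun y => hMat h y i q) x * star (pd b (fun y => hMat h y j p) x))
      - ∑ p, ∑ q, hUp h x p q * (pd a (fun y => hMat h y i q) x * star (pd j (fun y => hMat h y b p) x))
      - ∑ p, ∑ q, hUp h x p q * (pd i (fun y => hMat h y a q) x * star (pd b (fun y => hMat h y j p) x))
      + ∑ p, ∑ q, hUp h x p q * (pd i (fun y => hMat h y a q) x * star (pd j (fun y => hMat h y b p) x)))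
      := by
    simp only [← Finset.sum_add_distrib, ← Finset.sum_sub_distrib, Finset.mul_sum]
    refine Finset.sum_congr rfl fun p _ => Finset.sum_congr rfl fun q _ => ?_
    simp only [torsionLow, star_sub]
    ring
  simp only [e, curv_chern L hx hch hsb]
  ring

theorem del_delStar {ds : DForm n 1} (hds : IsFormalAdjoint h U del (fundForm h) ds) :
    del ds x = form11 fun i j => I * (tr1 h x (curv h ch x) i j - tr3 h x (curv h ch x) i j) := by
  have hI : star I = -I := conj_I
  have dτ := fun j => L.diffAt hx (L.contDiffOn_torsionTrace j)
  rw [del_dzbar (f := fun l y => -I * star (torsionTrace h y l))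
    (Filter.eventuallyEq_of_mem (L.isOpen.mem_nhds hx) fun y hy =>
      L.eqOn_of_isFormalAdjoint hds L.isFormalAdjoint_delStarOmega hy)
    fun j => (L.diffAt hx (contDiffOn_star (L.contDiffOn_torsionTrace j))).const_mul _]
  congr 1
  funext i j
  rw [pd, cderiv_const_mul _ (L.diffAt hx (contDiffOn_star (L.contDiffOn_torsionTrace j))), ← pd,
    pd_star i (dτ j), pdb_torsionTrace L hx hch hsb, star_sub, star_tr4_chern L hx hch hsb,
    star_tr1_chern L hx hch hsb]
  ring

theorem delbar_delbarStar {dbs : DForm n 1}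
    (hdbs : IsFormalAdjoint h U delbar (fundForm h) dbs) :
    delbar dbs x = form11 fun i j =>
      I * (tr1 h x (curv h ch x) i j - tr4 h x (curv h ch x) i j) := by
  have dτ := fun j => L.diffAt hx (L.contDiffOn_torsionTrace j)
  rw [delbar_dz (f := fun l y => I * torsionTrace h y l)
    (Filter.eventuallyEq_of_mem (L.isOpen.mem_nhds hx) fun y hy =>
      L.eqOn_of_isFormalAdjoint hdbs L.isFormalAdjoint_delbarStarOmega hy)
    fun j => (dτ j).const_mul _]
  congr 1
  funext i j
  rw [pdb, cderiv_const_mul _ (dτ i), ← pdb, pdb_torsionTrace L hx hch hsb]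
  ring

end chern

/-! ### Raising the indices of the torsion -/

section raise

variable {h : MetricField n} {U : Set (Fin n → ℂ)} (L : IsLocalHermitian h U)
  {x : Fin n → ℂ} (hx : x ∈ U) {ch sb : Conn n} (hch : IsRealChern h U ch)
  (hsb : IsRealStromingerBismut h U sb)

include L hx

/-- Contracting raised tensors with h_{p q̄} is contracting the lowered ones with h^{p q̄}. This is
the bridge from `torsionC` to `torsionLow`. -/
theorem IsLocalHermitian.sum_raise {v w a b : Fin n → ℂ}
    (hv : ∀ l, ∑ p, v p * hMat h x p l = a l) (hw : ∀ l, ∑ p, w p * hMat h x p l = b l) :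
    ∑ p, ∑ q, hMat h x p q * v p * star (w q) = ∑ p, ∑ q, hUp h x p q * (a q * star (b p)) := by
  rw [Finset.sum_comm]
  conv_rhs => rw [Finset.sum_comm]
  refine Finset.sum_congr rfl fun q _ => ?_
  rw [eq_raise L hx hw q, ← Finset.sum_mul, ← hv q, star_sum, Finset.mul_sum]
  refine Finset.sum_congr rfl fun l _ => ?_
  rw [star_mul', L.star_hUp hx]
  simp only [mul_comm (hMat h x _ q)]
  ring

include hch

theorem torsionC_low (i k l : Fin n) :
    ∑ p, torsionC ch x i k p * hMat h x p l = torsionLow h x i k l := by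
  simp only [torsionC, sub_mul, Finset.sum_sub_distrib, hch.christoffel_low L hx]
  rfl

theorem star_torsionC_low (i k l : Fin n) :
    ∑ p, hMat h x l p * star (torsionC ch x i k p) = star (torsionLow h x i k l) := by
  rw [← torsionC_low L hx hch, star_sum]
  refine Finset.sum_congr rfl fun p _ => ?_
  rw [star_mul', L.star_hMat hx, mul_comm]

theorem torsionQuad_eq (i j k l : Fin n) :
    ∑ p, ∑ q, torsionC ch x i k p * star (torsionC ch x j l q) * hMat h x p q
      - ∑ p, ∑ q, ∑ m, ∑ r, hUp h x p q * hMat h x m l * hMat h x k r * torsionC ch x i p m *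
        star (torsionC ch x j q r) = torsionQuad h x i j k l := by
  have e1 : ∑ p, ∑ q, torsionC ch x i k p * star (torsionC ch x j l q) * hMat h x p q =
      ∑ p, ∑ q, hUp h x p q * (torsionLow h x i k q * star (torsionLow h x j l p)) := by
    rw [← L.sum_raise hx (torsionC_low L hx hch i k) (torsionC_low L hx hch j l)]
    exact Finset.sum_congr rfl fun _ _ => Finset.sum_congr rfl fun _ _ => by ring
  have e2 : ∀ p q, ∑ m, ∑ r, hUp h x p q * hMat h x m l * hMat h x k r * torsionC ch x i p m *
      star (torsionC ch x j q r) =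
        hUp h x p q * (torsionLow h x i p l * star (torsionLow h x j q k)) := by
    intro p q
    rw [← torsionC_low L hx hch, ← star_torsionC_low L hx hch, Finset.sum_mul_sum, Finset.mul_sum]
    refine Finset.sum_congr rfl fun m _ => ?_
    rw [Finset.mul_sum]
    exact Finset.sum_congr rfl fun r _ => by ring
  simp only [e1, e2, torsionQuad, mul_sub, Finset.sum_sub_distrib]

theorem torsionBox_eq : torsionBox h (torsionC ch x) x = form11 (boxLow h x) := by
  rw [torsionBox]
  refine congrArg form11 (funext fun i => funext fun j => ?_)
  rw [boxLow]
  refine Finset.sum_congr rfl fun p _ => Finset.sum_congr rfl fun q _ => ?_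
  have := L.sum_raise hx (torsionC_low L hx hch i p) (torsionC_low L hx hch j q)
  simp only [mul_assoc, ← Finset.mul_sum] at this ⊢
  rw [this]

theorem torsionCirc_eq : torsionCirc h (torsionC ch x) x = form11 (circLow h x) := by
  rw [torsionCirc]
  refine congrArg form11 (funext fun i => funext fun j => ?_)
  rw [circLow, sum4_swap]
  refine Finset.sum_congr rfl fun p _ => Finset.sum_congr rfl fun q _ =>
    Finset.sum_congr rfl fun s _ => Finset.sum_congr rfl fun r _ => ?_
  rw [← torsionC_low L hx hch, ← star_torsionC_low L hx hch, Finset.sum_mul_sum, Finset.mul_sum]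
  refine Finset.sum_congr rfl fun k _ => ?_
  rw [Finset.mul_sum]
  exact Finset.sum_congr rfl fun l _ => by ring

theorem torsionContract_eq {ds : DForm n 1} (hds : IsFormalAdjoint h U del (fundForm h) ds) :
    torsionContract h (torsionC ch x) x (sharp h x (ds x)) =
      form11 fun i j => -I * contractLow h x i j := by
  have e : ∀ p, sharp h x (ds x) p = ∑ q, hUp h x p q * (-I * star (torsionTrace h x q)) := by
    intro p
    rw [L.eqOn_of_isFormalAdjoint hds L.isFormalAdjoint_delStarOmega hx, sharp]
    simp only [evalC_one, delStarOmega, ev1_sum_dzbar_dZbar]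
  rw [torsionContract]
  refine congrArg form11 (funext fun i => funext fun j => ?_)
  rw [contractLow, Finset.mul_sum]
  refine Finset.sum_congr rfl fun p _ => ?_
  simp only [mul_assoc, ← Finset.mul_sum]
  rw [torsionC_low L hx hch, e, Finset.sum_mul, Finset.mul_sum]
  exact Finset.sum_congr rfl fun q _ => by ring

include hsb

theorem curv_gauduchon_eq_gauduchonTensor (t : ℝ) : curv h (gauduchon ch sb t) x =
    gauduchonTensor (curv h ch x) (torsionQuad h x) t := by
  funext i j k l
  rw [curv_gauduchon_eq L hx hch hsb t]
  rfl

end raise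

/-! ### Pointwise inner products as traces -/

theorem formInner_fundForm_form11 {h : MetricField n} {U : Set (Fin n → ℂ)}
    (L : IsLocalHermitian h U) {x : Fin n → ℂ} (hx : x ∈ U) (a : Fin n → Fin n → ℂ) :
    formInner h x (form11 fun i j => I * a i j) (fundForm h x) = trace h x a := by
  rw [L.formInner_fundForm hx, trace, Finset.mul_sum]
  refine Finset.sum_congr rfl fun i _ => ?_
  rw [Finset.mul_sum]
  refine Finset.sum_congr rfl fun j _ => ?_
  rw [ev2_form11]
  linear_combination -(hUp h x i j * a i j) * I_mul_I

theorem formInner_delStar {h : MetricField n} {U : Set (Fin n → ℂ)}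
    (L : IsLocalHermitian h U) {x : Fin n → ℂ} (hx : x ∈ U) {ds : DForm n 1}
    (hds : IsFormalAdjoint h U del (fundForm h) ds) :
    formInner h x (ds x) (ds x) = trace h x (contractLow h x) := by
  have hI : star I = -I := conj_I
  have e : trace h x (contractLow h x) = ∑ p, ∑ q, hUp h x p q *
      (torsionTrace h x p * star (torsionTrace h x q)) := by
    -- Tracing over the two free indices turns the remaining torsion factor into a second torsion
    -- trace.
    simp only [trace, contractLow, Finset.mul_sum]
    rw [sum4_swap]
    refine Finset.sum_congr rfl fun p _ => Finset.sum_congr rfl fun q _ => ?_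
    have : torsionTrace h x p = ∑ i, ∑ j, hUp h x i j * torsionLow h x p i j := rfl
    rw [this, Finset.sum_mul, Finset.mul_sum]
    refine Finset.sum_congr rfl fun i _ => ?_
    rw [Finset.sum_mul, Finset.mul_sum]
    exact Finset.sum_congr rfl fun j _ => by ring
  rw [L.eqOn_of_isFormalAdjoint hds L.isFormalAdjoint_delStarOmega hx, e]
  simp only [delStarOmega]
  rw [formInner_dzbar]
  simp only [ev1_sum_dzbar_dZbar]
  refine Finset.sum_congr rfl fun i _ => Finset.sum_congr rfl fun j _ => ?_
  rw [star_mul', star_neg, hI, star_star]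
  linear_combination
    -(hUp h x i j * torsionTrace h x i * star (torsionTrace h x j)) * I_mul_I

theorem formInner_del_fundForm_eq {h : MetricField n} {U : Set (Fin n → ℂ)}
    (L : IsLocalHermitian h U) {x : Fin n → ℂ} (hx : x ∈ U) :
    2 * formInner h x (del (fundForm h) x) (del (fundForm h) x) = trace h x (boxLow h x) := by
  rw [L.formInner_del_fundForm hx]
  simp only [trace, boxLow, Finset.mul_sum, mul_assoc]

end

end HermitianGeometry

/-! ### Assembling the identities in a chart -/

open HermitianGeometry

theorem corollary1p6 {n : ℕ} {M : Type*} [TopologicalSpace M] [ChartedSpace (Fin n → ℂ) M]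
    [IsManifold 𝓘(ℂ, Fin n → ℂ) ω M]
    (g : RMetric n M)
    (hJ : ∀ (p : M) (v w : TangentSpace 𝓘(ℝ, Fin n → ℂ) p),
      g.inner p (J v) (J w) = g.inner p v w)
    (e : OpenPartialHomeomorph M (Fin n → ℂ))
    (he : e ∈ IsManifold.maximalAtlas 𝓘(ℂ, Fin n → ℂ) ω M)
    (h : MetricField n) (hh : h = chartMetric g e)
    (U : Set (Fin n → ℂ)) (hU : U = e.target)
    (Om : DForm n 2) (hOm : Om = fundForm h) :
    (∃ ch, IsRealChern h U ch) ∧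
    (∃ sb, IsRealStromingerBismut h U sb) ∧
    (∃ ds, IsFormalAdjoint h U del Om ds) ∧
    (∃ dbs, IsFormalAdjoint h U delbar Om dbs) ∧
    ∀ (ch sb : Conn n) (ds dbs : DForm n 1),
      IsRealChern h U ch → IsRealStromingerBismut h U sb →
      IsFormalAdjoint h U del Om ds → IsFormalAdjoint h U delbar Om dbs →
      ∀ (t : ℝ), ∀ x ∈ U,
      let H := hMat h x
      let Th := curv h ch x
      let R := curv h (gauduchon ch sb t) x
      let T := torsionC ch x
      (∀ i j k l, R i j k l = Th i j k l + t * (Th i l k j + Th k j i l - 2 * Th i j k l)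
        + t ^ 2 * (∑ p, ∑ q, T i k p * star (T j l q) * H p q
          - ∑ p, ∑ q, ∑ m, ∑ r,
              hUp h x p q * H m l * H k r * T i p m * star (T j q r))) ∧
      ricci1 h x R = ricci1 h x Th - (t : ℂ) • (del ds x + delbar dbs x) ∧
      ricci2 h x R = ricci1 h x Th - ((1 - 2 * t) * I : ℂ) • Lam h x (del (delbar Om) x)
        - (1 - t : ℂ) • (del ds x + delbar dbs x)
        + ((1 - t) ^ 2 * I : ℂ) • torsionBox h T x - (t ^ 2 * I : ℂ) • torsionCirc h T x ∧
      ricci3 h x R = ricci1 h x Th - (t * I : ℂ) • Lam h x (del (delbar Om) x)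
        - (1 - t : ℂ) • del ds x - (t : ℂ) • delbar dbs x
        + ((t - t ^ 2) * I : ℂ) • torsionBox h T x
        + (t ^ 2 : ℂ) • torsionContract h T x (sharp h x (ds x)) ∧
      ricci4 h x R = ricci1 h x Th - (t * I : ℂ) • Lam h x (del (delbar Om) x)
        - (1 - t : ℂ) • delbar dbs x - (t : ℂ) • del ds x
        + ((t - t ^ 2) * I : ℂ) • torsionBox h T x
        + (t ^ 2 : ℂ) • conjForm (torsionContract h T x (sharp h x (ds x))) ∧
      scalar1 h x R = scalar1 h x Th - 2 * t * formInner h x (del ds x) (Om x) ∧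
      scalar2 h x R = scalar1 h x Th - (1 - 2 * t) * formInner h x (del ds x) (Om x)
        - t ^ 2 * (2 * formInner h x (del Om x) (del Om x) + formInner h x (ds x) (ds x)) := by
  subst hOm
  have L : IsLocalHermitian h U := by
    rw [hh, hU]
    exact isLocalHermitian_chartMetric he g hJ
  refine ⟨exists_chern L, exists_strominger_bismut L, ⟨_, L.isFormalAdjoint_delStarOmega⟩,
    ⟨_, L.isFormalAdjoint_delbarStarOmega⟩, ?_⟩
  intro ch sb ds dbs hch hsb hds hdbs t x hx H Th R T
  have hR : R = gauduchonTensor Th (torsionQuad h x) t :=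
    curv_gauduchon_eq_gauduchonTensor L hx hch hsb t
  have hdel : del ds x = form11 fun i j => I * (tr1 h x Th i j - tr3 h x Th i j) :=
    del_delStar L hx hch hsb hds
  have hdelbar : delbar dbs x = form11 fun i j => I * (tr1 h x Th i j - tr4 h x Th i j) :=
    delbar_delbarStar L hx hch hsb hdbs
  have hLam := Lam_del_delbar_eq L hx hch hsb
  have hbox : torsionBox h T x = form11 (boxLow h x) := torsionBox_eq L hx hch
  have hcirc : torsionCirc h T x = form11 (circLow h x) := torsionCirc_eq L hx hch
  have hcon : torsionContract h T x (sharp h x (ds x)) =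
      form11 fun i j => -I * contractLow h x i j := torsionContract_eq L hx hch hds
  have hI : star I = -I := Complex.conj_I
  -- All terms are now expressed through the four traces of `Th` and the lowered torsion terms, so
  -- each remaining identity is a comparison of coefficients.
  refine ⟨fun i j k l => ?_, ?_, ?_, ?_, ?_, ?_, ?_⟩
  · rw [torsionQuad_eq L hx hch, hR, gauduchonTensor]
  · rw [hdel, hdelbar, form11_add, form11_smul]
    refine Eq.trans ?_ (form11_sub _ _).symm
    refine congrArg form11 (funext fun i => funext fun j => ?_)
    change I * tr1 h x R i j = I * tr1 h x Th i j - _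
    rw [hR, tr1_gauduchonTensor, tr1_torsionQuad]
    ring
  · rw [hdel, hdelbar, hLam, hbox, hcirc, form11_add, form11_smul, form11_smul, form11_smul,
      form11_smul, ricci1, form11_sub, form11_sub, form11_add, form11_sub]
    refine congrArg form11 (funext fun i => funext fun j => ?_)
    change I * tr2 h x R i j = I * tr1 h x Th i j - _ - _ + _ - _
    rw [hR, tr2_gauduchonTensor, tr2_torsionQuad]
    ring
  · rw [hdel, hdelbar, hLam, hbox, hcon, form11_smul, form11_smul, form11_smul, form11_smul,
      form11_smul, ricci1, form11_sub, form11_sub, form11_sub, form11_add, form11_add]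
    refine congrArg form11 (funext fun i => funext fun j => ?_)
    change I * tr3 h x R i j = I * tr1 h x Th i j - _ - _ - _ + _ + _
    rw [hR, tr3_gauduchonTensor, L.tr3_torsionQuad hx]
    ring
  · rw [hdel, hdelbar, hLam, hbox, hcon, conjForm_form11, form11_smul, form11_smul, form11_smul,
      form11_smul, form11_smul, ricci1, form11_sub, form11_sub, form11_sub, form11_add, form11_add]
    refine congrArg form11 (funext fun i => funext fun j => ?_)
    change I * tr4 h x R i j = I * tr1 h x Th i j - _ - _ - _ + _ + _
    -- The conjugate of -√-1 and the sign in `conjForm_form11` combine to -√-1 again, now times the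
    -- conjugate transpose of `contractLow`.
    rw [hR, tr4_gauduchonTensor, L.tr4_torsionQuad hx, star_mul', star_neg, hI]
    ring
  · rw [hdel, formInner_fundForm_form11 L hx, scalar1_eq_trace, scalar1_eq_trace, hR]
    have e : tr1 h x (gauduchonTensor Th (torsionQuad h x) t) = fun i j =>
        tr1 h x Th i j + t * (tr3 h x Th i j + tr4 h x Th i j - 2 * tr1 h x Th i j) := by
      funext i j
      rw [tr1_gauduchonTensor, tr1_torsionQuad, mul_zero, add_zero]
    -- The third and fourth traces have the same full trace, which produces the factor 2.
    rw [e, trace_add, trace_const_mul, trace_sub, trace_add, trace_const_mul, trace_sub,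
      ← trace_tr3_eq_tr4]
    ring
  · rw [hdel, formInner_fundForm_form11 L hx, scalar2_eq_trace, scalar1_eq_trace, hR,
      formInner_del_fundForm_eq L hx, formInner_delStar L hx hds]
    have e : tr3 h x (gauduchonTensor Th (torsionQuad h x) t) = fun i j =>
        tr3 h x Th i j + t * (tr1 h x Th i j + tr2 h x Th i j - 2 * tr3 h x Th i j)
          - t ^ 2 * (boxLow h x i j + contractLow h x i j) := by
      funext i j
      rw [tr3_gauduchonTensor, L.tr3_torsionQuad hx]
      ring
    rw [e, trace_sub, trace_add, trace_const_mul, trace_const_mul, trace_sub, trace_add,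
      trace_const_mul, trace_add, trace_sub, ← trace_tr1_eq_tr2]
    ring
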